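/- **Setting.** Fix $d\in\mathbb N_+$, $\lambda>0$, $0<T<\infty$, and put $\lambda_0=\max(\lambda,1)$, $\mathbb X_t=[0,\infty)\times[0,t]$. Let $l^2$ be the Hilbert space of square-summable sequences $q=(q_0,q_1,\dots)$ with unit vectors $e_i$, and let $$\hat{\mathcal S}^n=\{q\in l^2: q_0=1,\ q_i\ge q_{i+1},\ nq_i\in\{0,\dots,n\}\ \forall i\},\qquad \hat{\mathcal S}=\{q\in l^2: q_0=1,\ q_i\ge q_{i+1},\ 0\le q_i\le 1\ \forall i\}.$$ For $n\ge d$ and $i\ge1$ let $R^n_i(q)=\big[\binom{nq_{i-1}}{d}-\binom{nq_i}{d}\big]/\binom nd$, where $\binom xd=x(x-1)\cdots(x-d+1)/d!$, and $$G^n(q,y)=\sum_{i\ge1}\Big\{\mathbf 1_{[2(i-1)\lambda_0,\,2(i-1)\lambda_0+\lambda R^n_i(q))}(y)-\mathbf 1_{[(2i-1)\lambda_0,\,(2i-1)\lambda_0+q_i-q_{i+1})}(y)\Big\}e_i .$$ Let $G(q,y)$ be given by the same formula with $q_{i-1}^d-q_i^d$ in place of $R^n_i(q)$, and let $$b(q)=\sum_{i\ge1}\big[\lambda(q_{i-1}^d-q_i^d)-(q_i-q_{i+1})\big]e_i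 .$$ Let $\mathbb M$ be the space of Borel measures on $\mathbb X_T$ that are finite on compact sets, with the Borel $\sigma$-algebra of the vague topology, and let $\mathbb D([0,T]:l^2)$ be the space of right continuous paths with left limits, with the Skorokhod topology. Let $N$ be a Poisson random measure on $[0,\infty)\times\mathbb X_T$ with intensity $dr\,dy\,ds$ on a probability space, and let $N^n(B)=\int\mathbf 1_{[0,n]}(r)\mathbf 1_B(y,s)\,N(dr\,dy\,ds)$. For $n\ge d$ and a deterministic $Q^n(0)\in\hat{\mathcal S}^n$, the occupancy process $Q^n$ of the JSQ($d$) system with $n$ servers (arrival rate $n\lambda$, service rate $1$; $Q^n_i(t)$ is the proportion of queues of length at least $i$) is the process with paths in $\mathbb D([0,T]:l^2)$ and values in $\hat{\mathcal S}^n$ that satisfies almost surely $$Q^n(t)=Q^n(0)+\frac1n\int_{\mathbb X_t}G^n(Q^n(s-),y)\,N^n(dy\,ds),\qquad t\in[0,T].$$ **Proposition 2.2 (LLN).** (a) For every $n\ge d$ and $Q^n(0)\in\hat{\mathcal S}^n$ there is a measurable map $\bar{\mathcal G}^n:\mathbb M\to\mathbb D([0,T]:l^2)$ such that, for every such $N$,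 the process $\bar{\mathcal G}^n(\frac1nN^n)$ satisfies the above equation almost surely, and every process $Q^n$ that does so equals $\bar{\mathcal G}^n(\frac1nN^n)$ almost surely. (b) Let $Q(0)\in\hat{\mathcal S}$. There is a unique $Q\in\mathbb C([0,T]:l^2)$ with $$Q(t)=Q(0)+\int_{[0,t]}b(Q(s))\,ds,\qquad t\in[0,T].$$ It takes values in $\hat{\mathcal S}$, and it is also the unique $\hat{\mathcal S}$-valued $Q\in\mathbb C([0,T]:l^2)$ with $Q(t)=Q(0)+\int_{\mathbb X_t}G(Q(s),y)\,dy\,ds$ for all $t\in[0,T]$ (with integrable integrand). Moreover $$\|Q(t)\|_{l^2}^2\le 2\|Q(0)\|_{l^2}^2\,e^{8(\lambda d+1)^2t},\qquad t\in[0,T].$$ If $Q^n(0)\in\hat{\mathcal S}^n$ for $n\ge d$ and $\|Q^n(0)-Q(0)\|_{l^2}\to0$ as $n\to\infty$, then $Q^n$ converges to $Q$ in probability in $\mathbb D([0,T]:l^2)$. -/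

import Mathlib

open MeasureTheory ProbabilityTheory Filter Topology Set
open scoped NNReal ENNReal

namespace JSQ

noncomputable section

/-! ### The state space -/

/-- The Hilbert space `ℓ²` of square-summable real sequences `(q₀, q₁, q₂, …)`. -/
abbrev L2 : Type := lp (fun _ : ℕ => ℝ) 2

/-- The sequences `q ∈ ℓ²` with `q₀ = 1`, `q_i ≥ q_{i+1}` and `0 ≤ q_i ≤ 1` for all `i`. -/
def limitStates : Set L2 :=
  {q | q 0 = 1 ∧ ∀ i, q (i + 1) ≤ q i ∧ 0 ≤ q i ∧ q i ≤ 1}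

/-- The sequences `q ∈ ℓ²` with `q₀ = 1`, `q_i ≥ q_{i+1}` and `n q_i ∈ {0, 1, …, n}` for all `i`. -/
def states (n : ℕ) : Set L2 :=
  {q | q 0 = 1 ∧ ∀ i, q (i + 1) ≤ q i ∧ ∃ k : ℕ, k ≤ n ∧ (n : ℝ) * q i = k}

/-! ### Coefficients -/

/-- The half-line `[0, ∞)`. -/
abbrev Half : Type := Ici (0 : ℝ)

/-- The binomial coefficient `x (x - 1) ⋯ (x - d + 1) / d!`. -/
def binom (x : ℝ) (d : ℕ) : ℝ :=
  (∏ k ∈ Finset.range d, (x - k)) / (d.factorial : ℝ)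

/-- `arrivalRate d n q i` is the probability that an arriving task joins a queue of length
exactly `i`, and so raises coordinate `i + 1` of the occupancy vector `q`:
`[binom(n q_i, d) - binom(n q_{i+1}, d)] / binom(n, d)`. -/
def arrivalRate (d n : ℕ) (q : L2) (i : ℕ) : ℝ :=
  (binom (n * q i) d - binom (n * q (i + 1)) d) / binom n d

/-- The coordinates of the jump coefficient. For `i ≥ 1`, with `λ₀ = max λ 1` and with
`r (i - 1)` the arrival rate into coordinate `i`, coordinate `i` is the indicator of
`[2(i-1)λ₀, 2(i-1)λ₀ + λ r_{i-1})` minus the indicator of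
`[(2i-1)λ₀, (2i-1)λ₀ + (q_i - q_{i+1}))`. Coordinate `0` vanishes. -/
def jumpCoord (lam : ℝ) (r : ℕ → ℝ) (q : L2) (y : Half) : ℕ → ℝ
  | 0 => 0
  | i + 1 =>
    (Ico (2 * i * max lam 1) (2 * i * max lam 1 + lam * r i)).indicator 1 (y : ℝ)
      - (Ico ((2 * i + 1) * max lam 1)
          ((2 * i + 1) * max lam 1 + (q (i + 1) - q (i + 2)))).indicator 1 (y : ℝ)

/-- Only finitely many of the intervals start to the left of a given point. -/
theorem memℓp_jumpCoord (lam : ℝ) (r : ℕ → ℝ) (q : L2) (y : Half) :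
    Memℓp (jumpCoord lam r q y) 2 := by
  refine (memℓp_zero ?_).of_exponent_ge zero_le
  refine (Set.finite_Iic (⌊(y : ℝ)⌋₊ + 1)).subset ?_
  intro j hj
  rcases j with _ | i
  · simp
  by_contra hlt
  apply hj
  have hi : (⌊(y : ℝ)⌋₊ : ℝ) + 1 ≤ i := by
    have : ⌊(y : ℝ)⌋₊ + 1 ≤ i := by
      simp only [Set.mem_Iic, not_le] at hlt
      omega
    exact_mod_cast this
  have hy : (y : ℝ) < i := lt_of_lt_of_le (Nat.lt_floor_add_one _) hi
  have hm : (1 : ℝ) ≤ max lam 1 := le_max_right _ _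
  have hi0 : (0 : ℝ) ≤ i := Nat.cast_nonneg i
  have h1 : (y : ℝ) < 2 * i * max lam 1 := by nlinarith
  have h2 : (y : ℝ) < (2 * i + 1) * max lam 1 := by nlinarith
  have e1 : (y : ℝ) ∉ Ico (2 * i * max lam 1) (2 * i * max lam 1 + lam * r i) :=
    fun h => absurd h.1 (not_le.2 h1)
  have e2 : (y : ℝ) ∉ Ico ((2 * i + 1) * max lam 1)
      ((2 * i + 1) * max lam 1 + (q (i + 1) - q (i + 2))) :=
    fun h => absurd h.1 (not_le.2 h2)
  simp only [jumpCoord]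
  rw [Set.indicator_of_notMem e1, Set.indicator_of_notMem e2, sub_zero]

/-- The `ℓ²`-valued jump coefficient with arrival rates `r`. -/
def jump (lam : ℝ) (r : ℕ → ℝ) (q : L2) (y : Half) : L2 :=
  ⟨jumpCoord lam r q y, memℓp_jumpCoord lam r q y⟩

/-- The jump coefficient `Gⁿ(q, y)` of the system with `n` servers. -/
def Gn (d : ℕ) (lam : ℝ) (n : ℕ) (q : L2) (y : Half) : L2 :=
  jump lam (arrivalRate d n q) q y

/-- The limiting jump coefficient `G(q, y)`, with arrival rates `q_{i-1}^d - q_i^d`. -/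
def G (d : ℕ) (lam : ℝ) (q : L2) (y : Half) : L2 :=
  jump lam (fun i => q i ^ d - q (i + 1) ^ d) q y

/-- The coordinates of the limiting drift: `b_i(q) = λ(q_{i-1}^d - q_i^d) - (q_i - q_{i+1})` for
`i ≥ 1`, and `b_0(q) = 0`. -/
def driftCoord (d : ℕ) (lam : ℝ) (q : L2) : ℕ → ℝ
  | 0 => 0
  | i + 1 => lam * (q i ^ d - q (i + 1) ^ d) - (q (i + 1) - q (i + 2))

theorem memℓp_driftCoord (d : ℕ) (lam : ℝ) (q : L2) : Memℓp (driftCoord d lam q) 2 := by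
  have htwo : 0 < (2 : ℝ≥0∞).toReal := by norm_num
  -- a sequence is square-summable if and only if its shift is
  have shift : ∀ f : ℕ → ℝ, Memℓp (fun i => f (i + 1)) 2 → Memℓp f 2 := fun f hf =>
    memℓp_gen ((summable_nat_add_iff (f := fun i => ‖f i‖ ^ (2 : ℝ≥0∞).toReal) 1).1
      (hf.summable htwo))
  have unshift : ∀ f : ℕ → ℝ, Memℓp f 2 → Memℓp (fun i => f (i + 1)) 2 := fun f hf =>
    memℓp_gen ((summable_nat_add_iff (f := fun i => ‖f i‖ ^ (2 : ℝ≥0∞).toReal) 1).2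
      (hf.summable htwo))
  have subs : ∀ f g : ℕ → ℝ, Memℓp f 2 → Memℓp g 2 → Memℓp (fun i => f i - g i) 2 :=
    fun f g hf hg => Memℓp.sub hf hg
  have h0 : Memℓp (fun i => q i) 2 := lp.memℓp q
  have h1 := unshift (fun i => q i) h0
  have h2 := unshift (fun i => q (i + 1)) h1
  have hpow : Memℓp (fun i => q i ^ d - q (i + 1) ^ d) 2 := by
    rcases d with _ | d
    · simp only [pow_zero, sub_self]
      exact zero_mem_ℓp'
    have hp : Memℓp (fun i => q i ^ (d + 1)) 2 := by
      refine (h0.const_mul (‖q‖ ^ d)).mono' fun i => ?_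
      have hq : ‖q i‖ ≤ ‖q‖ := lp.norm_apply_le_norm (by norm_num) q i
      rw [norm_pow, pow_succ, norm_mul, norm_pow, norm_norm]
      gcongr
    exact subs (fun i => q i ^ (d + 1)) (fun i => q (i + 1) ^ (d + 1)) hp
      (unshift (fun i => q i ^ (d + 1)) hp)
  refine shift (driftCoord d lam q) ?_
  exact subs (fun i => lam * (q i ^ d - q (i + 1) ^ d)) (fun i => q (i + 1) - q (i + 2))
    (hpow.const_mul lam) (subs (fun i => q (i + 1)) (fun i => q (i + 2)) h1 h2)

/-- The limiting drift `b : ℓ² → ℓ²`. -/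
def drift (d : ℕ) (lam : ℝ) (q : L2) : L2 :=
  ⟨driftCoord d lam q, memℓp_driftCoord d lam q⟩

/-! ### Right continuous paths with left limits -/

/-- The space `D([0,T] : E)` of right continuous functions with left limits. -/
structure Cadlag (T : ℝ) (E : Type*) [TopologicalSpace E] where
  /-- the underlying function -/
  toFun : Icc (0 : ℝ) T → E
  right_cont : ∀ t, ContinuousWithinAt toFun (Ici t) t
  left_lim : ∀ t, ∃ l, Tendsto toFun (𝓝[<] t) (𝓝 l)

instance (T : ℝ) (E : Type*) [TopologicalSpace E] :
    CoeFun (Cadlag T E) (fun _ => Icc (0 : ℝ) T → E) :=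
  ⟨Cadlag.toFun⟩

/-- A continuous path, as an element of `D([0,T] : E)`. -/
def Cadlag.ofContinuous {T : ℝ} {E : Type*} [TopologicalSpace E] (x : C(Icc (0 : ℝ) T, E)) :
    Cadlag T E where
  toFun := x
  right_cont _ := x.continuous.continuousWithinAt
  left_lim t := ⟨x t, x.continuous.continuousWithinAt⟩

/-- Skorokhod's distance: the infimum, over the increasing homeomorphisms `θ` of `[0,T]`, of
the larger of `sup_t |θ t - t|` and `sup_t ‖x t - y (θ t)‖`. -/
def skorokhodDist {T : ℝ} {E : Type*} [PseudoEMetricSpace E] (x y : Cadlag T E) : ℝ≥0∞ :=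
  ⨅ θ : Icc (0 : ℝ) T ≃o Icc (0 : ℝ) T,
    max (⨆ t, edist (θ t) t) (⨆ t, edist (x t) (y (θ t)))

theorem skorokhodDist_comm_le {T : ℝ} {E : Type*} [PseudoEMetricSpace E] (x y : Cadlag T E) :
    skorokhodDist x y ≤ skorokhodDist y x := by
  refine le_iInf fun θ => (iInf_le _ θ.symm).trans (max_le_max ?_ ?_)
  · refine iSup_le fun t => le_iSup_of_le (θ.symm t) ?_
    rw [OrderIso.apply_symm_apply, edist_comm]
  · refine iSup_le fun t => le_iSup_of_le (θ.symm t) ?_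
    rw [OrderIso.apply_symm_apply, edist_comm]

theorem skorokhodDist_triangle {T : ℝ} {E : Type*} [PseudoEMetricSpace E]
    (x y z : Cadlag T E) :
    skorokhodDist x z ≤ skorokhodDist x y + skorokhodDist y z := by
  unfold skorokhodDist
  rw [ENNReal.iInf_add]
  refine le_iInf fun θ => ?_
  rw [ENNReal.add_iInf]
  refine le_iInf fun η => (iInf_le _ (θ.trans η)).trans (max_le ?_ ?_)
  · refine iSup_le fun t => ?_
    calc edist (η (θ t)) t ≤ edist (η (θ t)) (θ t) + edist (θ t) t := edist_triangle _ _ _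
      _ = edist (θ t) t + edist (η (θ t)) (θ t) := add_comm _ _
      _ ≤ _ := add_le_add
        ((le_iSup (fun t => edist (θ t) t) t).trans (le_max_left _ _))
        ((le_iSup (fun t => edist (η t) t) (θ t)).trans (le_max_left _ _))
  · refine iSup_le fun t => ?_
    calc edist (x t) (z (η (θ t))) ≤ edist (x t) (y (θ t)) + edist (y (θ t)) (z (η (θ t))) :=
        edist_triangle _ _ _
      _ ≤ _ := add_le_add
        ((le_iSup (fun t => edist (x t) (y (θ t))) t).trans (le_max_right _ _))
        ((le_iSup (fun t => edist (y t) (z (η t))) (θ t)).trans (le_max_right _ _))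

/-- `D([0,T] : E)` with Skorokhod's distance, and hence with the Skorokhod topology. -/
instance (T : ℝ) (E : Type*) [PseudoEMetricSpace E] : PseudoEMetricSpace (Cadlag T E) where
  edist := skorokhodDist
  edist_self x := by
    refine le_antisymm ((iInf_le _ (OrderIso.refl _)).trans ?_) zero_le
    simp
  edist_comm x y := le_antisymm (skorokhodDist_comm_le x y) (skorokhodDist_comm_le y x)
  edist_triangle := skorokhodDist_triangle

/-- `D([0,T] : E)` with the Borel σ-algebra of the Skorokhod topology. -/
instance (T : ℝ) (E : Type*) [PseudoEMetricSpace E] : MeasurableSpace (Cadlag T E) :=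
  borel _

/-! ### Random measures -/

/-- The space of measures on `S` that are finite on compact sets. It carries the σ-algebra
generated by the evaluations `μ ↦ μ A` at the measurable sets `A` (for the locally compact Polish
spaces `S` used here, this is the Borel σ-algebra of the vague topology). -/
def RadonMeasure (S : Type*) [TopologicalSpace S] [MeasurableSpace S] : Type _ :=
  {μ : Measure S // IsFiniteMeasureOnCompacts μ}

instance (S : Type*) [TopologicalSpace S] [MeasurableSpace S] :
    MeasurableSpace (RadonMeasure S) :=
  inferInstanceAs (MeasurableSpace {μ : Measure S // IsFiniteMeasureOnCompacts μ})

/-- `N` is a Poisson random measure on `S` with intensity `ν`: a random element of the space of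
measures finite on compacts such that `N(H)` is Poisson with mean `ν(H)` for every measurable `H`
with `ν(H) < ∞`, and `N(H₁), …, N(H_k)` are independent for disjoint measurable `H₁, …, H_k`. -/
structure IsPoissonRandomMeasure {Ω S : Type*} [MeasurableSpace Ω] [TopologicalSpace S]
    [MeasurableSpace S] (ν : Measure S) (N : Ω → RadonMeasure S) (P : Measure Ω) : Prop where
  measurable : Measurable N
  law : ∀ H, MeasurableSet H → ν H < ∞ →
    P.map (fun ω => (N ω).1 H) =
      (poissonMeasure (ν H).toNNReal).map (Nat.cast : ℕ → ℝ≥0∞)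
  indep : ∀ (k : ℕ) (H : Fin k → Set S), (∀ i, MeasurableSet (H i)) →
    Pairwise (fun i j => Disjoint (H i) (H j)) → iIndepFun (fun i ω => (N ω).1 (H i)) P

/-- The space `𝕏_T = [0, ∞) × [0, T]`, with points `(y, s)`. -/
abbrev MarkTime (T : ℝ) : Type := Half × Icc (0 : ℝ) T

/-- Lebesgue measure `dy` on `[0, ∞)`. -/
def lebHalf : Measure Half := (volume : Measure ℝ).comap Subtype.val

/-- Lebesgue measure `ds` on `[0, T]`. -/
def lebTime (T : ℝ) : Measure (Icc (0 : ℝ) T) := (volume : Measure ℝ).comap Subtype.val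

/-- Lebesgue measure `dy ds` on `𝕏_T`. -/
def lebMarkTime (T : ℝ) : Measure (MarkTime T) := lebHalf.prod (lebTime T)

/-- Lebesgue measure `dr dy ds` on `[0, ∞) × 𝕏_T`. -/
def intensity (T : ℝ) : Measure (Half × MarkTime T) := lebHalf.prod (lebMarkTime T)

/-- The measure `Nⁿ(B) = ∫ 1_{[0,n]}(r) 1_B(y, s) N(dr dy ds)` on `𝕏_T` obtained from a measure
`N` on `[0, ∞) × 𝕏_T`. -/
def thin {T : ℝ} (n : ℕ) (μ : RadonMeasure (Half × MarkTime T)) : RadonMeasure (MarkTime T) :=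
  ⟨(μ.1.restrict {p | (p.1 : ℝ) ≤ n}).map Prod.snd, by
    refine ⟨fun K hK => ?_⟩
    have hset : MeasurableSet {p : Half × MarkTime T | (p.1 : ℝ) ≤ n} :=
      measurableSet_le (by fun_prop) measurable_const
    rw [Measure.map_apply measurable_snd hK.measurableSet,
      Measure.restrict_apply (measurable_snd hK.measurableSet)]
    have hc : IsCompact ((Subtype.val : Half → ℝ) ⁻¹' Icc (0 : ℝ) n) :=
      isClosed_Ici.isClosedEmbedding_subtypeVal.isCompact_preimage isCompact_Icc
    have hμ := μ.2
    refine lt_of_le_of_lt (measure_mono ?_) (hc.prod hK).measure_lt_top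
    rintro ⟨r, p⟩ ⟨hp, hr⟩
    exact ⟨⟨r.2, hr⟩, hp⟩⟩

/-- The scaled measure `Nⁿ / n`. -/
def scaledThin {T : ℝ} (n : ℕ) (μ : RadonMeasure (Half × MarkTime T)) :
    RadonMeasure (MarkTime T) :=
  ⟨(n : ℝ≥0)⁻¹ • (thin n μ).1, by
    have := (thin n μ).2
    infer_instance⟩

/-! ### The occupancy process and its limit -/

/-- The path `x` in `D([0,T] : ℓ²)` solves the evolution equation of the occupancy process of the
JSQ(`d`) system with `n` servers, started from `q₀` and driven by the measure `μ` on `𝕏_T`: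
`x(t) = q₀ + (1/n) ∫_{[0,∞)×[0,t]} Gⁿ(x(s-), y) μ(dy ds)` for all `t ∈ [0,T]`. -/
structure IsOccupancyPath {T : ℝ} (d : ℕ) (lam : ℝ) (n : ℕ) (q₀ : L2)
    (μ : RadonMeasure (MarkTime T)) (x : Cadlag T L2) : Prop where
  mem_states : ∀ t, x t ∈ states n
  integrable : Integrable (fun p : MarkTime T => Gn d lam n (Function.leftLim x p.2) p.1) μ.1
  equation : ∀ t, x t = q₀ + (n : ℝ)⁻¹ •
    ∫ p in {p : MarkTime T | p.2 ≤ t}, Gn d lam n (Function.leftLim x p.2) p.1 ∂μ.1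

/-- `Qⁿ` is the occupancy process, driven by `Nⁿ`, of the JSQ(`d`) system with `n` servers. -/
def IsOccupancyProcess {Ω : Type*} [MeasurableSpace Ω] {T : ℝ} (d : ℕ) (lam : ℝ) (n : ℕ)
    (q₀ : L2) (N : Ω → RadonMeasure (Half × MarkTime T)) (P : Measure Ω)
    (Qn : Ω → Cadlag T L2) : Prop :=
  ∀ᵐ ω ∂P, IsOccupancyPath d lam n q₀ (thin n (N ω)) (Qn ω)

/-- `x(t) = q₀ + ∫_{[0,t]} b(x(s)) ds` for all `t ∈ [0,T]`. -/
def SolvesDriftEquation {T : ℝ} (d : ℕ) (lam : ℝ) (q₀ : L2) (x : C(Icc (0 : ℝ) T, L2)) : Prop :=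
  ∀ t, x t = q₀ + ∫ s in Iic t, drift d lam (x s) ∂lebTime T

/-- `x(t) = q₀ + ∫_{[0,∞)×[0,t]} G(x(s), y) dy ds` for all `t ∈ [0,T]`, where `x` takes its
values in the domain of `G` and the integrand is integrable. -/
structure SolvesJumpEquation {T : ℝ} (d : ℕ) (lam : ℝ) (q₀ : L2)
    (x : C(Icc (0 : ℝ) T, L2)) : Prop where
  mem_states : ∀ t, x t ∈ limitStates
  integrable : Integrable (fun p : MarkTime T => G d lam (x p.2) p.1) (lebMarkTime T)
  equation : ∀ t, x t = q₀ + ∫ p in {p : MarkTime T | p.2 ≤ t}, G d lam (x p.2) p.1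
    ∂lebMarkTime T

end

end JSQ

/-! Part (a) is a pathwise statement. Almost surely the points of the driving measure with marks
below a level `K` are finite in number and have distinct positive times. Infinitely many points with
larger marks remain, so a priori the path could use all of them. But coordinate `i + 1` can only be
raised by a mark in `strip T lam i`. These strips are disjoint and equally charged, so almost surely
infinitely many of them are empty, and an empty strip beyond the support of the initial state bounds
the queue lengths for all times. The equation is then a finite recursion over finitely many points.
The properties of the measure that are needed form the measurable event `Good`, which has
probability one (`IsPoissonField.ae_good`).

For measurability of the solution map, take a dyadic grid so fine that each block contains at most
one relevant point. Freezing the state over a block is then exact, so the path agrees at grid points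
with an Euler scheme (`Good.euler_identity`), which is a measurable function of the measure with
values in a countable set. A step path is the Skorokhod limit of its grid samples, and
`measurable_of_grid` concludes.

In part (b) the drift is locally Lipschitz on `ℓ²`, which gives uniqueness and, by Grönwall, the
norm bound. For existence inside `limitStates`, put `α = λ d + 1`. Multiplied by the integrating
factor `exp (α t)`, the equation says that `x t` is a weighted average of `q₀` and of the Euler
steps `x s + α⁻¹ b (x s)`, `s ≤ t`. The steps preserve the closed convex set `limitStates`, so a
contraction argument can be run within it.

For the convergence, the mean jump `nDrift` differs from the drift by at most `ε ‖q‖`, since the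
binomial ratios approach the powers in the Lipschitz sense. The compensated noise of the Euler
scheme has mean square at most `2 (λ + 1) T / n` in `ℓ²`, uniformly in the mesh, because jumps have
size `1 / n` and the total rate is at most `n (λ + 1)`. Freezing the noise once it is large turns
the bound at the final time into a bound at all grid times (`IsPoissonField.measure_chain_le`). A
discrete Grönwall inequality (`euler_stability`) compares path and limit on the grid, and right
continuity removes the grid. As the limit is continuous, uniform closeness is enough for Skorokhod's
distance. -/

namespace JSQ

noncomputable section

/-! ### Deterministic estimates: norms, states, jump coefficients, drifts. -/

/-! ### Norm estimates in `ℓ²` -/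

theorem summable_sq (q : L2) : Summable fun i => q i ^ 2 := by
  have h := (lp.memℓp q).summable (by norm_num : 0 < (2 : ℝ≥0∞).toReal)
  simpa using h

theorem norm_sq_eq_tsum (q : L2) : ‖q‖ ^ 2 = ∑' i, q i ^ 2 := by
  have h := lp.norm_rpow_eq_tsum (by norm_num : 0 < (2 : ℝ≥0∞).toReal) q
  simpa using h

theorem abs_apply_le_norm (q : L2) (i : ℕ) : |q i| ≤ ‖q‖ :=
  lp.norm_apply_le_norm (by norm_num) q i

theorem tendsto_apply_zero (q : L2) : Tendsto (fun i => q i) atTop (𝓝 0) := by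
  have h := (summable_sq q).tendsto_atTop_zero
  have h2 := (Real.continuous_sqrt.tendsto 0).comp h
  simp only [Real.sqrt_zero, Function.comp_def, Real.sqrt_sq_eq_abs] at h2
  exact (tendsto_zero_iff_abs_tendsto_zero _).2 h2

/-- An `ℓ²` bound from a coordinatewise bound by three consecutive coordinates. -/
theorem norm_le_of_coord {f u : L2} {c : ℝ} (hc : 0 ≤ c) (h0 : f 0 = 0)
    (h : ∀ i, |f (i + 1)| ≤ c * (|u i| + |u (i + 1)| + |u (i + 2)|)) :
    ‖f‖ ≤ 3 * c * ‖u‖ := by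
  refine le_of_sq_le_sq ?_ (by positivity)
  rw [mul_pow, norm_sq_eq_tsum, norm_sq_eq_tsum u]
  have s0 := summable_sq u
  have s1 := (summable_nat_add_iff (f := fun i => u i ^ 2) 1).2 s0
  have s2 := (summable_nat_add_iff (f := fun i => u i ^ 2) 2).2 s0
  have t1 : ∑' i, u (i + 1) ^ 2 ≤ ∑' i, u i ^ 2 := by
    have := s0.sum_add_tsum_nat_add 1
    have h1 : 0 ≤ ∑ i ∈ Finset.range 1, u i ^ 2 := Finset.sum_nonneg fun i _ => sq_nonneg _
    linarith
  have t2 : ∑' i, u (i + 2) ^ 2 ≤ ∑' i, u i ^ 2 := by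
    have := s0.sum_add_tsum_nat_add 2
    have h1 : 0 ≤ ∑ i ∈ Finset.range 2, u i ^ 2 := Finset.sum_nonneg fun i _ => sq_nonneg _
    linarith
  rw [(summable_sq f).tsum_eq_zero_add, h0]
  -- Origin of the constant: Cauchy–Schwarz for three terms gives one factor `3`, and the three
  -- shifted sums, each at most `‖u‖ ^ 2`, give another; `9 = 3 ^ 2`.
  have key : ∀ i, f (i + 1) ^ 2 ≤ 3 * c ^ 2 * (u i ^ 2 + u (i + 1) ^ 2 + u (i + 2) ^ 2) := by
    intro i
    have h1 : f (i + 1) ^ 2 ≤ (c * (|u i| + |u (i + 1)| + |u (i + 2)|)) ^ 2 := by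
      rw [← sq_abs]; exact pow_le_pow_left₀ (abs_nonneg _) (h i) 2
    refine h1.trans ?_
    rw [mul_pow, ← sq_abs (u i), ← sq_abs (u (i + 1)), ← sq_abs (u (i + 2))]
    have h2 : (|u i| + |u (i + 1)| + |u (i + 2)|) ^ 2
        ≤ 3 * (|u i| ^ 2 + |u (i + 1)| ^ 2 + |u (i + 2)| ^ 2) := by
      nlinarith [sq_nonneg (|u i| - |u (i + 1)|), sq_nonneg (|u i| - |u (i + 2)|),
        sq_nonneg (|u (i + 1)| - |u (i + 2)|)]
    nlinarith [sq_nonneg c]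
  have hs := ((s0.add s1).add s2).mul_left (3 * c ^ 2)
  have hle := Summable.tsum_le_tsum key
    ((summable_nat_add_iff (f := fun i => f i ^ 2) 1).2 (summable_sq f)) hs
  rw [tsum_mul_left, (s0.add s1).tsum_add s2, s0.tsum_add s1] at hle
  have : (∑' i, u i ^ 2) + (∑' i, u (i + 1) ^ 2) + (∑' i, u (i + 2) ^ 2)
      ≤ 3 * ∑' i, u i ^ 2 := by linarith
  nlinarith [sq_nonneg c]

/-! ### Powers and binomial ratios -/

theorem abs_pow_sub_pow_le_of_le (d : ℕ) {R x y : ℝ} (hx : |x| ≤ R) (hy : |y| ≤ R) :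
    |x ^ d - y ^ d| ≤ d * R ^ (d - 1) * |x - y| := by
  have h := abs_pow_sub_pow_le x y d
  refine h.trans ?_
  have hm : max |x| |y| ≤ R := max_le hx hy
  have hR : 0 ≤ R := (abs_nonneg x).trans hx
  have h3 : max |x| |y| ^ (d - 1) ≤ R ^ (d - 1) :=
    pow_le_pow_left₀ ((abs_nonneg x).trans (le_max_left _ _)) hm _
  nlinarith [mul_le_mul_of_nonneg_left h3
    (mul_nonneg (abs_nonneg (x - y)) (Nat.cast_nonneg (α := ℝ) d))]

theorem binom_natCast (k d : ℕ) : binom k d = (k.choose d : ℝ) := by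
  unfold binom
  have h : (d.factorial : ℝ) ≠ 0 := by positivity
  rw [← descPochhammer_eval_eq_prod_range, descPochhammer_eval_eq_descFactorial,
    Nat.descFactorial_eq_factorial_mul_choose, div_eq_iff h]
  push_cast
  ring

theorem binom_pos {d n : ℕ} (h : d ≤ n) : 0 < binom n d := by
  rw [binom_natCast]
  exact_mod_cast Nat.choose_pos h

/-- A product of `d` approximate identities approximates `x ^ d` in the Lipschitz sense. -/
theorem exists_lipschitz_prod_sub_pow (d : ℕ) : ∃ C : ℝ, 0 ≤ C ∧
    ∀ (δ : ℝ) (f : ℕ → ℝ → ℝ), 0 ≤ δ → δ ≤ 1 →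
      (∀ k < d, ∀ x ∈ Icc (0 : ℝ) 1, |f k x - x| ≤ δ) →
      (∀ k < d, ∀ x ∈ Icc (0 : ℝ) 1, ∀ y ∈ Icc (0 : ℝ) 1,
        |(f k x - x) - (f k y - y)| ≤ δ * |x - y|) →
      (∀ x ∈ Icc (0 : ℝ) 1, |∏ k ∈ Finset.range d, f k x - x ^ d| ≤ C * δ) ∧
      ∀ x ∈ Icc (0 : ℝ) 1, ∀ y ∈ Icc (0 : ℝ) 1,
        |(∏ k ∈ Finset.range d, f k x - x ^ d) - (∏ k ∈ Finset.range d, f k y - y ^ d)|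
          ≤ C * δ * |x - y| := by
  induction d with
  | zero => exact ⟨0, le_rfl, fun δ f _ _ _ _ => by simp⟩
  | succ d ih =>
    obtain ⟨C, hC, H⟩ := ih
    -- The four terms of the product rule below contribute `2 C`, `2 C`, `d` and `1` to the
    -- Lipschitz constant; the sup bound would only need `2 C + 1`.
    refine ⟨4 * C + d + 1, by positivity, fun δ f hδ hδ1 hb hl => ?_⟩
    obtain ⟨hB, hL⟩ := H δ f hδ hδ1 (fun k hk => hb k (by omega)) (fun k hk => hl k (by omega))
    have e : ∀ x, ∏ k ∈ Finset.range (d + 1), f k x - x ^ (d + 1)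
        = (∏ k ∈ Finset.range d, f k x - x ^ d) * f d x + x ^ d * (f d x - x) := by
      intro x; rw [Finset.prod_range_succ]; ring
    have hf : ∀ x ∈ Icc (0 : ℝ) 1, |f d x| ≤ 2 := by
      intro x hx
      have h1 := abs_le.1 (hb d (by omega) x hx)
      rw [abs_le]; constructor <;> linarith [h1.1, h1.2, hx.1, hx.2]
    have hp : ∀ x ∈ Icc (0 : ℝ) 1, |x ^ d| ≤ 1 := by
      intro x hx
      rw [abs_of_nonneg (pow_nonneg hx.1 d)]; exact pow_le_one₀ hx.1 hx.2
    constructor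
    · intro x hx
      rw [e]
      refine (abs_add_le _ _).trans ?_
      rw [abs_mul, abs_mul]
      have h1 := mul_le_mul (hB x hx) (hf x hx) (abs_nonneg _) (by positivity)
      have h2 := mul_le_mul (hp x hx) (hb d (by omega) x hx) (abs_nonneg _) zero_le_one
      have hd : (0 : ℝ) ≤ d := Nat.cast_nonneg d
      nlinarith [mul_nonneg hC hδ, mul_nonneg hd hδ]
    · intro x hx y hy
      rw [e, e]
      set E : ℝ → ℝ := fun x => ∏ k ∈ Finset.range d, f k x - x ^ d with hE
      have hxy : |f d x - f d y| ≤ 2 * |x - y| := by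
        have h1 := hl d (by omega) x hx y hy
        have h2 : f d x - f d y = ((f d x - x) - (f d y - y)) + (x - y) := by ring
        rw [h2]
        refine (abs_add_le _ _).trans ?_
        nlinarith [abs_nonneg (x - y)]
      have hpow : |x ^ d - y ^ d| ≤ d * |x - y| := by
        have := abs_pow_sub_pow_le_of_le d (R := 1) (x := x) (y := y)
          (abs_le.2 ⟨by linarith [hx.1], hx.2⟩) (abs_le.2 ⟨by linarith [hy.1], hy.2⟩)
        simpa using this
      have h3 : E x * f d x + x ^ d * (f d x - x) - (E y * f d y + y ^ d * (f d y - y))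
          = (E x - E y) * f d x + E y * (f d x - f d y) + (x ^ d - y ^ d) * (f d x - x)
            + y ^ d * ((f d x - x) - (f d y - y)) := by ring
      show |E x * f d x + x ^ d * (f d x - x) - (E y * f d y + y ^ d * (f d y - y))| ≤ _
      rw [h3]
      have a1 : |(E x - E y) * f d x| ≤ C * δ * |x - y| * 2 := by
        rw [abs_mul]; exact mul_le_mul (hL x hx y hy) (hf x hx) (abs_nonneg _) (by positivity)
      have a2 : |E y * (f d x - f d y)| ≤ C * δ * (2 * |x - y|) := by
        rw [abs_mul]; exact mul_le_mul (hB y hy) hxy (abs_nonneg _) (by positivity)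
      have a3 : |(x ^ d - y ^ d) * (f d x - x)| ≤ d * |x - y| * δ := by
        rw [abs_mul]
        exact mul_le_mul hpow (hb d (by omega) x hx) (abs_nonneg _) (by positivity)
      have a4 : |y ^ d * ((f d x - x) - (f d y - y))| ≤ 1 * (δ * |x - y|) := by
        rw [abs_mul]
        exact mul_le_mul (hp y hy) (hl d (by omega) x hx y hy) (abs_nonneg _) zero_le_one
      refine (abs_add_le _ _).trans ?_
      have b := abs_add_three ((E x - E y) * f d x) (E y * (f d x - f d y))
        ((x ^ d - y ^ d) * (f d x - x))
      linarith

/-- The factorials cancel, and each factor `(n x - k) / (n - k)` is a small perturbation of `x`;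
this is the form required by `exists_lipschitz_prod_sub_pow`. -/
theorem binom_div_eq_prod {d n : ℕ} (h : d ≤ n) (x : ℝ) :
    binom (n * x) d / binom n d = ∏ k ∈ Finset.range d, ((n * x - k) / (n - k)) := by
  unfold binom
  rw [Finset.prod_div_distrib]
  have : (d.factorial : ℝ) ≠ 0 := by positivity
  have h2 : ∏ k ∈ Finset.range d, ((n : ℝ) - k) ≠ 0 := by
    refine Finset.prod_ne_zero_iff.2 fun k hk => ?_
    have : (k : ℝ) < n := by exact_mod_cast lt_of_lt_of_le (Finset.mem_range.1 hk) h
    linarith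
  field_simp

/-- The binomial ratio converges to the power, in the Lipschitz sense on `[0, 1]`. -/
theorem eventually_lipschitz_binom (d : ℕ) {ε : ℝ} (hε : 0 < ε) :
    ∀ᶠ n : ℕ in atTop, ∀ x ∈ Icc (0 : ℝ) 1, ∀ y ∈ Icc (0 : ℝ) 1,
      |(binom (n * x) d / binom n d - x ^ d) - (binom (n * y) d / binom n d - y ^ d)|
        ≤ ε * |x - y| := by
  obtain ⟨C, hC, H⟩ := exists_lipschitz_prod_sub_pow d
  have hlim : Tendsto (fun n : ℕ => (d : ℝ) / ((n : ℝ) - d)) atTop (𝓝 0) :=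
    tendsto_const_nhds.div_atTop (tendsto_atTop_add_const_right _ _ tendsto_natCast_atTop_atTop)
  have hpos : 0 < min 1 (ε / (C + 1)) := by positivity
  filter_upwards [hlim.eventually (gt_mem_nhds hpos), eventually_gt_atTop d] with n hn hnd x hx y hy
  have hdn : (0 : ℝ) < n - d := by
    have : (d : ℝ) < n := by exact_mod_cast hnd
    linarith
  have hδ0 : 0 ≤ (d : ℝ) / (n - d) := by positivity
  have hden : ∀ k < d, (0 : ℝ) < n - k := fun k hk => by
    have : (k : ℝ) < d := by exact_mod_cast hk
    linarith
  have hk : ∀ k < d, (k : ℝ) / (n - k) ≤ d / (n - d) := by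
    intro k hk
    have : (k : ℝ) < d := by exact_mod_cast hk
    exact div_le_div₀ (Nat.cast_nonneg d) this.le hdn (by linarith)
  -- The deviation of a factor from the identity is affine in `x`, so `k / (n - k) ≤ d / (n - d)`
  -- bounds both its size on `[0, 1]` and its Lipschitz constant.
  have hf : ∀ k < d, ∀ x : ℝ, ((n : ℝ) * x - k) / (n - k) - x = -((k : ℝ) / (n - k)) * (1 - x) := by
    intro k hkd x
    have := (hden k hkd).ne'
    field_simp
    ring
  have hk0 : ∀ k < d, (0 : ℝ) ≤ k / (n - k) := fun k h =>
    div_nonneg (Nat.cast_nonneg k) (hden k h).le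
  obtain ⟨-, hL⟩ := H ((d : ℝ) / (n - d)) (fun k x => ((n : ℝ) * x - k) / (n - k)) hδ0
    (hn.le.trans (min_le_left _ _))
    (fun k hkd x hx => by
      rw [hf k hkd, abs_mul, abs_neg, abs_of_nonneg (hk0 k hkd)]
      have h1 : |1 - x| ≤ 1 := abs_le.2 ⟨by linarith [hx.2], by linarith [hx.1]⟩
      nlinarith [hk k hkd, hk0 k hkd])
    (fun k hkd x hx y hy => by
      rw [hf k hkd, hf k hkd]
      have h1 : -((k : ℝ) / (n - k)) * (1 - x) - -((k : ℝ) / (n - k)) * (1 - y)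
        = ((k : ℝ) / (n - k)) * (x - y) := by ring
      rw [h1, abs_mul, abs_of_nonneg (hk0 k hkd)]
      exact mul_le_mul_of_nonneg_right (hk k hkd) (abs_nonneg _))
  have := hL x hx y hy
  rw [binom_div_eq_prod hnd.le, binom_div_eq_prod hnd.le]
  refine this.trans (mul_le_mul_of_nonneg_right ?_ (abs_nonneg _))
  have h2 : (d : ℝ) / (n - d) ≤ ε / (C + 1) := hn.le.trans (min_le_right _ _)
  calc C * (d / (n - d)) ≤ (C + 1) * (ε / (C + 1)) :=
        mul_le_mul (by linarith) h2 hδ0 (by linarith)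
    _ = ε := by field_simp

/-! ### The states -/

theorem states.antitone {n : ℕ} {q : L2} (hq : q ∈ states n) : Antitone fun i => q i :=
  antitone_nat_of_succ_le fun i => (hq.2 i).1

theorem limitStates.antitone {q : L2} (hq : q ∈ limitStates) : Antitone fun i => q i :=
  antitone_nat_of_succ_le fun i => (hq.2 i).1

theorem states_subset_limitStates {n : ℕ} (hn : 0 < n) : states n ⊆ limitStates := by
  intro q hq
  have hn' : (0 : ℝ) < n := by exact_mod_cast hn
  refine ⟨hq.1, fun i => ⟨(hq.2 i).1, ?_, ?_⟩⟩
  · obtain ⟨k, -, hk⟩ := (hq.2 i).2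
    by_contra h
    have : (n : ℝ) * q i < 0 := mul_neg_of_pos_of_neg hn' (not_le.1 h)
    rw [hk] at this
    exact absurd this (not_lt.2 (Nat.cast_nonneg k))
  · rw [← hq.1]; exact states.antitone hq (Nat.zero_le i)

theorem limitStates.mem_Icc {q : L2} (hq : q ∈ limitStates) (i : ℕ) : q i ∈ Icc (0 : ℝ) 1 :=
  (hq.2 i).2

/-- The coordinates tend to `0` but are multiples of `1 / n`, so they vanish once they are below `1
/ n`. -/
theorem states.exists_zero {n : ℕ} (hn : 0 < n) {q : L2} (hq : q ∈ states n) :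
    ∃ m, ∀ i, m ≤ i → q i = 0 := by
  have hn' : (0 : ℝ) < n := by exact_mod_cast hn
  have h : ∀ᶠ i in atTop, q i < (n : ℝ)⁻¹ :=
    (tendsto_apply_zero q).eventually (gt_mem_nhds (by positivity))
  obtain ⟨m, hm⟩ := eventually_atTop.1 h
  refine ⟨m, fun i hi => ?_⟩
  obtain ⟨k, -, hk⟩ := (hq.2 i).2
  have h1 : (n : ℝ) * q i < 1 := by
    have := mul_lt_mul_of_pos_left (hm i hi) hn'
    rwa [mul_inv_cancel₀ hn'.ne'] at this
  rw [hk] at h1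
  have : k = 0 := by
    have : k < 1 := by exact_mod_cast h1
    omega
  rw [this, Nat.cast_zero] at hk
  exact (mul_eq_zero.1 hk).resolve_left hn'.ne'

theorem states.eq_div {n : ℕ} (hn : 0 < n) {q : L2} (hq : q ∈ states n) (i : ℕ) :
    ∃ k : ℕ, k ≤ n ∧ q i = k / n := by
  have hn' : (0 : ℝ) < n := by exact_mod_cast hn
  obtain ⟨k, hk, h⟩ := (hq.2 i).2
  exact ⟨k, hk, by rw [← h]; field_simp⟩

/-- Distinct values differ by at least `1 / n`. -/
theorem states.add_inv_le {n : ℕ} (hn : 0 < n) {q : L2} (hq : q ∈ states n) {i j : ℕ}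
    (h : q i < q j) : q i + (n : ℝ)⁻¹ ≤ q j := by
  have hn' : (0 : ℝ) < n := by exact_mod_cast hn
  obtain ⟨k, -, hk⟩ := states.eq_div hn hq i
  obtain ⟨l, -, hl⟩ := states.eq_div hn hq j
  rw [hk, hl] at h ⊢
  rw [div_lt_div_iff_of_pos_right hn'] at h
  have : (k : ℝ) + 1 ≤ l := by exact_mod_cast h
  rw [inv_eq_one_div, ← add_div]
  exact div_le_div_of_nonneg_right this hn'.le

/-- A state is encoded by the finitely supported integer sequence `n q_i`. Countability is what
later reduces measurability of state-valued maps to that of their fibres. -/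
theorem countable_states {n : ℕ} (hn : 0 < n) : (states n).Countable := by
  classical
  have hfin : ∀ q : states n, (Function.support fun i => ⌊(n : ℝ) * (q : L2) i⌋₊).Finite := by
    intro q
    obtain ⟨m, hm⟩ := states.exists_zero hn q.2
    refine (finite_lt_nat m).subset fun i hi => ?_
    by_contra h
    exact hi (by simp [hm i (not_lt.1 h)])
  have : Function.Injective fun q : states n =>
      Finsupp.ofSupportFinite (fun i => ⌊(n : ℝ) * (q : L2) i⌋₊) (hfin q) := by
    intro q q' h
    apply Subtype.ext
    refine lp.ext (funext fun i => ?_)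
    have h1 := DFunLike.congr_fun h i
    simp only [Finsupp.ofSupportFinite_coe] at h1
    obtain ⟨k, -, hk⟩ := (q.2.2 i).2
    obtain ⟨k', -, hk'⟩ := (q'.2.2 i).2
    rw [hk, hk', Nat.floor_natCast, Nat.floor_natCast] at h1
    have hn' : (n : ℝ) ≠ 0 := by exact_mod_cast hn.ne'
    exact mul_left_cancel₀ hn' (by rw [hk, hk', h1])
  exact this.countable

/-! ### Arrival rates -/

theorem binom_states_mono {d n : ℕ} {q : L2} (hq : q ∈ states n) {i j : ℕ} (h : i ≤ j) :
    binom (n * q j) d ≤ binom (n * q i) d := by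
  obtain ⟨k, -, hk⟩ := (hq.2 i).2
  obtain ⟨l, -, hl⟩ := (hq.2 j).2
  rw [hk, hl, binom_natCast, binom_natCast]
  have h1 : (l : ℝ) ≤ k := by
    rw [← hk, ← hl]
    exact mul_le_mul_of_nonneg_left (states.antitone hq h) (Nat.cast_nonneg n)
  exact_mod_cast Nat.choose_le_choose d (by exact_mod_cast h1)

theorem binom_states_nonneg {d n : ℕ} {q : L2} (hq : q ∈ states n) (i : ℕ) :
    0 ≤ binom (n * q i) d := by
  obtain ⟨k, -, hk⟩ := (hq.2 i).2
  rw [hk, binom_natCast]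
  exact Nat.cast_nonneg _

theorem arrivalRate_nonneg {d n : ℕ} (h : d ≤ n) {q : L2} (hq : q ∈ states n) (i : ℕ) :
    0 ≤ arrivalRate d n q i :=
  div_nonneg (sub_nonneg.2 (binom_states_mono hq (Nat.le_succ i))) (binom_pos h).le

theorem sum_arrivalRate (d n : ℕ) (q : L2) (m : ℕ) :
    ∑ i ∈ Finset.range m, arrivalRate d n q i
      = (binom (n * q 0) d - binom (n * q m) d) / binom n d := by
  unfold arrivalRate
  rw [← Finset.sum_div]
  congr 1
  exact Finset.sum_range_sub' (fun i => binom (n * q i) d) m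

theorem sum_arrivalRate_le_one {d n : ℕ} (h : d ≤ n) {q : L2} (hq : q ∈ states n) (m : ℕ) :
    ∑ i ∈ Finset.range m, arrivalRate d n q i ≤ 1 := by
  rw [sum_arrivalRate, div_le_one (binom_pos h), hq.1, mul_one]
  linarith [binom_states_nonneg (d := d) hq m]

theorem arrivalRate_le_one {d n : ℕ} (h : d ≤ n) {q : L2} (hq : q ∈ states n) (i : ℕ) :
    arrivalRate d n q i ≤ 1 :=
  (Finset.single_le_sum (fun j _ => arrivalRate_nonneg h hq j)
    (Finset.mem_range.2 (Nat.lt_succ_self i))).trans (sum_arrivalRate_le_one h hq (i + 1))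

theorem arrivalRate_eq_zero {d n : ℕ} {q : L2} {i : ℕ} (h : q i = q (i + 1)) :
    arrivalRate d n q i = 0 := by
  unfold arrivalRate; rw [h, sub_self, zero_div]

/-! ### The jump coefficient -/

/-- The window of marks that raise coordinate `i + 1`. -/
def arrWin (lam : ℝ) (r : ℕ → ℝ) (i : ℕ) : Set ℝ :=
  Ico (2 * i * max lam 1) (2 * i * max lam 1 + lam * r i)

/-- The window of marks that lower coordinate `i + 1`. -/
def depWin (lam : ℝ) (q : L2) (i : ℕ) : Set ℝ :=
  Ico ((2 * i + 1) * max lam 1) ((2 * i + 1) * max lam 1 + (q (i + 1) - q (i + 2)))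

theorem jump_zero (lam : ℝ) (r : ℕ → ℝ) (q : L2) (y : Half) : jump lam r q y 0 = 0 := rfl

theorem jump_succ (lam : ℝ) (r : ℕ → ℝ) (q : L2) (y : Half) (i : ℕ) :
    jump lam r q y (i + 1)
      = (arrWin lam r i).indicator 1 (y : ℝ) - (depWin lam q i).indicator 1 (y : ℝ) := rfl

/-- Windows start at multiples of `λ₀ = max lam 1`, even ones for arrivals and odd ones for
departures, and have length at most `λ₀`. Hence `⌊y / λ₀⌋` identifies the only window that can
contain `y`, and a jump is zero or plus or minus a single unit vector. -/
theorem floor_of_mem_arrWin {lam : ℝ} (hlam : 0 < lam) {r : ℕ → ℝ} {i : ℕ} (hr : r i ≤ 1)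
    {y : ℝ} (hy : y ∈ arrWin lam r i) : ⌊y / max lam 1⌋₊ = 2 * i := by
  have hm : (0 : ℝ) < max lam 1 := lt_of_lt_of_le one_pos (le_max_right _ _)
  have h1 : lam * r i ≤ max lam 1 := by
    have := le_max_left lam 1
    nlinarith
  have hy1 := hy.1
  have hy2 := hy.2
  have hi : (0 : ℝ) ≤ i := Nat.cast_nonneg i
  rw [Nat.floor_eq_iff (by apply div_nonneg _ hm.le; nlinarith)]
  rw [le_div_iff₀ hm, div_lt_iff₀ hm]
  push_cast
  constructor <;> nlinarith

theorem floor_of_mem_depWin {lam : ℝ} {q : L2} {i : ℕ}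
    (hq : q (i + 1) - q (i + 2) ≤ 1) {y : ℝ} (hy : y ∈ depWin lam q i) :
    ⌊y / max lam 1⌋₊ = 2 * i + 1 := by
  have hm : (0 : ℝ) < max lam 1 := lt_of_lt_of_le one_pos (le_max_right _ _)
  have h1 := le_max_right lam 1
  have hy1 := hy.1
  have hy2 := hy.2
  have hi : (0 : ℝ) ≤ i := Nat.cast_nonneg i
  rw [Nat.floor_eq_iff (by apply div_nonneg _ hm.le; nlinarith)]
  rw [le_div_iff₀ hm, div_lt_iff₀ hm]
  push_cast
  constructor <;> nlinarith

theorem jump_of_mem_arrWin {lam : ℝ} (hlam : 0 < lam) {r : ℕ → ℝ} (hr : ∀ i, r i ≤ 1) {q : L2}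
    (hq : ∀ i, q (i + 1) - q (i + 2) ≤ 1) {y : Half} {i : ℕ} (hy : (y : ℝ) ∈ arrWin lam r i) :
    jump lam r q y = lp.single 2 (i + 1) 1 := by
  have hf := floor_of_mem_arrWin hlam (hr i) hy
  refine lp.ext (funext fun j => ?_)
  rw [lp.single_apply]
  rcases j with _ | j
  · rw [jump_zero, Pi.single_eq_of_ne (by omega)]
  rw [jump_succ]
  have h2 : (y : ℝ) ∉ depWin lam q j := fun h => by
    have := floor_of_mem_depWin (hq j) h
    omega
  rw [indicator_of_notMem h2, sub_zero]
  by_cases hij : j = i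
  · subst hij
    rw [indicator_of_mem hy, Pi.single_eq_same, Pi.one_apply]
  · have h1 : (y : ℝ) ∉ arrWin lam r j := fun h => by
      have := floor_of_mem_arrWin hlam (hr j) h
      omega
    rw [indicator_of_notMem h1, Pi.single_eq_of_ne (by omega)]

theorem jump_of_mem_depWin {lam : ℝ} (hlam : 0 < lam) {r : ℕ → ℝ} (hr : ∀ i, r i ≤ 1) {q : L2}
    (hq : ∀ i, q (i + 1) - q (i + 2) ≤ 1) {y : Half} {i : ℕ} (hy : (y : ℝ) ∈ depWin lam q i) :
    jump lam r q y = -lp.single 2 (i + 1) 1 := by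
  have hf := floor_of_mem_depWin (hq i) hy
  refine lp.ext (funext fun j => ?_)
  rw [lp.coeFn_neg, Pi.neg_apply, lp.single_apply]
  rcases j with _ | j
  · rw [jump_zero, Pi.single_eq_of_ne (by omega), neg_zero]
  rw [jump_succ]
  have h2 : (y : ℝ) ∉ arrWin lam r j := fun h => by
    have := floor_of_mem_arrWin hlam (hr j) h
    omega
  rw [indicator_of_notMem h2, zero_sub]
  by_cases hij : j = i
  · subst hij
    rw [indicator_of_mem hy, Pi.single_eq_same, Pi.one_apply]
  · have h1 : (y : ℝ) ∉ depWin lam q j := fun h => by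
      have := floor_of_mem_depWin (hq j) h
      omega
    rw [indicator_of_notMem h1, Pi.single_eq_of_ne (by omega)]

theorem jump_of_notMem {lam : ℝ} {r : ℕ → ℝ} {q : L2} {y : Half}
    (h1 : ∀ i, (y : ℝ) ∉ arrWin lam r i) (h2 : ∀ i, (y : ℝ) ∉ depWin lam q i) :
    jump lam r q y = 0 := by
  refine lp.ext (funext fun j => ?_)
  rcases j with _ | j
  · rfl
  · rw [jump_succ, indicator_of_notMem (h1 j), indicator_of_notMem (h2 j), sub_zero]; rfl

theorem norm_jump_le_indicator {lam : ℝ} (hlam : 0 < lam) {r : ℕ → ℝ} (hr : ∀ i, r i ≤ 1) {q : L2}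
    (hq : ∀ i, q (i + 1) - q (i + 2) ≤ 1) (y : Half) :
    ‖jump lam r q y‖ ≤
      ((⋃ i, arrWin lam r i) ∪ ⋃ i, depWin lam q i).indicator (1 : ℝ → ℝ) y := by
  by_cases h1 : ∃ i, (y : ℝ) ∈ arrWin lam r i
  · obtain ⟨i, hi⟩ := h1
    rw [jump_of_mem_arrWin hlam hr hq hi, indicator_of_mem (mem_union_left _ (mem_iUnion.2 ⟨i, hi⟩)),
      lp.norm_single (by norm_num)]
    simp
  by_cases h2 : ∃ i, (y : ℝ) ∈ depWin lam q i
  · obtain ⟨i, hi⟩ := h2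
    rw [jump_of_mem_depWin hlam hr hq hi, indicator_of_mem (mem_union_right _ (mem_iUnion.2 ⟨i, hi⟩)),
      norm_neg, lp.norm_single (by norm_num)]
    simp
  · push Not at h1 h2
    rw [jump_of_notMem h1 h2, norm_zero]
    exact indicator_nonneg (fun _ _ => zero_le_one) _

theorem limitStates.sub_le_one {q : L2} (hq : q ∈ limitStates) (i j : ℕ) : q i - q j ≤ 1 := by
  linarith [(limitStates.mem_Icc hq i).2, (limitStates.mem_Icc hq j).1]

/-- The windows are empty for the coordinates at which `q` vanishes. -/
theorem lt_of_mem_window {d n : ℕ} {lam : ℝ} (hlam : 0 < lam) (hn : d ≤ n) (hn0 : 0 < n) {q : L2}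
    (hq : q ∈ states n) {m : ℕ} (hm : ∀ i, m ≤ i → q i = 0) {y : ℝ} {i : ℕ}
    (hy : y ∈ arrWin lam (arrivalRate d n q) i ∨ y ∈ depWin lam q i) :
    y < (2 * m + 2) * max lam 1 := by
  have hm1 : (0 : ℝ) < max lam 1 := lt_of_lt_of_le one_pos (le_max_right _ _)
  by_contra hlt
  -- A mark this large can only lie in a window with index `i > m`; there the neighbouring
  -- coordinates are both `0` and the window is empty.
  have hfl : 2 * m + 2 ≤ ⌊y / max lam 1⌋₊ := by
    apply Nat.le_floor
    rw [le_div_iff₀ hm1]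
    push_cast
    linarith
  rcases hy with h | h
  · have h1 := floor_of_mem_arrWin hlam (arrivalRate_le_one hn hq i) h
    have h2 : arrivalRate d n q i = 0 :=
      arrivalRate_eq_zero (by rw [hm i (by omega), hm (i + 1) (by omega)])
    simp [arrWin, h2] at h
  · have h1 := floor_of_mem_depWin
      (limitStates.sub_le_one (states_subset_limitStates hn0 hq) (i + 1) (i + 2)) h
    have h2 : q (i + 1) - q (i + 2) = 0 := by
      rw [hm (i + 1) (by omega), hm (i + 2) (by omega), sub_zero]
    simp [depWin, h2] at h

theorem Gn_eq_zero_of_le {d n : ℕ} {lam : ℝ} (hlam : 0 < lam) (hn : d ≤ n) (hn0 : 0 < n) {q : L2}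
    (hq : q ∈ states n) {m : ℕ} (hm : ∀ i, m ≤ i → q i = 0) {y : Half}
    (hy : (2 * m + 2) * max lam 1 ≤ (y : ℝ)) : Gn d lam n q y = 0 :=
  jump_of_notMem
    (fun _ h => not_lt.2 hy (lt_of_mem_window hlam hn hn0 hq hm (Or.inl h)))
    (fun _ h => not_lt.2 hy (lt_of_mem_window hlam hn hn0 hq hm (Or.inr h)))

/-- A window that contains a point is nonempty, so the two coordinates that determine its length
differ, hence by at least `1 / n`. This leaves room for the jump without breaking monotonicity or
the bounds. -/
theorem add_jump_mem_states {d n : ℕ} {lam : ℝ} (hlam : 0 < lam) (hn : d ≤ n) (hn0 : 0 < n)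
    {q : L2} (hq : q ∈ states n) (y : Half) :
    q + (n : ℝ)⁻¹ • Gn d lam n q y ∈ states n := by
  have hn' : (0 : ℝ) < n := by exact_mod_cast hn0
  have hL := states_subset_limitStates hn0 hq
  have hr := arrivalRate_le_one hn hq
  have hd := fun i => limitStates.sub_le_one hL (i + 1) (i + 2)
  by_cases h1 : ∃ i, (y : ℝ) ∈ arrWin lam (arrivalRate d n q) i
  · obtain ⟨i, hi⟩ := h1
    unfold Gn
    rw [jump_of_mem_arrWin hlam hr hd hi]
    have hlt : q (i + 1) < q i := by
      refine lt_of_le_of_ne (hq.2 i).1 fun h => ?_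
      simp [arrWin, arrivalRate_eq_zero h.symm] at hi
    have hstep := states.add_inv_le hn0 hq hlt
    have hval : ∀ j, (q + (n : ℝ)⁻¹ • lp.single 2 (i + 1) (1 : ℝ) : L2) j
        = q j + if j = i + 1 then (n : ℝ)⁻¹ else 0 := by
      intro j
      rw [lp.coeFn_add, Pi.add_apply, lp.coeFn_smul, Pi.smul_apply, lp.single_apply,
        Pi.single_apply]
      split_ifs <;> simp
    refine ⟨by rw [hval, if_neg (by omega), add_zero, hq.1], fun j => ⟨?_, ?_⟩⟩
    · rw [hval, hval]
      have := (hq.2 j).1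
      have hi0 : (0 : ℝ) < (n : ℝ)⁻¹ := by positivity
      rcases eq_or_ne j i with rfl | hj
      · rw [if_pos rfl, if_neg (by omega), add_zero]; exact hstep
      · rw [if_neg (by omega), add_zero]
        split_ifs <;> linarith
    · rw [hval]
      split_ifs with hj
      · subst hj
        obtain ⟨k, hk, hk'⟩ := (hq.2 (i + 1)).2
        refine ⟨k + 1, ?_, by rw [mul_add, hk', mul_inv_cancel₀ hn'.ne']; push_cast; ring⟩
        have : (n : ℝ) * (q (i + 1) + (n : ℝ)⁻¹) ≤ n * 1 :=
          mul_le_mul_of_nonneg_left (hstep.trans (limitStates.mem_Icc hL i).2) hn'.le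
        rw [mul_add, hk', mul_inv_cancel₀ hn'.ne', mul_one] at this
        exact_mod_cast this
      · rw [add_zero]; exact (hq.2 j).2
  by_cases h2 : ∃ i, (y : ℝ) ∈ depWin lam q i
  · obtain ⟨i, hi⟩ := h2
    unfold Gn
    rw [jump_of_mem_depWin hlam hr hd hi]
    have hlt : q (i + 2) < q (i + 1) := by
      refine lt_of_le_of_ne (hq.2 (i + 1)).1 fun h => ?_
      simp [depWin, h] at hi
    have hstep := states.add_inv_le hn0 hq hlt
    have hval : ∀ j, (q + (n : ℝ)⁻¹ • -lp.single 2 (i + 1) (1 : ℝ) : L2) j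
        = q j - if j = i + 1 then (n : ℝ)⁻¹ else 0 := by
      intro j
      rw [lp.coeFn_add, Pi.add_apply, lp.coeFn_smul, Pi.smul_apply, lp.coeFn_neg, Pi.neg_apply,
        lp.single_apply, Pi.single_apply]
      split_ifs <;> simp [sub_eq_add_neg]
    refine ⟨by rw [hval, if_neg (by omega), sub_zero, hq.1], fun j => ⟨?_, ?_⟩⟩
    · rw [hval, hval]
      have := (hq.2 j).1
      have hi0 : (0 : ℝ) < (n : ℝ)⁻¹ := by positivity
      rcases eq_or_ne j (i + 1) with rfl | hj
      · rw [if_pos rfl, if_neg (by omega), sub_zero]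
        linarith
      · rw [if_neg hj, sub_zero]
        split_ifs <;> linarith
    · rw [hval]
      split_ifs with hj
      · subst hj
        obtain ⟨k, hk, hk'⟩ := (hq.2 (i + 1)).2
        have h3 : (n : ℝ) * (q (i + 2) + (n : ℝ)⁻¹) ≤ n * q (i + 1) :=
          mul_le_mul_of_nonneg_left hstep hn'.le
        rw [mul_add, hk', mul_inv_cancel₀ hn'.ne'] at h3
        have h4 : (1 : ℝ) ≤ k := by nlinarith [(limitStates.mem_Icc hL (i + 2)).1]
        have h5 : 1 ≤ k := by exact_mod_cast h4
        refine ⟨k - 1, by omega, ?_⟩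
        rw [mul_sub, hk', mul_inv_cancel₀ hn'.ne', Nat.cast_sub h5, Nat.cast_one]
      · rw [sub_zero]; exact (hq.2 j).2
  · push Not at h1 h2
    unfold Gn
    rw [jump_of_notMem h1 h2, smul_zero, add_zero]
    exact hq

/-! ### The drifts -/

theorem drift_zero (d : ℕ) (lam : ℝ) (q : L2) : drift d lam q 0 = 0 := rfl

theorem drift_succ (d : ℕ) (lam : ℝ) (q : L2) (i : ℕ) :
    drift d lam q (i + 1) = lam * (q i ^ d - q (i + 1) ^ d) - (q (i + 1) - q (i + 2)) := rfl

/-- The bound is stated on sup-norm balls and not only on `limitStates`, since uniqueness is claimed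
among all continuous `ℓ²`-valued solutions. -/
theorem norm_drift_sub_le (d : ℕ) {lam : ℝ} (hlam : 0 < lam) {R : ℝ} {q q' : L2}
    (hq : ∀ i, |q i| ≤ R) (hq' : ∀ i, |q' i| ≤ R) :
    ‖drift d lam q - drift d lam q'‖
      ≤ 3 * (lam * (d * R ^ (d - 1)) + 1) * ‖q - q'‖ := by
  have hR : 0 ≤ R := (abs_nonneg _).trans (hq 0)
  refine norm_le_of_coord (by positivity) (by simp [drift_zero]) fun i => ?_
  simp only [lp.coeFn_sub, Pi.sub_apply, drift_succ]
  have e : lam * (q i ^ d - q (i + 1) ^ d) - (q (i + 1) - q (i + 2))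
      - (lam * (q' i ^ d - q' (i + 1) ^ d) - (q' (i + 1) - q' (i + 2)))
      = lam * (q i ^ d - q' i ^ d) - lam * (q (i + 1) ^ d - q' (i + 1) ^ d)
        - (q (i + 1) - q' (i + 1)) + (q (i + 2) - q' (i + 2)) := by ring
  rw [e]
  have h1 := abs_pow_sub_pow_le_of_le d (hq i) (hq' i)
  have h2 := abs_pow_sub_pow_le_of_le d (hq (i + 1)) (hq' (i + 1))
  set K := (d : ℝ) * R ^ (d - 1) with hK
  have hK0 : 0 ≤ K := by positivity
  have t1 := abs_add_le (lam * (q i ^ d - q' i ^ d) - lam * (q (i + 1) ^ d - q' (i + 1) ^ d)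
        - (q (i + 1) - q' (i + 1))) (q (i + 2) - q' (i + 2))
  have t2 := abs_sub (lam * (q i ^ d - q' i ^ d) - lam * (q (i + 1) ^ d - q' (i + 1) ^ d))
        (q (i + 1) - q' (i + 1))
  have t3 := abs_sub (lam * (q i ^ d - q' i ^ d)) (lam * (q (i + 1) ^ d - q' (i + 1) ^ d))
  rw [abs_mul, abs_mul, abs_of_pos hlam] at t3
  have m1 := mul_le_mul_of_nonneg_left h1 hlam.le
  have m2 := mul_le_mul_of_nonneg_left h2 hlam.le
  have n0 := abs_nonneg (q i - q' i)
  have n2 := mul_nonneg (mul_nonneg hlam.le hK0) (abs_nonneg (q (i + 2) - q' (i + 2)))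
  nlinarith

theorem continuous_drift (d : ℕ) {lam : ℝ} (hlam : 0 < lam) : Continuous (drift d lam) := by
  rw [continuous_iff_continuousAt]
  intro q
  set R := ‖q‖ + 1
  set K := 3 * (lam * (d * R ^ (d - 1)) + 1)
  rw [ContinuousAt, tendsto_iff_norm_sub_tendsto_zero]
  have h1 : Tendsto (fun p : L2 => K * ‖p - q‖) (𝓝 q) (𝓝 0) := by
    have : Continuous fun p : L2 => K * ‖p - q‖ := by fun_prop
    simpa using this.tendsto q
  refine squeeze_zero' (Eventually.of_forall fun _ => norm_nonneg _) ?_ h1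
  filter_upwards [Metric.ball_mem_nhds q one_pos] with p hp
  refine norm_drift_sub_le d hlam (fun i => ?_) (fun i => ?_)
  · refine (abs_apply_le_norm p i).trans ?_
    have : ‖p‖ ≤ ‖p - q‖ + ‖q‖ := by simpa using norm_add_le (p - q) q
    rw [Metric.mem_ball, dist_eq_norm] at hp
    show ‖p‖ ≤ ‖q‖ + 1
    linarith
  · exact (abs_apply_le_norm q i).trans (by simp [R])

theorem limitStates.abs_le_one {q : L2} (hq : q ∈ limitStates) (i : ℕ) : |q i| ≤ 1 := by
  rw [abs_of_nonneg (limitStates.mem_Icc hq i).1]; exact (limitStates.mem_Icc hq i).2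

theorem norm_drift_sub_le_of_mem (d : ℕ) {lam : ℝ} (hlam : 0 < lam) {q q' : L2}
    (hq : q ∈ limitStates) (hq' : q' ∈ limitStates) :
    ‖drift d lam q - drift d lam q'‖ ≤ 3 * (lam * d + 1) * ‖q - q'‖ := by
  simpa using norm_drift_sub_le d hlam (limitStates.abs_le_one hq) (limitStates.abs_le_one hq')

theorem norm_drift_le (d : ℕ) {lam : ℝ} (hlam : 0 < lam) {q : L2} (hq : q ∈ limitStates) :
    ‖drift d lam q‖ ≤ 3 * (lam * d + 1) * ‖q‖ := by
  refine norm_le_of_coord (by positivity) (drift_zero _ _ _) fun i => ?_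
  rw [drift_succ]
  have h1 := abs_pow_sub_pow_le_of_le d (limitStates.abs_le_one hq i) (limitStates.abs_le_one hq (i + 1))
  simp only [one_pow, mul_one] at h1
  have t := abs_sub (lam * (q i ^ d - q (i + 1) ^ d)) (q (i + 1) - q (i + 2))
  rw [abs_mul, abs_of_pos hlam] at t
  have p0 := (limitStates.mem_Icc hq i).1
  have p1 := (limitStates.mem_Icc hq (i + 1)).1
  have p2 := (limitStates.mem_Icc hq (i + 2)).1
  have o1 := (hq.2 i).1
  have o2 := (hq.2 (i + 1)).1
  rw [abs_of_nonneg (sub_nonneg.2 o1)] at h1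
  rw [abs_of_nonneg (sub_nonneg.2 o2)] at t
  rw [abs_of_nonneg p0, abs_of_nonneg p1, abs_of_nonneg p2]
  have m1 := mul_le_mul_of_nonneg_left h1 hlam.le
  have hd : (0 : ℝ) ≤ lam * d := by positivity
  nlinarith [mul_nonneg hd p1, mul_nonneg hd p2]

/-- The coordinates of the mean jump of the system with `n` servers. -/
def nDriftCoord (d : ℕ) (lam : ℝ) (n : ℕ) (q : L2) : ℕ → ℝ
  | 0 => 0
  | i + 1 => lam * arrivalRate d n q i - (q (i + 1) - q (i + 2))

open Classical in
/-- The mean jump of the system with `n` servers. -/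
def nDrift (d : ℕ) (lam : ℝ) (n : ℕ) (q : L2) : L2 :=
  -- For `0 < n` and `q ∈ states n` the sequence has finite support, so the default `0` is not used
  -- there.
  if h : Memℓp (nDriftCoord d lam n q) 2 then ⟨nDriftCoord d lam n q, h⟩ else 0

theorem nDriftCoord_eq_zero {d n : ℕ} {lam : ℝ} {q : L2} {m : ℕ} (hm : ∀ i, m ≤ i → q i = 0)
    {i : ℕ} (hi : m < i) : nDriftCoord d lam n q i = 0 := by
  rcases i with _ | i
  · rfl
  · simp only [nDriftCoord]
    rw [arrivalRate_eq_zero (by rw [hm i (by omega), hm (i + 1) (by omega)]),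
      hm (i + 1) (by omega), hm (i + 2) (by omega)]
    simp

theorem nDrift_apply {d n : ℕ} (lam : ℝ) (hn0 : 0 < n) {q : L2} (hq : q ∈ states n) (i : ℕ) :
    nDrift d lam n q i = nDriftCoord d lam n q i := by
  obtain ⟨m, hm⟩ := states.exists_zero hn0 hq
  have h : Memℓp (nDriftCoord d lam n q) 2 := by
    refine (memℓp_zero ((finite_le_nat m).subset fun i hi => ?_)).of_exponent_ge zero_le
    by_contra h
    exact hi (nDriftCoord_eq_zero hm (not_le.1 h))
  unfold nDrift
  rw [dif_pos h]

/-- A uniform error in each coordinate would not be square-summable. The Lipschitz form of the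
binomial convergence bounds the error in coordinate `i + 1` by a small multiple of `|q i - q (i +
1)|`, which is. -/
theorem eventually_norm_nDrift_sub_drift_le (d : ℕ) {lam : ℝ} (hlam : 0 < lam) {ε : ℝ}
    (hε : 0 < ε) : ∀ᶠ n : ℕ in atTop, ∀ q ∈ states n,
      ‖nDrift d lam n q - drift d lam q‖ ≤ ε * ‖q‖ := by
  have hε' : 0 < ε / (3 * lam) := by positivity
  filter_upwards [eventually_lipschitz_binom d hε', eventually_gt_atTop 0] with n hn hn0 q hq
  have hL := states_subset_limitStates hn0 hq
  have e : ε = 3 * (ε / 3) := by ring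
  rw [e]
  refine norm_le_of_coord (by positivity) ?_ fun i => ?_
  · simp [drift_zero, nDrift_apply lam hn0 hq, nDriftCoord]
  · rw [lp.coeFn_sub, Pi.sub_apply, drift_succ, nDrift_apply lam hn0 hq]
    simp only [nDriftCoord, arrivalRate]
    have h := hn (q i) (limitStates.mem_Icc hL i) (q (i + 1)) (limitStates.mem_Icc hL (i + 1))
    have e2 : lam * ((binom (n * q i) d - binom (n * q (i + 1)) d) / binom n d)
          - (q (i + 1) - q (i + 2)) - (lam * (q i ^ d - q (i + 1) ^ d) - (q (i + 1) - q (i + 2)))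
        = lam * ((binom (n * q i) d / binom n d - q i ^ d)
          - (binom (n * q (i + 1)) d / binom n d - q (i + 1) ^ d)) := by ring
    rw [e2, abs_mul, abs_of_pos hlam]
    have h2 := mul_le_mul_of_nonneg_left h hlam.le
    have h3 : |q i - q (i + 1)| ≤ |q i| + |q (i + 1)| := abs_sub _ _
    have e3 : lam * (ε / (3 * lam) * |q i - q (i + 1)|) = ε / 3 * |q i - q (i + 1)| := by
      field_simp
    rw [e3] at h2
    refine h2.trans (mul_le_mul_of_nonneg_left ?_ (by positivity))
    linarith [abs_nonneg (q (i + 2))]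

/-! ### Coordinates and measurability in `ℓ²` -/

/-- The coordinate functionals of `ℓ²`. -/
def coordCLM (i : ℕ) : L2 →L[ℝ] ℝ := lp.evalCLM ℝ (fun _ : ℕ => ℝ) 2 i

theorem coordCLM_apply (i : ℕ) (q : L2) : coordCLM i q = q i := rfl

theorem continuous_coord (i : ℕ) : Continuous fun q : L2 => q i := (coordCLM i).continuous

/-- A vector of `ℓ²` is the limit of its truncations, and each truncation is a finite sum of
measurable multiples of unit vectors. -/
theorem stronglyMeasurable_of_coord {α : Type*} [MeasurableSpace α] {f : α → L2}
    (h : ∀ i, Measurable fun a => f a i) : StronglyMeasurable f := by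
  have hs : ∀ N : ℕ, StronglyMeasurable fun a => ∑ i ∈ Finset.range N, lp.single 2 i (f a i) := by
    intro N
    refine Finset.stronglyMeasurable_fun_sum _ fun i _ => ?_
    exact (lp.isometry_single (E := fun _ : ℕ => ℝ) (p := 2) i).continuous.comp_stronglyMeasurable
      (h i).stronglyMeasurable
  refine stronglyMeasurable_of_tendsto atTop hs (tendsto_pi_nhds.2 fun a => ?_)
  exact (lp.hasSum_single (by norm_num) (f a)).tendsto_sum_nat

theorem isClosed_limitStates : IsClosed limitStates := by
  have : limitStates = {q : L2 | q 0 = 1} ∩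
      ⋂ i, ({q : L2 | q (i + 1) ≤ q i} ∩ ({q : L2 | 0 ≤ q i} ∩ {q : L2 | q i ≤ 1})) := by
    ext q; simp [limitStates]
  rw [this]
  refine (isClosed_eq (continuous_coord 0) continuous_const).inter (isClosed_iInter fun i => ?_)
  exact (isClosed_le (continuous_coord _) (continuous_coord _)).inter
    ((isClosed_le continuous_const (continuous_coord _)).inter
      (isClosed_le (continuous_coord _) continuous_const))

theorem mem_limitStates_of {q : L2} (h0 : q 0 = 1) (h : ∀ i, q (i + 1) ≤ q i)
    (hnn : ∀ i, 0 ≤ q i) : q ∈ limitStates :=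
  ⟨h0, fun i => ⟨h i, hnn i, h0 ▸ antitone_nat_of_succ_le h (Nat.zero_le i)⟩⟩

/-! ### The limit equation: uniqueness, norm bound, existence, and its equivalent form with jumps.
-/

/-! ### Integrals over the time interval -/

instance (T : ℝ) : IsFiniteMeasure (lebTime T) := by
  refine ⟨?_⟩
  rw [lebTime, comap_subtype_coe_apply measurableSet_Icc, image_univ, Subtype.range_coe]
  exact measure_Icc_lt_top

theorem map_lebTime (T : ℝ) : (lebTime T).map Subtype.val = volume.restrict (Icc 0 T) :=
  map_comap_subtype_coe measurableSet_Icc _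

theorem setIntegral_lebTime {T : ℝ} {E : Type*} [NormedAddCommGroup E] [NormedSpace ℝ E]
    (F : ℝ → E) (t : Icc (0 : ℝ) T) :
    ∫ s in Iic t, F s ∂lebTime T = ∫ u in (0 : ℝ)..t, F u := by
  have h := (MeasurableEmbedding.subtype_coe (measurableSet_Icc (a := (0 : ℝ)) (b := T))).setIntegral_map
    (μ := lebTime T) F (Iic (t : ℝ))
  rw [map_lebTime, Measure.restrict_restrict measurableSet_Iic] at h
  have e : Iic (t : ℝ) ∩ Icc 0 T = Icc 0 (t : ℝ) := by
    ext u
    simp only [mem_inter_iff, mem_Iic, mem_Icc]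
    exact ⟨fun h => ⟨h.2.1, h.1⟩, fun h => ⟨h.2, h.1, h.2.trans t.2.2⟩⟩
  rw [e, integral_Icc_eq_integral_Ioc, ← intervalIntegral.integral_of_le t.2.1] at h
  exact h.symm

theorem solvesDriftEquation_iff {T : ℝ} (hT : 0 ≤ T) {d : ℕ} {lam : ℝ} {q₀ : L2}
    {x : C(Icc (0 : ℝ) T, L2)} : SolvesDriftEquation d lam q₀ x ↔
      ∀ t : Icc (0 : ℝ) T, x t = q₀ + ∫ u in (0 : ℝ)..t, drift d lam (IccExtend hT x u) := by
  refine forall_congr' fun t => ?_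
  rw [← setIntegral_lebTime]
  simp only [IccExtend_val]

/-! ### Uniqueness and the norm bound -/

/-- The right side of the integral equation makes sense for all real times once `x` is extended by
constants. It is differentiable on the whole line, so two-sided derivatives are available at the end
points of `[0, T]` too. -/
theorem SolvesDriftEquation.exists_extension {T : ℝ} (hT : 0 ≤ T) {d : ℕ} {lam : ℝ} (hlam : 0 < lam)
    {q₀ : L2} {x : C(Icc (0 : ℝ) T, L2)} (hx : SolvesDriftEquation d lam q₀ x) :
    ∃ X : ℝ → L2, X 0 = q₀ ∧ (∀ t : Icc (0 : ℝ) T, X t = x t) ∧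
      ∀ t ∈ Icc 0 T, HasDerivAt X (drift d lam (X t)) t := by
  rw [solvesDriftEquation_iff hT] at hx
  have hc : Continuous fun u => drift d lam (IccExtend hT x u) :=
    (continuous_drift d hlam).comp (x.continuous.Icc_extend' (h := hT))
  refine ⟨fun t => q₀ + ∫ u in (0 : ℝ)..t, drift d lam (IccExtend hT x u), by simp,
    fun t => (hx t).symm, fun t ht => ?_⟩
  have h1 := (hc.integral_hasStrictDerivAt 0 t).hasDerivAt.const_add q₀
  have h2 : x ⟨t, ht⟩ = q₀ + ∫ u in (0 : ℝ)..t, drift d lam (IccExtend hT x u) := hx ⟨t, ht⟩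
  beta_reduce
  rw [← h2]
  rwa [IccExtend_of_mem hT x ht] at h1

/-- Both solutions stay in a common ball by compactness, and the drift is Lipschitz there. -/
theorem SolvesDriftEquation.unique {T : ℝ} (hT : 0 ≤ T) {d : ℕ} {lam : ℝ} (hlam : 0 < lam)
    {q₀ : L2} {x x' : C(Icc (0 : ℝ) T, L2)} (hx : SolvesDriftEquation d lam q₀ x)
    (hx' : SolvesDriftEquation d lam q₀ x') : x = x' := by
  obtain ⟨X, hX0, hX, hXd⟩ := hx.exists_extension hT hlam
  obtain ⟨Y, hY0, hY, hYd⟩ := hx'.exists_extension hT hlam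
  set R := max ‖x‖ ‖x'‖ with hR
  have hXR : ∀ t ∈ Icc 0 T, X t ∈ {q : L2 | ‖q‖ ≤ R} := fun t ht => by
    rw [mem_ofPred_eq, hX ⟨t, ht⟩]; exact (x.norm_coe_le_norm _).trans (le_max_left _ _)
  have hYR : ∀ t ∈ Icc 0 T, Y t ∈ {q : L2 | ‖q‖ ≤ R} := fun t ht => by
    rw [mem_ofPred_eq, hY ⟨t, ht⟩]; exact (x'.norm_coe_le_norm _).trans (le_max_right _ _)
  have hR0 : 0 ≤ R := (norm_nonneg _).trans (le_max_left _ _)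
  have hLip : LipschitzOnWith (3 * (lam * (d * R ^ (d - 1)) + 1)).toNNReal (drift d lam)
      {q : L2 | ‖q‖ ≤ R} := by
    refine LipschitzOnWith.of_dist_le_mul fun q hq q' hq' => ?_
    rw [dist_eq_norm, dist_eq_norm, Real.coe_toNNReal _ (by positivity)]
    exact norm_drift_sub_le d hlam (fun i => (abs_apply_le_norm q i).trans hq)
      (fun i => (abs_apply_le_norm q' i).trans hq')
  have := ODE_solution_unique_of_mem_Icc_right (v := fun _ => drift d lam)
    (s := fun _ => {q : L2 | ‖q‖ ≤ R}) (a := 0) (b := T) (f := X) (g := Y)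
    (fun t _ => hLip)
    (fun t ht => (hXd t ht).continuousAt.continuousWithinAt)
    (fun t ht => (hXd t (Ico_subset_Icc_self ht)).hasDerivWithinAt)
    (fun t ht => hXR t (Ico_subset_Icc_self ht))
    (fun t ht => (hYd t ht).continuousAt.continuousWithinAt)
    (fun t ht => (hYd t (Ico_subset_Icc_self ht)).hasDerivWithinAt)
    (fun t ht => hYR t (Ico_subset_Icc_self ht)) (by rw [hX0, hY0])
  ext1 t
  rw [← hX, ← hY, this t.2]

/-- Grönwall with rate `K = 3 (λ d + 1)` gives `‖q₀‖ ^ 2 * exp (2 K t)`. Since `λ d + 1 ≥ 1`, `2 K ≤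
8 (λ d + 1) ^ 2`, and the factor `2` of the statement is to spare. -/
theorem SolvesDriftEquation.norm_sq_le {T : ℝ} (hT : 0 ≤ T) {d : ℕ} {lam : ℝ} (hlam : 0 < lam)
    {q₀ : L2} {x : C(Icc (0 : ℝ) T, L2)} (hx : SolvesDriftEquation d lam q₀ x)
    (hmem : ∀ t, x t ∈ limitStates) (t : Icc (0 : ℝ) T) :
    ‖x t‖ ^ 2 ≤ 2 * ‖q₀‖ ^ 2 * Real.exp (8 * (lam * d + 1) ^ 2 * (t : ℝ)) := by
  obtain ⟨X, hX0, hX, hXd⟩ := hx.exists_extension hT hlam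
  set K := 3 * (lam * d + 1) with hK
  have h := norm_le_gronwallBound_of_norm_deriv_right_le (f := X)
    (f' := fun t => drift d lam (X t)) (δ := ‖q₀‖) (K := K) (ε := 0) (a := 0) (b := T)
    (fun t ht => (hXd t ht).continuousAt.continuousWithinAt)
    (fun t ht => (hXd t (Ico_subset_Icc_self ht)).hasDerivWithinAt) (by rw [hX0])
    (fun t ht => by
      rw [add_zero]
      refine norm_drift_le d hlam ?_
      rw [hX ⟨t, Ico_subset_Icc_self ht⟩]; exact hmem _) t t.2
  rw [gronwallBound_ε0, sub_zero, hX] at h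
  have h1 : ‖x t‖ ^ 2 ≤ (‖q₀‖ * Real.exp (K * t)) ^ 2 := pow_le_pow_left₀ (norm_nonneg _) h 2
  refine h1.trans ?_
  rw [mul_pow, ← Real.exp_nat_mul]
  have h2 : ((2 : ℕ) : ℝ) * (K * t) ≤ 8 * (lam * d + 1) ^ 2 * (t : ℝ) := by
    have h3 : (1 : ℝ) ≤ lam * d + 1 := by
      have : 0 ≤ lam * d := by positivity
      linarith
    have h4 := t.2.1
    have h5 : (2 : ℝ) * K ≤ 8 * (lam * d + 1) ^ 2 := by rw [hK]; nlinarith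
    push_cast
    nlinarith [mul_le_mul_of_nonneg_right h5 h4]
  have h3 := Real.exp_le_exp.2 h2
  have h4 := sq_nonneg ‖q₀‖
  have h5 := Real.exp_pos (8 * (lam * d + 1) ^ 2 * (t : ℝ))
  nlinarith [mul_le_mul_of_nonneg_left h3 h4, mul_nonneg h4 h5.le]

/-! ### Existence -/

/-- A small Euler step preserves `limitStates`. -/
theorem add_smul_drift_mem {d : ℕ} {lam : ℝ} (hlam : 0 < lam) {q : L2} (hq : q ∈ limitStates) :
    q + (lam * d + 1)⁻¹ • drift d lam q ∈ limitStates := by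
  have hα : 0 < lam * d + 1 := by positivity
  set h := (lam * d + 1)⁻¹ with hh
  have hh0 : 0 < h := by positivity
  have hα1 : h * (lam * d + 1) = 1 := inv_mul_cancel₀ hα.ne'
  have hpow : ∀ i, q i ^ d - q (i + 1) ^ d ≤ d * (q i - q (i + 1)) := by
    intro i
    have h1 := abs_pow_sub_pow_le_of_le d (limitStates.abs_le_one hq i)
      (limitStates.abs_le_one hq (i + 1))
    simp only [one_pow, mul_one] at h1
    rw [abs_of_nonneg (sub_nonneg.2 (hq.2 i).1)] at h1
    exact (le_abs_self _).trans h1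
  have hpow0 : ∀ i, 0 ≤ q i ^ d - q (i + 1) ^ d := fun i =>
    sub_nonneg.2 (pow_le_pow_left₀ (limitStates.mem_Icc hq (i + 1)).1 (hq.2 i).1 d)
  have hval : ∀ i, (q + h • drift d lam q : L2) i = q i + h * drift d lam q i := fun i => rfl
  have h0 : (q + h • drift d lam q : L2) 0 = 1 := by
    rw [hval, drift_zero, mul_zero, add_zero, hq.1]
  -- The step decreases the gap `q i - q (i + 1)` by at most `h (λ d + 1)` times the gap: `λ d` from
  -- the arrivals into `i + 1` and `1` from the departures at `i`. As `h (λ d + 1) = 1`, the new gap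
  -- is nonnegative. Coordinate `0` has no drift, hence the separate case.
  have hanti : ∀ i, (q + h • drift d lam q : L2) (i + 1) ≤ (q + h • drift d lam q : L2) i := by
    intro i
    rw [hval, hval, drift_succ]
    have g1 := hpow i
    have g2 := (hq.2 i).1
    have g3 := (hq.2 (i + 1)).1
    have m1 := mul_le_mul_of_nonneg_left g1 (mul_pos hh0 hlam).le
    rcases i with _ | i
    · rw [drift_zero]
      have m4 := mul_nonneg hh0.le (sub_nonneg.2 g3)
      have m5 := mul_nonneg hh0.le (sub_nonneg.2 g2)
      have m6 : (h * (lam * d + 1)) * (q 0 - q (0 + 1)) = q 0 - q (0 + 1) := by rw [hα1, one_mul]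
      nlinarith
    · rw [drift_succ]
      have m3 := mul_nonneg (mul_pos hh0 hlam).le (hpow0 i)
      have m4 := mul_nonneg hh0.le (sub_nonneg.2 g3)
      have m6 : (h * (lam * d + 1)) * (q (i + 1) - q (i + 1 + 1)) = q (i + 1) - q (i + 1 + 1) := by
        rw [hα1, one_mul]
      nlinarith
  refine mem_limitStates_of h0 hanti fun i => ?_
  -- An antitone sequence that tends to `0` is nonnegative.
  exact (antitone_nat_of_succ_le hanti).le_of_tendsto (tendsto_apply_zero _) i

/-- Exponential averages of elements of `limitStates` are in `limitStates`. -/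
theorem exp_average_mem {α t : ℝ} (hα : 0 < α) (ht : 0 ≤ t) {q₀ : L2} (hq : q₀ ∈ limitStates)
    {c : ℝ → L2} (hc : Continuous c) (hmem : ∀ s ∈ Icc 0 t, c s ∈ limitStates) :
    Real.exp (-α * t) • (q₀ + ∫ s in (0 : ℝ)..t, (α * Real.exp (α * s)) • c s) ∈ limitStates := by
  have hcont : Continuous fun s : ℝ => (α * Real.exp (α * s)) • c s := by fun_prop
  have hval : ∀ i, (Real.exp (-α * t) • (q₀ + ∫ s in (0 : ℝ)..t, (α * Real.exp (α * s)) • c s) : L2) i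
      = Real.exp (-α * t) * (q₀ i + ∫ s in (0 : ℝ)..t, (α * Real.exp (α * s)) * c s i) := by
    intro i
    have := (coordCLM i).intervalIntegral_comp_comm (hcont.intervalIntegrable (μ := volume) 0 t)
    rw [← coordCLM_apply, map_smul, map_add, ← this]
    rfl
  have hci : ∀ i, Continuous fun s : ℝ => (α * Real.exp (α * s)) * c s i := fun i => by
    have := (continuous_coord i).comp hc
    fun_prop
  refine mem_limitStates_of ?_ (fun i => ?_) fun i => ?_
  · rw [hval]
    have h1 : ∫ s in (0 : ℝ)..t, (α * Real.exp (α * s)) * c s 0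
        = ∫ s in (0 : ℝ)..t, α * Real.exp (α * s) := by
      refine intervalIntegral.integral_congr fun s hs => ?_
      rw [uIcc_of_le ht] at hs
      simp only [(hmem s hs).1, mul_one]
    -- Total weight one: `exp (-α t) * (1 + (exp (α t) - 1)) = 1`.
    have h2 : ∫ s in (0 : ℝ)..t, α * Real.exp (α * s) = Real.exp (α * t) - 1 := by
      have := intervalIntegral.integral_eq_sub_of_hasDerivAt (a := 0) (b := t)
        (f := fun s => Real.exp (α * s)) (f' := fun s => α * Real.exp (α * s))
        (fun s _ => by
          have := ((hasDerivAt_id s).const_mul α).exp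
          simpa [mul_comm] using this)
        ((by fun_prop : Continuous fun s => α * Real.exp (α * s)).intervalIntegrable _ _)
      rw [this]; simp
    rw [h1, h2, hq.1, add_sub_cancel, ← Real.exp_add]
    simp
  · rw [hval, hval]
    refine mul_le_mul_of_nonneg_left (add_le_add (hq.2 i).1 ?_) (Real.exp_pos _).le
    refine intervalIntegral.integral_mono_on ht ((hci _).intervalIntegrable _ _)
      ((hci _).intervalIntegrable _ _) fun s hs => ?_
    exact mul_le_mul_of_nonneg_left ((hmem s hs).2 i).1 (by positivity)
  · rw [hval]
    refine mul_nonneg (Real.exp_pos _).le (add_nonneg (limitStates.mem_Icc hq i).1 ?_)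
    refine intervalIntegral.integral_nonneg ht fun s hs => ?_
    exact mul_nonneg (by positivity) (limitStates.mem_Icc (hmem s hs) i).1

/-- The drift equation with integrating factors has a solution in `limitStates`. -/
theorem exists_mild_solution {T : ℝ} (hT : 0 ≤ T) {d : ℕ} {lam : ℝ} (hlam : 0 < lam)
    {q₀ : L2} (hq : q₀ ∈ limitStates) : ∃ x : ℝ → L2, Continuous x ∧
      (∀ t ∈ Icc 0 T, x t ∈ limitStates) ∧ ∀ t ∈ Icc 0 T,
      x t = Real.exp (-(lam * d + 1) * t) • (q₀ + ∫ s in (0 : ℝ)..t,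
        ((lam * d + 1) * Real.exp ((lam * d + 1) * s)) •
          (x s + (lam * d + 1)⁻¹ • drift d lam (x s))) := by
  set α := lam * d + 1 with hαdef
  have hα : 0 < α := by positivity
  have hLip : ∀ q ∈ limitStates, ∀ q' ∈ limitStates,
      ‖(q + α⁻¹ • drift d lam q) - (q' + α⁻¹ • drift d lam q')‖ ≤ 4 * ‖q - q'‖ := by
    intro q hq q' hq'
    have h1 := norm_drift_sub_le_of_mem d hlam hq hq'
    have e : (q + α⁻¹ • drift d lam q) - (q' + α⁻¹ • drift d lam q')
        = (q - q') + α⁻¹ • (drift d lam q - drift d lam q') := by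
      rw [smul_sub]; abel
    rw [e]
    refine (norm_add_le _ _).trans ?_
    rw [norm_smul, Real.norm_of_nonneg (by positivity)]
    have h2 := mul_le_mul_of_nonneg_left h1 (by positivity : 0 ≤ α⁻¹)
    have h3 : α⁻¹ * (3 * (lam * d + 1) * ‖q - q'‖) = 3 * ‖q - q'‖ := by
      rw [← hαdef]; field_simp
    linarith
  -- The Euler map is `4`-Lipschitz (`1` from the identity, `3` from the drift), so in the norm
  -- weighted by `exp (-γ t)` the fixed point map has Lipschitz constant `4 α / (α + γ)`. The choice
  -- `γ = 7 α` makes it `1 / 2`.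
  set γ := 7 * α with hγ
  have hγ0 : 0 < γ := by positivity
  set Φ : L2 → L2 := fun q => q + α⁻¹ • drift d lam q with hΦ
  have hΦc : Continuous Φ := by
    have := continuous_drift d hlam
    fun_prop
  have hint : ∀ y : C(Icc (0 : ℝ) T, L2), Continuous fun s : ℝ =>
      (α * Real.exp (α * s)) • Φ (Real.exp (γ * s) • IccExtend hT y s) := by
    intro y
    have := y.continuous.Icc_extend' (h := hT)
    fun_prop
  have hintc : ∀ y : C(Icc (0 : ℝ) T, L2), Continuous fun t : ℝ => ∫ s in (0 : ℝ)..t,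
      (α * Real.exp (α * s)) • Φ (Real.exp (γ * s) • IccExtend hT y s) := fun y =>
    continuous_iff_continuousAt.2 fun t =>
      ((hint y).integral_hasStrictDerivAt 0 t).hasDerivAt.continuousAt
  -- The unknown is `y t = exp (-γ t) x t`, so that the ordinary sup norm of `y` is the weighted
  -- norm of `x`.
  let Γ : C(Icc (0 : ℝ) T, L2) → C(Icc (0 : ℝ) T, L2) := fun y =>
    ⟨fun t => Real.exp (-(α + γ) * t) • (q₀ + ∫ s in (0 : ℝ)..t,
      (α * Real.exp (α * s)) • Φ (Real.exp (γ * s) • IccExtend hT y s)), by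
      have := hintc y
      fun_prop⟩
  set 𝒴 : Set C(Icc (0 : ℝ) T, L2) := {y | ∀ t : Icc (0 : ℝ) T, Real.exp (γ * (t : ℝ)) • y t ∈ limitStates} with h𝒴
  have hclosed : IsClosed 𝒴 := by
    rw [h𝒴, ofPred_forall]
    refine isClosed_iInter fun t => isClosed_limitStates.preimage ?_
    fun_prop
  have hext : ∀ y ∈ 𝒴, ∀ s ∈ Icc 0 T, Real.exp (γ * s) • IccExtend hT y s ∈ limitStates := by
    intro y hy s hs
    rw [IccExtend_of_mem hT y hs]
    exact hy ⟨s, hs⟩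
  have hΓmul : ∀ y (t : Icc (0 : ℝ) T), Real.exp (γ * (t : ℝ)) • Γ y t
      = Real.exp (-α * t) • (q₀ + ∫ s in (0 : ℝ)..t,
      (α * Real.exp (α * s)) • Φ (Real.exp (γ * s) • IccExtend hT y s)) := by
    intro y t
    have e : Γ y t = Real.exp (-(α + γ) * t) • (q₀ + ∫ s in (0 : ℝ)..t,
      (α * Real.exp (α * s)) • Φ (Real.exp (γ * s) • IccExtend hT y s)) := rfl
    rw [e, smul_smul, ← Real.exp_add]
    congr 2
    ring
  have hmaps : MapsTo Γ 𝒴 𝒴 := by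
    intro y hy t
    rw [hΓmul]
    have hy' : Continuous (IccExtend hT y) := y.continuous.Icc_extend' (h := hT)
    refine exp_average_mem hα t.2.1 hq (by fun_prop) fun s hs => ?_
    exact add_smul_drift_mem hlam (hext y hy s ⟨hs.1, hs.2.trans t.2.2⟩)
  have hcontr : ContractingWith (1 / 2) (hmaps.restrict Γ 𝒴 𝒴) := by
    refine ⟨NNReal.coe_lt_coe.1 (by norm_num), LipschitzWith.of_dist_le_mul fun y y' => ?_⟩
    rw [Subtype.dist_eq, Subtype.dist_eq]
    simp only [MapsTo.val_restrict_apply]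
    rw [ContinuousMap.dist_le (by positivity)]
    intro t
    obtain ⟨y, hy⟩ := y
    obtain ⟨y', hy'⟩ := y'
    rw [dist_eq_norm]
    have e : Γ y t - Γ y' t = Real.exp (-(α + γ) * t) • ∫ s in (0 : ℝ)..t,
        ((α * Real.exp (α * s)) • Φ (Real.exp (γ * s) • IccExtend hT y s)
          - (α * Real.exp (α * s)) • Φ (Real.exp (γ * s) • IccExtend hT y' s)) := by
      rw [intervalIntegral.integral_sub ((hint y).intervalIntegrable _ _)
        ((hint y').intervalIntegrable _ _)]
      show Real.exp (-(α + γ) * t) • (q₀ + _) - Real.exp (-(α + γ) * t) • (q₀ + _) = _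
      rw [← smul_sub, add_sub_add_left_eq_sub]
    have hb : ∀ s ∈ Ioc (0 : ℝ) t, ‖(α * Real.exp (α * s)) • Φ (Real.exp (γ * s) • IccExtend hT y s)
          - (α * Real.exp (α * s)) • Φ (Real.exp (γ * s) • IccExtend hT y' s)‖
        ≤ 4 * α * dist y y' * Real.exp ((α + γ) * s) := by
      intro s hs
      have hsI : s ∈ Icc 0 T := ⟨hs.1.le, hs.2.trans t.2.2⟩
      rw [← smul_sub, norm_smul, Real.norm_of_nonneg (by positivity)]
      have h1 := hLip _ (hext y hy s hsI) _ (hext y' hy' s hsI)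
      rw [← smul_sub, norm_smul, Real.norm_of_nonneg (Real.exp_pos _).le] at h1
      have h2 : ‖IccExtend hT y s - IccExtend hT y' s‖ ≤ dist y y' := by
        rw [IccExtend_of_mem hT y hsI, IccExtend_of_mem hT y' hsI, ← dist_eq_norm]
        exact ContinuousMap.dist_apply_le_dist _
      have h3 := mul_le_mul_of_nonneg_left h2 (Real.exp_pos (γ * s)).le
      have h4 : Real.exp ((α + γ) * s) = Real.exp (α * s) * Real.exp (γ * s) := by
        rw [← Real.exp_add]; ring_nf
      rw [h4]
      calc α * Real.exp (α * s) * ‖Φ (Real.exp (γ * s) • IccExtend hT y s)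
            - Φ (Real.exp (γ * s) • IccExtend hT y' s)‖
          ≤ α * Real.exp (α * s) * (4 * (Real.exp (γ * s) * dist y y')) := by
            refine mul_le_mul_of_nonneg_left (h1.trans ?_) (by positivity)
            linarith
        _ = _ := by ring
    have hi : ∫ s in (0 : ℝ)..t, 4 * α * dist y y' * Real.exp ((α + γ) * s)
        = 4 * α * dist y y' * ((Real.exp ((α + γ) * t) - 1) / (α + γ)) := by
      rw [intervalIntegral.integral_const_mul]
      congr 1
      have hne : α + γ ≠ 0 := by positivity
      have := intervalIntegral.integral_eq_sub_of_hasDerivAt (a := 0) (b := (t : ℝ))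
        (f := fun s => Real.exp ((α + γ) * s) / (α + γ)) (f' := fun s => Real.exp ((α + γ) * s))
        (fun s _ => by
          have := (((hasDerivAt_id s).const_mul (α + γ)).exp).div_const (α + γ)
          simp only [id, mul_one] at this
          rwa [mul_div_cancel_right₀ _ hne] at this)
        ((by fun_prop : Continuous fun s => Real.exp ((α + γ) * s)).intervalIntegrable _ _)
      rw [this]
      simp [sub_div]
    have hn := intervalIntegral.norm_integral_le_of_norm_le t.2.1
      (ae_of_all _ hb) ((by fun_prop : Continuous fun s => 4 * α * dist y y' *
        Real.exp ((α + γ) * s)).intervalIntegrable (μ := volume) 0 (t : ℝ))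
    rw [hi] at hn
    rw [e, norm_smul, Real.norm_of_nonneg (Real.exp_pos _).le]
    refine (mul_le_mul_of_nonneg_left hn (Real.exp_pos _).le).trans ?_
    have h8 : α + γ = 8 * α := by rw [hγ]; ring
    have h5 : Real.exp (-(α + γ) * t) * Real.exp ((α + γ) * t) = 1 := by
      rw [← Real.exp_add, ← add_mul, neg_add_cancel, zero_mul, Real.exp_zero]
    have h6 : Real.exp (-(α + γ) * t) * (4 * α * dist y y' * ((Real.exp ((α + γ) * t) - 1) / (α + γ)))
        = 1 / 2 * dist y y' * (Real.exp (-(α + γ) * t) * Real.exp ((α + γ) * t)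
          - Real.exp (-(α + γ) * t)) := by
      rw [h8]; field_simp; ring
    rw [h6, h5]
    have h7 := Real.exp_pos (-(α + γ) * t)
    have h9 : (0 : ℝ) ≤ dist y y' := dist_nonneg
    push_cast
    nlinarith [mul_nonneg h9 h7.le]
  let y₀ : C(Icc (0 : ℝ) T, L2) := ⟨fun t => Real.exp (-γ * (t : ℝ)) • q₀, by fun_prop⟩
  have hy₀ : y₀ ∈ 𝒴 := by
    intro t
    show Real.exp (γ * (t : ℝ)) • (Real.exp (-γ * (t : ℝ)) • q₀) ∈ limitStates
    rw [smul_smul, ← Real.exp_add]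
    simpa using hq
  obtain ⟨y, hy, hfix, -⟩ := hcontr.exists_fixedPoint' hclosed.isComplete hmaps hy₀ (edist_ne_top _ _)
  have hy' : Continuous (IccExtend hT y) := y.continuous.Icc_extend' (h := hT)
  refine ⟨fun s => Real.exp (γ * s) • IccExtend hT y s, by fun_prop, hext y hy, fun t ht => ?_⟩
  have := hΓmul y ⟨t, ht⟩
  rw [hfix.eq] at this
  beta_reduce
  rw [IccExtend_of_mem hT y ht]
  exact this

/-- Differentiating the averaged equation gives `x' = -α x + α (x + α⁻¹ b x)`, in which the terms
with `α x` cancel. -/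
theorem exists_solvesDriftEquation {T : ℝ} (hT : 0 ≤ T) {d : ℕ} {lam : ℝ} (hlam : 0 < lam)
    {q₀ : L2} (hq : q₀ ∈ limitStates) : ∃ x : C(Icc (0 : ℝ) T, L2),
      SolvesDriftEquation d lam q₀ x ∧ ∀ t, x t ∈ limitStates := by
  obtain ⟨x, hxc, hmem, hx⟩ := exists_mild_solution hT (d := d) hlam hq
  set α := lam * d + 1 with hαdef
  have hα : 0 < α := by positivity
  have hdc := continuous_drift d hlam
  refine ⟨⟨fun t => x t, by fun_prop⟩, ?_, fun t => hmem t t.2⟩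
  intro t
  have h1 : ∫ s in Iic t, drift d lam (x s) ∂lebTime T = ∫ u in (0 : ℝ)..t, drift d lam (x u) :=
    setIntegral_lebTime (fun u => drift d lam (x u)) t
  show x t = q₀ + ∫ s in Iic t, drift d lam (x s) ∂lebTime T
  rw [h1]
  set c : ℝ → L2 := fun s => (α * Real.exp (α * s)) • (x s + α⁻¹ • drift d lam (x s)) with hc
  have hcc : Continuous c := by fun_prop
  set W : ℝ → L2 := fun t => Real.exp (-α * t) • (q₀ + ∫ s in (0 : ℝ)..t, c s) with hW
  -- `W` satisfies its differential equation on the whole line, but agrees with `x` only on `[0,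
  -- T]`; the two are exchanged only under the integral over `[0, t]`.
  have hWd : ∀ u, HasDerivAt W ((-α) • W u + α • (x u + α⁻¹ • drift d lam (x u))) u := by
    intro u
    have e1 : HasDerivAt (fun u => Real.exp (-α * u)) (Real.exp (-α * u) * -α) u := by
      simpa using ((hasDerivAt_id u).const_mul (-α)).exp
    have e2 := (hcc.integral_hasStrictDerivAt 0 u).hasDerivAt.const_add q₀
    have e3 := e1.smul e2
    have hWu : W u = Real.exp (-α * u) • (q₀ + ∫ s in (0 : ℝ)..u, c s) := rfl
    have hcu : c u = (α * Real.exp (α * u)) • (x u + α⁻¹ • drift d lam (x u)) := rfl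
    have hexp : Real.exp (-α * u) * (α * Real.exp (α * u)) = α := by
      rw [mul_left_comm, ← Real.exp_add, neg_mul, neg_add_cancel, Real.exp_zero, mul_one]
    rw [hcu, smul_smul, hexp, add_comm, mul_comm, mul_smul, ← hWu] at e3
    exact e3
  have hWx : ∀ u ∈ Icc 0 T, W u = x u := fun u hu => (hx u hu).symm
  have hint : IntervalIntegrable (fun u => (-α) • W u + α • (x u + α⁻¹ • drift d lam (x u)))
      volume 0 t := by
    have : Continuous W := continuous_iff_continuousAt.2 fun u => (hWd u).continuousAt
    exact Continuous.intervalIntegrable (by fun_prop) _ _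
  have hftc := intervalIntegral.integral_eq_sub_of_hasDerivAt (fun u _ => hWd u) hint
  have hW0 : W 0 = q₀ := by simp [hW]
  rw [hW0, hWx t t.2] at hftc
  have hcongr : ∫ u in (0 : ℝ)..t, ((-α) • W u + α • (x u + α⁻¹ • drift d lam (x u)))
      = ∫ u in (0 : ℝ)..t, drift d lam (x u) := by
    refine intervalIntegral.integral_congr fun u hu => ?_
    rw [uIcc_of_le t.2.1] at hu
    rw [hWx u ⟨hu.1, hu.2.trans t.2.2⟩, smul_add, smul_smul, mul_inv_cancel₀ hα.ne', one_smul,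
      ← add_assoc, neg_smul, neg_add_cancel, zero_add]
  rw [hcongr] at hftc
  rw [hftc]; abel

/-! ### Lebesgue measure of the windows -/

theorem map_lebHalf : lebHalf.map Subtype.val = volume.restrict (Ici (0 : ℝ)) :=
  map_comap_subtype_coe measurableSet_Ici _

theorem lebHalf_preimage_Ico {a b : ℝ} (ha : 0 ≤ a) :
    lebHalf (Subtype.val ⁻¹' Ico a b) = ENNReal.ofReal (b - a) := by
  rw [← Measure.map_apply measurable_subtype_coe measurableSet_Ico, map_lebHalf,
    Measure.restrict_apply measurableSet_Ico, inter_eq_self_of_subset_left, Real.volume_Ico]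
  exact fun x hx => ha.trans hx.1

instance : SigmaFinite lebHalf :=
  ⟨⟨⟨fun n => Subtype.val ⁻¹' Ico (0 : ℝ) n, fun _ => trivial,
    fun n => by rw [lebHalf_preimage_Ico le_rfl]; exact ENNReal.ofReal_lt_top,
    eq_univ_of_forall fun y => mem_iUnion.2 <| by
      obtain ⟨n, hn⟩ := exists_nat_gt (y : ℝ)
      exact ⟨n, y.2, hn⟩⟩⟩⟩

theorem lebHalf_arrWin {lam : ℝ} (r : ℕ → ℝ) (i : ℕ) :
    lebHalf (Subtype.val ⁻¹' arrWin lam r i) = ENNReal.ofReal (lam * r i) := by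
  have hm : (0 : ℝ) < max lam 1 := lt_of_lt_of_le one_pos (le_max_right _ _)
  rw [arrWin, lebHalf_preimage_Ico (by positivity), add_sub_cancel_left]

theorem lebHalf_depWin {lam : ℝ} (q : L2) (i : ℕ) :
    lebHalf (Subtype.val ⁻¹' depWin lam q i) = ENNReal.ofReal (q (i + 1) - q (i + 2)) := by
  have hm : (0 : ℝ) < max lam 1 := lt_of_lt_of_le one_pos (le_max_right _ _)
  rw [depWin, lebHalf_preimage_Ico (by positivity), add_sub_cancel_left]

theorem measurableSet_arrWin (lam : ℝ) (r : ℕ → ℝ) (i : ℕ) : MeasurableSet (arrWin lam r i) :=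
  measurableSet_Ico

theorem measurableSet_depWin (lam : ℝ) (q : L2) (i : ℕ) : MeasurableSet (depWin lam q i) :=
  measurableSet_Ico

theorem tsum_ofReal_arr_le {lam : ℝ} (hlam : 0 < lam) {r : ℕ → ℝ} (hr0 : ∀ i, 0 ≤ r i)
    (hrs : ∀ m, ∑ i ∈ Finset.range m, r i ≤ 1) :
    ∑' i, ENNReal.ofReal (lam * r i) ≤ ENNReal.ofReal lam := by
  refine ENNReal.tsum_le_of_sum_range_le fun m => ?_
  rw [← ENNReal.ofReal_sum_of_nonneg fun i _ => mul_nonneg hlam.le (hr0 i), ← Finset.mul_sum]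
  exact ENNReal.ofReal_le_ofReal (mul_le_of_le_one_right hlam.le (hrs m))

theorem tsum_ofReal_dep_le {q : L2} (hq : q ∈ limitStates) :
    ∑' i, ENNReal.ofReal (q (i + 1) - q (i + 2)) ≤ 1 := by
  refine ENNReal.tsum_le_of_sum_range_le fun m => ?_
  rw [← ENNReal.ofReal_sum_of_nonneg fun i _ => sub_nonneg.2 (hq.2 (i + 1)).1,
    Finset.sum_range_sub' (fun i => q (i + 1)), ← ENNReal.ofReal_one]
  exact ENNReal.ofReal_le_ofReal (limitStates.sub_le_one hq _ _)

/-- The lengths telescope: arrivals contribute at most `lam` in total and departures at most `1`,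
however many coordinates are nonzero. This bound on the total rate, uniform in the state, gives
integrability. -/
theorem lebHalf_windows_le {lam : ℝ} (hlam : 0 < lam) {r : ℕ → ℝ} (hr0 : ∀ i, 0 ≤ r i)
    (hrs : ∀ m, ∑ i ∈ Finset.range m, r i ≤ 1) {q : L2} (hq : q ∈ limitStates) :
    lebHalf (Subtype.val ⁻¹' ((⋃ i, arrWin lam r i) ∪ ⋃ i, depWin lam q i))
      ≤ ENNReal.ofReal (lam + 1) := by
  rw [preimage_union, preimage_iUnion, preimage_iUnion]
  refine (measure_union_le _ _).trans ?_
  rw [ENNReal.ofReal_add hlam.le zero_le_one, ENNReal.ofReal_one]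
  refine add_le_add ((measure_iUnion_le _).trans ?_) ((measure_iUnion_le _).trans ?_)
  · simp_rw [lebHalf_arrWin]; exact tsum_ofReal_arr_le hlam hr0 hrs
  · simp_rw [lebHalf_depWin]; exact tsum_ofReal_dep_le hq

theorem le_one_of_sum_le {r : ℕ → ℝ} (hr0 : ∀ i, 0 ≤ r i)
    (hrs : ∀ m, ∑ i ∈ Finset.range m, r i ≤ 1) (i : ℕ) : r i ≤ 1 :=
  (Finset.single_le_sum (fun j _ => hr0 j) (Finset.mem_range.2 (Nat.lt_succ_self i))).trans
    (hrs (i + 1))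

theorem stronglyMeasurable_jump (lam : ℝ) (r : ℕ → ℝ) (q : L2) :
    StronglyMeasurable (jump lam r q) := by
  refine stronglyMeasurable_of_coord fun i => ?_
  rcases i with _ | i
  · simp only [jump_zero]; exact measurable_const
  · simp only [jump_succ]
    exact ((measurable_one.indicator (measurableSet_arrWin lam r i)).comp measurable_subtype_coe).sub
      ((measurable_one.indicator (measurableSet_depWin lam q i)).comp measurable_subtype_coe)

theorem lintegral_norm_jump_le {lam : ℝ} (hlam : 0 < lam) {r : ℕ → ℝ} (hr0 : ∀ i, 0 ≤ r i)
    (hrs : ∀ m, ∑ i ∈ Finset.range m, r i ≤ 1) {q : L2} (hq : q ∈ limitStates) :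
    ∫⁻ y, ‖jump lam r q y‖ₑ ∂lebHalf ≤ ENNReal.ofReal (lam + 1) := by
  refine le_trans ?_ (lebHalf_windows_le hlam hr0 hrs hq)
  have hms : MeasurableSet ((Subtype.val : Half → ℝ) ⁻¹'
      ((⋃ i, arrWin lam r i) ∪ ⋃ i, depWin lam q i)) :=
    measurable_subtype_coe ((MeasurableSet.iUnion fun i => measurableSet_arrWin lam r i).union
      (MeasurableSet.iUnion fun i => measurableSet_depWin lam q i))
  rw [← lintegral_indicator_one hms]
  refine lintegral_mono fun y => ?_
  have h := norm_jump_le_indicator hlam (le_one_of_sum_le hr0 hrs)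
    (fun i => limitStates.sub_le_one hq (i + 1) (i + 2)) y
  by_cases hy : (y : ℝ) ∈ (⋃ i, arrWin lam r i) ∪ ⋃ i, depWin lam q i
  · rw [indicator_of_mem hy] at h
    have hy' : y ∈ (Subtype.val : Half → ℝ) ⁻¹'
      ((⋃ i, arrWin lam r i) ∪ ⋃ i, depWin lam q i) := hy
    rw [indicator_of_mem hy', ← ofReal_norm, Pi.one_apply, ← ENNReal.ofReal_one]
    exact ENNReal.ofReal_le_ofReal h
  · rw [indicator_of_notMem hy] at h
    rw [← ofReal_norm, ENNReal.ofReal_of_nonpos h]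
    exact zero_le

theorem integrable_jump {lam : ℝ} (hlam : 0 < lam) {r : ℕ → ℝ} (hr0 : ∀ i, 0 ≤ r i)
    (hrs : ∀ m, ∑ i ∈ Finset.range m, r i ≤ 1) {q : L2} (hq : q ∈ limitStates) :
    Integrable (jump lam r q) lebHalf :=
  ⟨(stronglyMeasurable_jump lam r q).aestronglyMeasurable,
    (lintegral_norm_jump_le hlam hr0 hrs hq).trans_lt ENNReal.ofReal_lt_top⟩

theorem integral_jump_succ {lam : ℝ} (hlam : 0 < lam) {r : ℕ → ℝ} (hr0 : ∀ i, 0 ≤ r i)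
    (hrs : ∀ m, ∑ i ∈ Finset.range m, r i ≤ 1) {q : L2} (hq : q ∈ limitStates) (i : ℕ) :
    (∫ y, jump lam r q y ∂lebHalf) (i + 1) = lam * r i - (q (i + 1) - q (i + 2)) := by
  rw [← coordCLM_apply, ← (coordCLM (i + 1)).integral_comp_comm (integrable_jump hlam hr0 hrs hq)]
  simp only [coordCLM_apply, jump_succ]
  have hA := measurableSet_preimage (f := (Subtype.val : Half → ℝ)) measurable_subtype_coe
    (measurableSet_arrWin lam r i)
  have hB := measurableSet_preimage (f := (Subtype.val : Half → ℝ)) measurable_subtype_coe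
    (measurableSet_depWin lam q i)
  have eA : (fun y : Half => (arrWin lam r i).indicator (1 : ℝ → ℝ) (y : ℝ))
      = (Subtype.val ⁻¹' arrWin lam r i).indicator (1 : Half → ℝ) := rfl
  have eB : (fun y : Half => (depWin lam q i).indicator (1 : ℝ → ℝ) (y : ℝ))
      = (Subtype.val ⁻¹' depWin lam q i).indicator (1 : Half → ℝ) := rfl
  rw [integral_sub, eA, eB, integral_indicator_one hA, integral_indicator_one hB, measureReal_def,
    measureReal_def, lebHalf_arrWin, lebHalf_depWin,
    ENNReal.toReal_ofReal (mul_nonneg hlam.le (hr0 i)),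
    ENNReal.toReal_ofReal (sub_nonneg.2 (hq.2 (i + 1)).1)]
  · rw [eA, integrable_indicator_iff hA]
    exact integrableOn_const (by rw [lebHalf_arrWin]; exact ENNReal.ofReal_ne_top)
  · rw [eB, integrable_indicator_iff hB]
    exact integrableOn_const (by rw [lebHalf_depWin]; exact ENNReal.ofReal_ne_top)

theorem integral_jump_zero {lam : ℝ} (hlam : 0 < lam) {r : ℕ → ℝ} (hr0 : ∀ i, 0 ≤ r i)
    (hrs : ∀ m, ∑ i ∈ Finset.range m, r i ≤ 1) {q : L2} (hq : q ∈ limitStates) :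
    (∫ y, jump lam r q y ∂lebHalf) 0 = 0 := by
  rw [← coordCLM_apply, ← (coordCLM 0).integral_comp_comm (integrable_jump hlam hr0 hrs hq)]
  simp only [coordCLM_apply, jump_zero, integral_zero]

/-! ### The limiting jump coefficient -/

theorem limitRate_nonneg (d : ℕ) {q : L2} (hq : q ∈ limitStates) (i : ℕ) :
    0 ≤ q i ^ d - q (i + 1) ^ d :=
  sub_nonneg.2 (pow_le_pow_left₀ (limitStates.mem_Icc hq (i + 1)).1 (hq.2 i).1 d)

theorem sum_limitRate_le (d : ℕ) {q : L2} (hq : q ∈ limitStates) (m : ℕ) :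
    ∑ i ∈ Finset.range m, (q i ^ d - q (i + 1) ^ d) ≤ 1 := by
  rw [Finset.sum_range_sub' (fun i => q i ^ d), hq.1, one_pow]
  linarith [pow_nonneg (limitStates.mem_Icc hq m).1 d]

theorem integral_G {d : ℕ} {lam : ℝ} (hlam : 0 < lam) {q : L2} (hq : q ∈ limitStates) :
    ∫ y, G d lam q y ∂lebHalf = drift d lam q := by
  refine lp.ext (funext fun i => ?_)
  rcases i with _ | i
  · exact integral_jump_zero hlam (limitRate_nonneg d hq) (sum_limitRate_le d hq) hq
  · exact integral_jump_succ hlam (limitRate_nonneg d hq) (sum_limitRate_le d hq) hq i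

theorem stronglyMeasurable_G_path {T : ℝ} (d : ℕ) (lam : ℝ) (x : C(Icc (0 : ℝ) T, L2)) :
    StronglyMeasurable fun p : MarkTime T => G d lam (x p.2) p.1 := by
  refine stronglyMeasurable_of_coord fun i => ?_
  have hx : ∀ j, Measurable fun p : MarkTime T => x p.2 j := fun j =>
    ((continuous_coord j).comp x.continuous).measurable.comp measurable_snd
  have hy : Measurable fun p : MarkTime T => (p.1 : ℝ) := measurable_subtype_coe.comp measurable_fst
  have hind : ∀ a b : MarkTime T → ℝ, Measurable a → Measurable b →
      Measurable fun p : MarkTime T => (Ico (a p) (b p)).indicator (1 : ℝ → ℝ) (p.1 : ℝ) := by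
    intro a b ha hb
    have : (fun p : MarkTime T => (Ico (a p) (b p)).indicator (1 : ℝ → ℝ) (p.1 : ℝ))
        = ({p : MarkTime T | a p ≤ (p.1 : ℝ)} ∩ {p | (p.1 : ℝ) < b p}).indicator 1 := by
      ext p
      simp only [indicator, mem_Ico, mem_inter_iff, mem_ofPred_eq]
      rfl
    rw [this]
    exact measurable_one.indicator ((measurableSet_le ha hy).inter (measurableSet_lt hy hb))
  rcases i with _ | i
  · simp only [G, jump_zero]; exact measurable_const
  · simp only [G, jump_succ]
    exact (hind _ _ measurable_const (((((hx i).pow_const d).sub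
      ((hx (i + 1)).pow_const d)).const_mul lam).const_add _)).sub
      (hind _ _ measurable_const (((hx (i + 1)).sub (hx (i + 2))).const_add _))

theorem integrable_G_path {T : ℝ} {d : ℕ} {lam : ℝ} (hlam : 0 < lam) {x : C(Icc (0 : ℝ) T, L2)}
    (hx : ∀ t, x t ∈ limitStates) :
    Integrable (fun p : MarkTime T => G d lam (x p.2) p.1) (lebMarkTime T) := by
  refine ⟨(stronglyMeasurable_G_path d lam x).aestronglyMeasurable, ?_⟩
  rw [HasFiniteIntegral, lebMarkTime,
    lintegral_prod_symm' _ (stronglyMeasurable_G_path d lam x).enorm]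
  have h : ∀ s, ∫⁻ y, ‖G d lam (x s) y‖ₑ ∂lebHalf ≤ ENNReal.ofReal (lam + 1) := fun s =>
    lintegral_norm_jump_le hlam (limitRate_nonneg d (hx s)) (sum_limitRate_le d (hx s)) (hx s)
  refine (lintegral_mono h).trans_lt ?_
  rw [lintegral_const]
  exact ENNReal.mul_lt_top ENNReal.ofReal_lt_top (measure_lt_top _ _)

theorem setIntegral_markTime {T : ℝ} {E : Type*} [NormedAddCommGroup E] [NormedSpace ℝ E]
    {f : MarkTime T → E} (hf : Integrable f (lebMarkTime T)) (t : Icc (0 : ℝ) T) :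
    ∫ p in {p : MarkTime T | p.2 ≤ t}, f p ∂lebMarkTime T
      = ∫ s in Iic t, ∫ y, f (y, s) ∂lebHalf ∂lebTime T := by
  have e : {p : MarkTime T | p.2 ≤ t} = univ ×ˢ Iic t := by ext p; simp
  have e2 : (lebMarkTime T).restrict {p : MarkTime T | p.2 ≤ t}
      = lebHalf.prod ((lebTime T).restrict (Iic t)) := by
    rw [e, lebMarkTime, ← Measure.prod_restrict, Measure.restrict_univ]
  have hint := hf.integrableOn (s := {p : MarkTime T | p.2 ≤ t})
  rw [IntegrableOn, e2] at hint
  rw [e2, integral_prod_symm _ hint]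

theorem setIntegral_G_path {T : ℝ} {d : ℕ} {lam : ℝ} (hlam : 0 < lam) {x : C(Icc (0 : ℝ) T, L2)}
    (hx : ∀ t, x t ∈ limitStates) (t : Icc (0 : ℝ) T) :
    ∫ p in {p : MarkTime T | p.2 ≤ t}, G d lam (x p.2) p.1 ∂lebMarkTime T
      = ∫ s in Iic t, drift d lam (x s) ∂lebTime T := by
  have h := setIntegral_markTime (integrable_G_path (d := d) hlam hx) t
  have h2 : (fun s => ∫ y, G d lam (x s) y ∂lebHalf) = fun s => drift d lam (x s) :=
    funext fun s => integral_G hlam (hx s)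
  exact h.trans (congrArg (fun F => ∫ s in Iic t, F s ∂lebTime T) h2)

/-- By Fubini the marks can be integrated out first, and each window has length equal to its rate.
This needs the state constraint: a negative rate would give an empty window instead of a negative
length. -/
theorem solvesJumpEquation_iff {T : ℝ} {d : ℕ} {lam : ℝ} (hlam : 0 < lam) {q₀ : L2}
    {x : C(Icc (0 : ℝ) T, L2)} : SolvesJumpEquation d lam q₀ x ↔
      (∀ t, x t ∈ limitStates) ∧ SolvesDriftEquation d lam q₀ x := by
  constructor
  · intro h
    refine ⟨h.mem_states, fun t => ?_⟩
    rw [← setIntegral_G_path hlam h.mem_states]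
    exact h.equation t
  · rintro ⟨h1, h2⟩
    refine ⟨h1, integrable_G_path hlam h1, fun t => ?_⟩
    rw [setIntegral_G_path hlam h1]
    exact h2 t

/-- Existence, uniqueness and the norm bound for the limit equation. -/
theorem exists_limit {T : ℝ} (hT : 0 ≤ T) (d : ℕ) {lam : ℝ} (hlam : 0 < lam) {q₀ : L2}
    (hq : q₀ ∈ limitStates) : ∃ Q : C(Icc (0 : ℝ) T, L2),
      SolvesJumpEquation d lam q₀ Q ∧ SolvesDriftEquation d lam q₀ Q ∧
      (∀ x : C(Icc (0 : ℝ) T, L2),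
        SolvesJumpEquation d lam q₀ x ∨ SolvesDriftEquation d lam q₀ x → x = Q) ∧
      ∀ t : Icc (0 : ℝ) T,
        ‖Q t‖ ^ 2 ≤ 2 * ‖q₀‖ ^ 2 * Real.exp (8 * (lam * d + 1) ^ 2 * (t : ℝ)) := by
  obtain ⟨Q, hQ, hmem⟩ := exists_solvesDriftEquation hT (d := d) hlam hq
  refine ⟨Q, (solvesJumpEquation_iff hlam).2 ⟨hmem, hQ⟩, hQ, ?_, hQ.norm_sq_le hT hlam hmem⟩
  rintro x (hx | hx)
  · exact ((solvesJumpEquation_iff hlam).1 hx).2.unique hT hlam hQ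
  · exact hx.unique hT hlam hQ

/-! ### Skorokhod's distance for step paths, and measurability by dyadic sampling. -/

/-! ### Step paths -/

theorem Cadlag.ext' {T : ℝ} {E : Type*} [TopologicalSpace E] {x y : Cadlag T E}
    (h : ∀ t, x t = y t) : x = y := by
  obtain ⟨f, _, _⟩ := x
  obtain ⟨g, _, _⟩ := y
  have : f = g := funext h
  subst this
  rfl

theorem tendsto_ite_le_right {T : ℝ} {E : Type*} [TopologicalSpace E] [Zero E]
    (s t : Icc (0 : ℝ) T) (g : E) :
    ContinuousWithinAt (fun u => if s ≤ u then g else 0) (Ici t) t := by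
  by_cases h : s ≤ t
  · have : (fun u => if s ≤ u then g else 0) =ᶠ[𝓝[≥] t] fun _ => g := by
      filter_upwards [self_mem_nhdsWithin] with u hu
      rw [if_pos (h.trans hu)]
    rw [ContinuousWithinAt, if_pos h]
    exact tendsto_const_nhds.congr' this.symm
  · have : (fun u => if s ≤ u then g else 0) =ᶠ[𝓝[≥] t] fun _ => 0 := by
      filter_upwards [mem_nhdsWithin_of_mem_nhds (Iio_mem_nhds (not_le.1 h))] with u hu
      rw [if_neg (not_le.2 hu)]
    rw [ContinuousWithinAt, if_neg h]
    exact tendsto_const_nhds.congr' this.symm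

theorem tendsto_ite_le_left {T : ℝ} {E : Type*} [TopologicalSpace E] [Zero E]
    (s t : Icc (0 : ℝ) T) (g : E) :
    Tendsto (fun u => if s ≤ u then g else 0) (𝓝[<] t) (𝓝 (if s < t then g else 0)) := by
  by_cases h : s < t
  · have : (fun u => if s ≤ u then g else 0) =ᶠ[𝓝[<] t] fun _ => g := by
      filter_upwards [mem_nhdsWithin_of_mem_nhds (Ioi_mem_nhds h)] with u hu
      rw [if_pos (le_of_lt hu)]
    rw [if_pos h]
    exact tendsto_const_nhds.congr' this.symm
  · have : (fun u => if s ≤ u then g else 0) =ᶠ[𝓝[<] t] fun _ => 0 := by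
      filter_upwards [self_mem_nhdsWithin] with u hu
      rw [if_neg (not_le.2 (lt_of_lt_of_le hu (not_lt.1 h)))]
    rw [if_neg h]
    exact tendsto_const_nhds.congr' this.symm

/-- The path `t ↦ q₀ + ∑_{p ∈ F, s p ≤ t} g p`. -/
def stepPath {T : ℝ} {E : Type*} [TopologicalSpace E] [AddCommMonoid E] [ContinuousAdd E]
    {ι : Type*} (F : Finset ι) (s : ι → Icc (0 : ℝ) T) (g : ι → E) (q₀ : E) : Cadlag T E where
  toFun t := q₀ + ∑ p ∈ F, if s p ≤ t then g p else 0
  right_cont t := continuousWithinAt_const.add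
    (tendsto_finsetSum _ fun p _ => tendsto_ite_le_right (s p) t (g p))
  left_lim t := ⟨q₀ + ∑ p ∈ F, if s p < t then g p else 0, tendsto_const_nhds.add
    (tendsto_finsetSum _ fun p _ => tendsto_ite_le_left (s p) t (g p))⟩

theorem stepPath_apply {T : ℝ} {E : Type*} [TopologicalSpace E] [AddCommMonoid E] [ContinuousAdd E]
    {ι : Type*} (F : Finset ι) (s : ι → Icc (0 : ℝ) T) (g : ι → E) (q₀ : E) (t : Icc (0 : ℝ) T) :
    stepPath F s g q₀ t = q₀ + ∑ p ∈ F, if s p ≤ t then g p else 0 := rfl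

theorem nhdsLT_neBot_of_pos {T : ℝ} {t : Icc (0 : ℝ) T} (ht : 0 < (t : ℝ)) : (𝓝[<] t).NeBot := by
  have h0 : (⟨0, le_rfl, ht.le.trans t.2.2⟩ : Icc (0 : ℝ) T) < t := ht
  exact nhdsLT_neBot_of_exists_lt ⟨_, h0⟩

/-- Time `0` has to be excluded: it has no left neighbourhood in `[0, T]`, and `Function.leftLim`
returns the value itself there. -/
theorem leftLim_stepPath {T : ℝ} {E : Type*} [TopologicalSpace E] [AddCommMonoid E]
    [ContinuousAdd E] [T2Space E] {ι : Type*} (F : Finset ι) (s : ι → Icc (0 : ℝ) T) (g : ι → E)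
    (q₀ : E) {t : Icc (0 : ℝ) T} (ht : 0 < (t : ℝ)) :
    Function.leftLim (stepPath F s g q₀) t = q₀ + ∑ p ∈ F, if s p < t then g p else 0 := by
  have := nhdsLT_neBot_of_pos ht
  exact leftLim_eq_of_tendsto (tendsto_const_nhds.add
    (tendsto_finsetSum _ fun p _ => tendsto_ite_le_left (s p) t (g p)))

/-! ### Time changes -/

/-- The tent function. -/
def tent (u : ℝ) : ℝ := max 0 (1 - |u|)

theorem tent_zero : tent 0 = 1 := by simp [tent]

theorem tent_eq_zero {u : ℝ} (h : 1 ≤ |u|) : tent u = 0 := max_eq_left (by linarith)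

theorem abs_tent_le_one (u : ℝ) : |tent u| ≤ 1 := by
  rw [tent, abs_of_nonneg (le_max_left _ _)]
  exact max_le zero_le_one (by linarith [abs_nonneg u])

theorem continuous_tent : Continuous tent := by unfold tent; fun_prop

theorem abs_tent_sub_le (u v : ℝ) : |tent u - tent v| ≤ |u - v| := by
  unfold tent
  refine (abs_max_sub_max_le_max _ _ _ _).trans ?_
  rw [sub_self, abs_zero]
  refine max_le (abs_nonneg _) ?_
  have : 1 - |u| - (1 - |v|) = |v| - |u| := by ring
  rw [this, abs_sub_comm u v]
  exact abs_abs_sub_abs_le_abs_sub v u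

theorem exists_common_gap {T : ℝ} {ι : Type*} (F : Finset ι) (s : ι → Icc (0 : ℝ) T)
    (hs : InjOn s F) (hpos : ∀ p ∈ F, 0 < (s p : ℝ)) :
    ∃ w > 0, ∀ p ∈ F, w ≤ (s p : ℝ) ∧ ((s p : ℝ) < T → w ≤ T - s p) ∧
      ∀ p' ∈ F, p' ≠ p → w ≤ |(s p' : ℝ) - s p| := by
  have key : ∀ a : ℝ, 0 < a → ∀ᶠ w in 𝓝[>] (0 : ℝ), w ≤ a := fun a ha =>
    nhdsWithin_le_nhds (Iic_mem_nhds ha)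
  have h : ∀ᶠ w in 𝓝[>] (0 : ℝ), ∀ p ∈ F, w ≤ (s p : ℝ) ∧ ((s p : ℝ) < T → w ≤ T - s p) ∧
      ∀ p' ∈ F, p' ≠ p → w ≤ |(s p' : ℝ) - s p| := by
    rw [eventually_all_finset]
    intro p hp
    refine (key _ (hpos p hp)).and (Eventually.and ?_ ?_)
    · by_cases hT : (s p : ℝ) < T
      · exact (key (T - s p) (by linarith)).mono fun w hw _ => hw
      · exact Eventually.of_forall fun w h => absurd h hT
    · rw [eventually_all_finset]
      intro p' hp'
      by_cases hne : p' = p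
      · exact Eventually.of_forall fun w h => absurd hne h
      · refine (key _ (abs_pos.2 (sub_ne_zero.2 fun h => hne ?_))).mono fun w hw _ => hw
        exact hs hp' hp (Subtype.ext h)
  obtain ⟨w, hw, hw0⟩ := (h.and self_mem_nhdsWithin).exists
  exact ⟨w, hw0, hw⟩

/-- Finitely many points can be moved a little by a time change that is close to the identity. -/
theorem exists_timeChange {T : ℝ} (hT : 0 < T) {ι : Type*} (F : Finset ι)
    (s : ι → Icc (0 : ℝ) T) (hs : InjOn s F) (hpos : ∀ p ∈ F, 0 < (s p : ℝ)) :
    ∃ η > 0, ∀ (h : ℝ) (s' : ι → Icc (0 : ℝ) T), 0 ≤ h → h < η →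
      (∀ p ∈ F, |(s' p : ℝ) - s p| ≤ h ∧ ((s p : ℝ) = T → (s' p : ℝ) = T)) →
      ∃ θ : Icc (0 : ℝ) T ≃o Icc (0 : ℝ) T, (∀ p ∈ F, θ (s p) = s' p) ∧
        ∀ t, |(θ t : ℝ) - t| ≤ F.card * h := by
  classical
  obtain ⟨w, hw0, hw⟩ := exists_common_gap F s hs hpos
  -- With `h < w / (card F + 1)` the total Lipschitz constant `card F * h / w` of the perturbation
  -- below is less than `1`, so the time change is strictly increasing.
  refine ⟨w / (F.card + 1), by positivity, fun h s' hh0 hh hs' => ?_⟩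
  set c : ι → ℝ := fun p => (s' p : ℝ) - s p with hc
  -- Each tent has half-width `w`: it is `1` at its own point and `0` at all the other points and at
  -- the end points of `[0, T]`. The exception is a tent centred at `T`, whose coefficient is `0` by
  -- hypothesis.
  set φ : ℝ → ℝ := fun t => t + ∑ p ∈ F, c p * tent ((t - s p) / w) with hφ
  have hsum : F.card * h < w := by
    have h1 : F.card * h ≤ F.card * (w / (F.card + 1)) :=
      mul_le_mul_of_nonneg_left hh.le (Nat.cast_nonneg _)
    have h2 : (F.card : ℝ) * (w / (F.card + 1)) < w := by
      rw [mul_div_assoc', div_lt_iff₀ (by positivity)]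
      nlinarith
    linarith
  have hcont : Continuous φ := by
    have := continuous_tent
    fun_prop
  have hmono : StrictMono φ := by
    intro a b hab
    have e : φ b - φ a = (b - a) + ∑ p ∈ F, c p * (tent ((b - s p) / w) - tent ((a - s p) / w)) := by
      simp only [hφ, mul_sub, Finset.sum_sub_distrib]; ring
    have hb : |∑ p ∈ F, c p * (tent ((b - s p) / w) - tent ((a - s p) / w))|
        ≤ F.card * h * ((b - a) / w) := by
      refine (Finset.abs_sum_le_sum_abs _ _).trans ?_
      rw [mul_assoc, ← nsmul_eq_mul]
      refine Finset.sum_le_card_nsmul _ _ _ fun p hp => ?_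
      rw [abs_mul]
      refine mul_le_mul (hs' p hp).1 ((abs_tent_sub_le _ _).trans ?_) (abs_nonneg _) hh0
      rw [← sub_div, sub_sub_sub_cancel_right, abs_div, abs_of_pos hw0, abs_of_pos (sub_pos.2 hab)]
    have h3 : F.card * h * ((b - a) / w) < b - a := by
      rw [mul_div_assoc', div_lt_iff₀ hw0, mul_comm]
      exact mul_lt_mul_of_pos_left hsum (sub_pos.2 hab)
    have := neg_abs_le (∑ p ∈ F, c p * (tent ((b - s p) / w) - tent ((a - s p) / w)))
    linarith
  have hφ0 : φ 0 = 0 := by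
    simp only [hφ, zero_add]
    refine Finset.sum_eq_zero fun p hp => ?_
    rw [tent_eq_zero, mul_zero]
    rw [zero_sub, abs_div, abs_neg, abs_of_pos hw0, le_div_iff₀ hw0, one_mul,
      abs_of_pos (hpos p hp)]
    exact (hw p hp).1
  have hφT : φ T = T := by
    simp only [hφ, add_eq_left]
    refine Finset.sum_eq_zero fun p hp => ?_
    rcases eq_or_lt_of_le (s p).2.2 with h1 | h1
    · rw [hc]
      simp only
      rw [(hs' p hp).2 h1, h1, sub_self, zero_mul]
    · rw [tent_eq_zero, mul_zero]
      rw [abs_div, abs_of_pos hw0, le_div_iff₀ hw0, one_mul, abs_of_pos (by linarith)]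
      exact (hw p hp).2.1 h1
  have hφs : ∀ p ∈ F, φ (s p) = s' p := by
    intro p hp
    simp only [hφ]
    rw [Finset.sum_eq_single_of_mem p hp]
    · rw [sub_self, zero_div, tent_zero, mul_one, hc]; ring
    · intro p' hp' hne
      rw [tent_eq_zero, mul_zero]
      rw [abs_div, abs_of_pos hw0, le_div_iff₀ hw0, one_mul]
      exact (hw p' hp').2.2 p hp hne.symm
  have hφd : ∀ t, |φ t - t| ≤ F.card * h := by
    intro t
    simp only [hφ, add_sub_cancel_left]
    refine (Finset.abs_sum_le_sum_abs _ _).trans ?_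
    rw [← nsmul_eq_mul]
    refine Finset.sum_le_card_nsmul _ _ _ fun p hp => ?_
    rw [abs_mul, ← mul_one h]
    exact mul_le_mul (hs' p hp).1 (abs_tent_le_one _) (abs_nonneg _) hh0
  have hmaps : ∀ t ∈ Icc 0 T, φ t ∈ Icc 0 T := fun t ht =>
    ⟨hφ0 ▸ hmono.monotone ht.1, by
      have := hmono.monotone ht.2
      rwa [hφT] at this⟩
  have hsurj : ∀ u ∈ Icc 0 T, ∃ t ∈ Icc 0 T, φ t = u := by
    intro u hu
    have := intermediate_value_Icc hT.le hcont.continuousOn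
    rw [hφ0, hφT] at this
    exact this hu
  let ψ : Icc (0 : ℝ) T → Icc (0 : ℝ) T := fun t => ⟨φ t, hmaps t t.2⟩
  have hψm : StrictMono ψ := fun a b hab => hmono hab
  have hψs : Function.Surjective ψ := by
    rintro ⟨u, hu⟩
    obtain ⟨t, ht, htu⟩ := hsurj u hu
    exact ⟨⟨t, ht⟩, Subtype.ext htu⟩
  exact ⟨hψm.orderIsoOfSurjective ψ hψs, fun p hp => Subtype.ext (hφs p hp), fun t => hφd t⟩

/-- Moving the jump times of a step path changes it little in Skorokhod's distance. -/
theorem exists_edist_stepPath_le {T : ℝ} (hT : 0 < T) {E : Type*} [NormedAddCommGroup E]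
    {ι : Type*} (F : Finset ι) (s : ι → Icc (0 : ℝ) T) (g : ι → E) (q₀ : E)
    (hs : InjOn s F) (hpos : ∀ p ∈ F, 0 < (s p : ℝ)) :
    ∃ η > 0, ∀ (h : ℝ) (s' : ι → Icc (0 : ℝ) T), 0 ≤ h → h < η →
      (∀ p ∈ F, |(s' p : ℝ) - s p| ≤ h ∧ ((s p : ℝ) = T → (s' p : ℝ) = T)) →
      edist (stepPath F s g q₀) (stepPath F s' g q₀) ≤ ENNReal.ofReal (F.card * h) := by
  obtain ⟨η, hη, H⟩ := exists_timeChange hT F s hs hpos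
  refine ⟨η, hη, fun h s' hh0 hh hs' => ?_⟩
  obtain ⟨θ, hθ, hd⟩ := H h s' hh0 hh hs'
  refine (iInf_le _ θ).trans (max_le (iSup_le fun t => ?_) (iSup_le fun t => ?_))
  · rw [edist_dist, Subtype.dist_eq, Real.dist_eq]
    exact ENNReal.ofReal_le_ofReal (hd t)
  · have : stepPath F s g q₀ t = stepPath F s' g q₀ (θ t) := by
      rw [stepPath_apply, stepPath_apply]
      congr 1
      refine Finset.sum_congr rfl fun p hp => ?_
      rw [← hθ p hp]
      simp only [OrderIso.le_iff_le]
    rw [this, edist_self]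
    exact zero_le

/-! ### Sampling on dyadic grids -/

/-- The dyadic grid of `[0, T]`. -/
def grid {T : ℝ} (hT : 0 < T) (k j : ℕ) : Icc (0 : ℝ) T := projIcc 0 T hT.le (j * (T / 2 ^ k))

theorem grid_val {T : ℝ} (hT : 0 < T) {k j : ℕ} (hj : j ≤ 2 ^ k) :
    (grid hT k j : ℝ) = j * (T / 2 ^ k) := by
  have h : (j : ℝ) * (T / 2 ^ k) ∈ Icc 0 T := by
    refine ⟨by positivity, ?_⟩
    have h1 : (j : ℝ) ≤ 2 ^ k := by exact_mod_cast hj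
    calc (j : ℝ) * (T / 2 ^ k) ≤ 2 ^ k * (T / 2 ^ k) := mul_le_mul_of_nonneg_right h1 (by positivity)
      _ = T := by field_simp
  rw [grid, projIcc_of_mem hT.le h]

theorem grid_zero {T : ℝ} (hT : 0 < T) (k : ℕ) : (grid hT k 0 : ℝ) = 0 := by
  rw [grid_val hT (Nat.zero_le _)]; simp

theorem grid_mono {T : ℝ} (hT : 0 < T) (k : ℕ) : Monotone (grid hT k) := by
  intro i j hij
  refine monotone_projIcc hT.le ?_
  have : (i : ℝ) ≤ j := by exact_mod_cast hij
  exact mul_le_mul_of_nonneg_right this (by positivity)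

theorem grid_succ_sub {T : ℝ} (hT : 0 < T) {k j : ℕ} (hj : j < 2 ^ k) :
    (grid hT k (j + 1) : ℝ) - grid hT k j = T / 2 ^ k := by
  rw [grid_val hT hj, grid_val hT hj.le]; push_cast; ring

/-- The index of the first grid point not before `t`. -/
def gridIndex (T : ℝ) (k : ℕ) (t : ℝ) : ℕ := ⌈t / (T / 2 ^ k)⌉₊

theorem gridIndex_le {T : ℝ} (hT : 0 < T) (k : ℕ) (t : Icc (0 : ℝ) T) :
    gridIndex T k t ≤ 2 ^ k := by
  refine Nat.ceil_le.2 ?_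
  rw [div_le_iff₀ (by positivity)]
  push_cast
  have : (2 : ℝ) ^ k * (T / 2 ^ k) = T := by field_simp
  rw [this]; exact t.2.2

theorem gridIndex_pos {T : ℝ} (hT : 0 < T) (k : ℕ) {t : ℝ} (ht : 0 < t) : 0 < gridIndex T k t :=
  Nat.ceil_pos.2 (by positivity)

theorem gridIndex_le_iff {T : ℝ} (hT : 0 < T) {k j : ℕ} (hj : j ≤ 2 ^ k) (t : Icc (0 : ℝ) T) :
    gridIndex T k t ≤ j ↔ t ≤ grid hT k j := by
  rw [← Subtype.coe_le_coe, grid_val hT hj, gridIndex, Nat.ceil_le, div_le_iff₀ (by positivity)]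

theorem le_grid_gridIndex {T : ℝ} (hT : 0 < T) (k : ℕ) (t : Icc (0 : ℝ) T) :
    t ≤ grid hT k (gridIndex T k t) :=
  (gridIndex_le_iff hT (gridIndex_le hT k t) t).1 le_rfl

theorem grid_gridIndex_lt {T : ℝ} (hT : 0 < T) (k : ℕ) (t : Icc (0 : ℝ) T) :
    (grid hT k (gridIndex T k t) : ℝ) < t + T / 2 ^ k := by
  have hp : 0 < T / 2 ^ k := by positivity
  rw [grid_val hT (gridIndex_le hT k t), gridIndex]
  have := Nat.ceil_lt_add_one (div_nonneg t.2.1 hp.le)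
  have h2 := mul_lt_mul_of_pos_right this hp
  rwa [add_mul, one_mul, div_mul_cancel₀ _ hp.ne'] at h2

/-- The path that jumps at the grid points to the values of `v`. -/
def samplePath {T : ℝ} (hT : 0 < T) {E : Type*} [NormedAddCommGroup E] (k : ℕ) (v : ℕ → E) :
    Cadlag T E :=
  stepPath (Finset.Icc 1 (2 ^ k)) (grid hT k) (fun j => v j - v (j - 1)) (v 0)

/-- Sampling a step path on the grid only postpones each jump to the next grid point; jumps
postponed to the same grid point are added up. A jump at time `0` would be lost, hence `hpos`. -/
theorem samplePath_stepPath {T : ℝ} (hT : 0 < T) {E : Type*} [NormedAddCommGroup E]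
    {ι : Type*} (F : Finset ι) (s : ι → Icc (0 : ℝ) T) (g : ι → E) (q₀ : E)
    (hpos : ∀ p ∈ F, 0 < (s p : ℝ)) (k : ℕ) :
    samplePath hT k (fun j => stepPath F s g q₀ (grid hT k j))
      = stepPath F (fun p => grid hT k (gridIndex T k (s p))) g q₀ := by
  refine Cadlag.ext' fun u => ?_
  have h0 : stepPath F s g q₀ (grid hT k 0) = q₀ := by
    rw [stepPath_apply, Finset.sum_eq_zero, add_zero]
    intro p hp
    rw [if_neg]
    rw [← Subtype.coe_le_coe, grid_zero]
    exact not_le.2 (hpos p hp)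
  have hterm : ∀ j ∈ Finset.Icc 1 (2 ^ k),
      stepPath F s g q₀ (grid hT k j) - stepPath F s g q₀ (grid hT k (j - 1))
      = ∑ p ∈ F, if gridIndex T k (s p) = j then g p else 0 := by
    intro j hj
    rw [Finset.mem_Icc] at hj
    rw [stepPath_apply, stepPath_apply, add_sub_add_left_eq_sub, ← Finset.sum_sub_distrib]
    refine Finset.sum_congr rfl fun p hp => ?_
    have e1 := gridIndex_le_iff hT hj.2 (s p)
    have e2 := gridIndex_le_iff hT ((Nat.sub_le j 1).trans hj.2) (s p)
    simp only [← e1, ← e2]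
    by_cases c1 : gridIndex T k (s p) ≤ j
    · by_cases c2 : gridIndex T k (s p) ≤ j - 1
      · rw [if_pos c1, if_pos c2, if_neg (by omega), sub_self]
      · rw [if_pos c1, if_neg c2, if_pos (by omega), sub_zero]
    · rw [if_neg c1, if_neg (by omega), if_neg (by omega), sub_self]
  rw [samplePath, h0, stepPath_apply, stepPath_apply _ _ g]
  congr 1
  have h1 : ∀ j ∈ Finset.Icc 1 (2 ^ k), (if grid hT k j ≤ u then
        stepPath F s g q₀ (grid hT k j) - stepPath F s g q₀ (grid hT k (j - 1)) else 0)
      = ∑ p ∈ F, if gridIndex T k (s p) = j then (if grid hT k j ≤ u then g p else 0) else 0 := by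
    intro j hj
    rw [hterm j hj]
    split_ifs with hu
    · rfl
    · simp
  rw [Finset.sum_congr rfl h1, Finset.sum_comm]
  refine Finset.sum_congr rfl fun p hp => ?_
  rw [Finset.sum_ite_eq, if_pos]
  exact Finset.mem_Icc.2 ⟨gridIndex_pos hT k (hpos p hp), gridIndex_le hT k (s p)⟩

theorem tendsto_div_two_pow (T : ℝ) : Tendsto (fun k : ℕ => T / 2 ^ k) atTop (𝓝 0) :=
  tendsto_const_nhds.div_atTop (tendsto_pow_atTop_atTop_of_one_lt one_lt_two)

theorem tendsto_samplePath {T : ℝ} (hT : 0 < T) {E : Type*} [NormedAddCommGroup E]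
    {ι : Type*} (F : Finset ι) (s : ι → Icc (0 : ℝ) T) (g : ι → E) (q₀ : E)
    (hs : InjOn s F) (hpos : ∀ p ∈ F, 0 < (s p : ℝ)) :
    Tendsto (fun k => samplePath hT k (fun j => stepPath F s g q₀ (grid hT k j))) atTop
      (𝓝 (stepPath F s g q₀)) := by
  obtain ⟨η, hη, H⟩ := exists_edist_stepPath_le hT F s g q₀ hs hpos
  rw [tendsto_iff_edist_tendsto_0]
  have hlim : Tendsto (fun k : ℕ => ENNReal.ofReal (F.card * (T / 2 ^ k))) atTop (𝓝 0) := by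
    have := ENNReal.tendsto_ofReal ((tendsto_div_two_pow T).const_mul (F.card : ℝ))
    simpa using this
  refine tendsto_of_tendsto_of_tendsto_of_le_of_le' tendsto_const_nhds hlim
    (Eventually.of_forall fun _ => zero_le) ?_
  filter_upwards [(tendsto_div_two_pow T).eventually (gt_mem_nhds hη)] with k hk
  rw [samplePath_stepPath hT F s g q₀ hpos, edist_comm]
  refine H _ _ (by positivity) hk fun p hp => ⟨?_, fun h => ?_⟩
  · have h1 := le_grid_gridIndex hT k (s p)
    have h2 := grid_gridIndex_lt hT k (s p)
    rw [← Subtype.coe_le_coe] at h1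
    rw [abs_of_nonneg (by linarith)]
    linarith
  -- Rounding up stays within `[0, T]`, so a jump at `T` is not moved, as the time change requires.
  · refine le_antisymm (grid hT k _).2.2 ?_
    have h1 := le_grid_gridIndex hT k (s p)
    rw [← Subtype.coe_le_coe] at h1
    linarith

instance (T : ℝ) (E : Type*) [PseudoEMetricSpace E] : BorelSpace (Cadlag T E) := ⟨rfl⟩

/-- Step paths with distinct positive jump times. -/
def IsStepPath {T : ℝ} (x : Cadlag T L2) : Prop :=
  ∃ (F : Finset (MarkTime T)) (g : MarkTime T → L2) (q₀ : L2), InjOn Prod.snd (F : Set (MarkTime T)) ∧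
    (∀ p ∈ F, 0 < (p.2 : ℝ)) ∧ x = stepPath F Prod.snd g q₀

/-- A random step path is measurable if its values at the grid points are measurable maps into a
countable set. -/
theorem measurable_of_grid {T : ℝ} (hT : 0 < T) {α : Type*} [MeasurableSpace α]
    {x : α → Cadlag T L2} (hx : ∀ a, IsStepPath (x a)) {S : Type*} [Countable S]
    [MeasurableSpace S] [MeasurableSingletonClass S] (val : S → L2) (X : ℕ → ℕ → α → S)
    (hX : ∀ k j, Measurable (X k j)) (hval : ∀ k, ∀ j ≤ 2 ^ k, ∀ a, x a (grid hT k j) = val (X k j a)) :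
    Measurable x := by
  have hm : ∀ k, Measurable fun a => samplePath hT k (fun j => x a (grid hT k j)) := by
    intro k
    -- The sampled path depends on finitely many values in a countable set. A map from such a
    -- product is automatically measurable, so the Borel sets of the Skorokhod topology need not be
    -- described.
    let Ψ : (Fin (2 ^ k + 1) → S) → Cadlag T L2 := fun v =>
      samplePath hT k (fun j => val (v (Fin.ofNat _ j)))
    have e : (fun a => samplePath hT k (fun j => x a (grid hT k j)))
        = Ψ ∘ fun a (j : Fin (2 ^ k + 1)) => X k j a := by
      funext a
      refine Cadlag.ext' fun u => ?_
      have hv : ∀ j ≤ 2 ^ k, x a (grid hT k j) = val (X k (Fin.ofNat (2 ^ k + 1) j : Fin _) a) := by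
        intro j hj
        rw [hval k j hj a]
        congr 2
        simp only [Fin.ofNat, Nat.mod_eq_of_lt (Nat.lt_succ_of_le hj)]
      simp only [samplePath, stepPath_apply, Function.comp_apply, Ψ]
      rw [hv 0 (Nat.zero_le _)]
      congr 1
      refine Finset.sum_congr rfl fun j hj => ?_
      rw [Finset.mem_Icc] at hj
      rw [hv j hj.2, hv (j - 1) (by omega)]
    rw [e]
    exact (measurable_of_countable Ψ).comp (measurable_pi_lambda _ fun j => hX k j)
  refine measurable_of_tendsto_metrizable hm (tendsto_pi_nhds.2 fun a => ?_)
  obtain ⟨F, g, q₀, hinj, hpos, e⟩ := hx a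
  rw [e]
  exact tendsto_samplePath hT F Prod.snd g q₀ hinj hpos

/-! ### Pathwise existence, uniqueness and measurability for the occupancy equation. -/

/-! ### Paths with values in the states -/

theorem isClosed_states (n : ℕ) : IsClosed (states n) := by
  have : states n = {q : L2 | q 0 = 1} ∩ ⋂ i, ({q : L2 | q (i + 1) ≤ q i} ∩
      (fun q : L2 => (n : ℝ) * q i) ⁻¹' ((fun k : ℕ => (k : ℝ)) '' Iic n)) := by
    ext q
    simp only [states, mem_ofPred_eq, mem_inter_iff, mem_iInter, mem_preimage, mem_image, mem_Iic]
    refine and_congr_right fun _ => forall_congr' fun i => and_congr_right fun _ => ?_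
    exact ⟨fun ⟨k, h1, h2⟩ => ⟨k, h1, h2.symm⟩, fun ⟨k, h1, h2⟩ => ⟨k, h1, h2.symm⟩⟩
  rw [this]
  refine (isClosed_eq (continuous_coord 0) continuous_const).inter (isClosed_iInter fun i => ?_)
  refine (isClosed_le (continuous_coord _) (continuous_coord _)).inter (IsClosed.preimage ?_ ?_)
  · exact (continuous_coord i).const_mul _
  · exact ((finite_Iic n).image _).isClosed

theorem Cadlag.leftLim_mem {T : ℝ} {E : Type*} [TopologicalSpace E] (x : Cadlag T E)
    {C : Set E} (hC : IsClosed C) (h : ∀ t, x t ∈ C) (t : Icc (0 : ℝ) T) :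
    Function.leftLim x t ∈ C := by
  by_cases hb : 𝓝[<] t = ⊥
  · rw [leftLim_eq_of_eq_bot _ hb]; exact h t
  · have : (𝓝[<] t).NeBot := ⟨hb⟩
    exact hC.mem_of_tendsto (tendsto_leftLim_of_tendsto (x.left_lim t))
      (Eventually.of_forall fun s => h s)

/-- `IsOccupancyPath`, for a measure that need not be finite on compact sets. -/
structure IsPathFor {T : ℝ} (d : ℕ) (lam : ℝ) (n : ℕ) (q₀ : L2)
    (μ : Measure (MarkTime T)) (x : Cadlag T L2) : Prop where
  mem_states : ∀ t, x t ∈ states n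
  integrable : Integrable (fun p : MarkTime T => Gn d lam n (Function.leftLim x p.2) p.1) μ
  equation : ∀ t, x t = q₀ + (n : ℝ)⁻¹ •
    ∫ p in {p : MarkTime T | p.2 ≤ t}, Gn d lam n (Function.leftLim x p.2) p.1 ∂μ

theorem isOccupancyPath_iff {T : ℝ} {d : ℕ} {lam : ℝ} {n : ℕ} {q₀ : L2}
    {μ : RadonMeasure (MarkTime T)} {x : Cadlag T L2} :
    IsOccupancyPath d lam n q₀ μ x ↔ IsPathFor d lam n q₀ μ.1 x :=
  ⟨fun h => ⟨h.1, h.2, h.3⟩, fun h => ⟨h.1, h.2, h.3⟩⟩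

/-- The marks that can raise coordinate `i + 1`. -/
def strip (T lam : ℝ) (i : ℕ) : Set (MarkTime T) :=
  {p | (p.1 : ℝ) ∈ Ico (2 * i * max lam 1) (2 * i * max lam 1 + lam)}

theorem measurableSet_le_time {T : ℝ} (t : Icc (0 : ℝ) T) :
    MeasurableSet {p : MarkTime T | p.2 ≤ t} :=
  measurableSet_le measurable_snd measurable_const

/-- Only marks in `strip T lam i` can raise coordinate `i + 1`, because the arrival rate is at most
one. If there are none, this coordinate starts at `0` and never increases; monotonicity of the state
handles the higher ones. -/
theorem IsPathFor.eq_zero_of_strip {T : ℝ} {d : ℕ} {lam : ℝ} {n : ℕ} {q₀ : L2}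
    {μ : Measure (MarkTime T)} {x : Cadlag T L2} (hlam : 0 < lam) (hn : d ≤ n) (hn0 : 0 < n)
    (hx : IsPathFor d lam n q₀ μ x) {i : ℕ} (hi : q₀ (i + 1) = 0) (hμ : μ (strip T lam i) = 0)
    (t : Icc (0 : ℝ) T) {j : ℕ} (hj : i + 1 ≤ j) : x t j = 0 := by
  have hL := states_subset_limitStates hn0 (hx.mem_states t)
  have h0 : x t (i + 1) ≤ 0 := by
    rw [hx.equation t, ← coordCLM_apply, map_add, map_smul,
      ← (coordCLM (i + 1)).integral_comp_comm hx.integrable.integrableOn, coordCLM_apply, hi,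
      zero_add, smul_eq_mul]
    refine mul_nonpos_of_nonneg_of_nonpos (by positivity) (integral_nonpos_of_ae ?_)
    refine ae_restrict_of_ae ?_
    filter_upwards [measure_eq_zero_iff_ae_notMem.1 hμ] with p hp
    rw [coordCLM_apply, Gn, jump_succ, indicator_of_notMem, zero_sub, Pi.zero_apply, neg_nonpos]
    · exact indicator_nonneg (fun _ _ => zero_le_one) _
    · intro h
      refine hp ⟨h.1, lt_of_lt_of_le h.2 ?_⟩
      have := arrivalRate_le_one hn (x.leftLim_mem (isClosed_states n) hx.mem_states p.2) i
      nlinarith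
  exact le_antisymm ((limitStates.antitone hL hj).trans h0) (limitStates.mem_Icc hL j).1

/-- The marks below `K`. -/
def below (T : ℝ) (K : ℕ) : Set (MarkTime T) := {p | (p.1 : ℝ) < K}

theorem measurableSet_below (T : ℝ) (K : ℕ) : MeasurableSet (below T K) :=
  measurableSet_lt (measurable_subtype_coe.comp measurable_fst) measurable_const

/-- If the path vanishes from coordinate `m` on, all its nonempty windows lie below `K`, and points
with larger marks have no effect. -/
theorem isPathFor_restrict_iff {T : ℝ} {d : ℕ} {lam : ℝ} {n : ℕ} {q₀ : L2}
    {μ : Measure (MarkTime T)} {x : Cadlag T L2} (hlam : 0 < lam) (hn : d ≤ n) (hn0 : 0 < n)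
    {m K : ℕ} (hK : (2 * m + 2) * max lam 1 ≤ K) (hx : ∀ t, x t ∈ states n)
    (hm : ∀ t, ∀ j, m ≤ j → x t j = 0) :
    IsPathFor d lam n q₀ (μ.restrict (below T K)) x ↔ IsPathFor d lam n q₀ μ x := by
  have hzero : ∀ p : MarkTime T, p ∉ below T K → Gn d lam n (Function.leftLim x p.2) p.1 = 0 := by
    intro p hp
    refine Gn_eq_zero_of_le hlam hn hn0 (x.leftLim_mem (isClosed_states n) hx p.2) (m := m) ?_ ?_
    · intro j hj
      have hC : IsClosed {q : L2 | q j = 0} := isClosed_eq (continuous_coord j) continuous_const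
      exact x.leftLim_mem hC (fun t => hm t j hj) p.2
    · exact hK.trans (not_lt.1 hp)
  have e1 : Integrable (fun p : MarkTime T => Gn d lam n (Function.leftLim x p.2) p.1)
      (μ.restrict (below T K))
      ↔ Integrable (fun p : MarkTime T => Gn d lam n (Function.leftLim x p.2) p.1) μ := by
    refine integrableOn_iff_integrable_of_support_subset fun p hp => ?_
    by_contra h
    exact hp (hzero p h)
  have e2 : ∀ t : Icc (0 : ℝ) T, ∫ p in {p : MarkTime T | p.2 ≤ t},
      Gn d lam n (Function.leftLim x p.2) p.1 ∂(μ.restrict (below T K))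
      = ∫ p in {p : MarkTime T | p.2 ≤ t}, Gn d lam n (Function.leftLim x p.2) p.1 ∂μ := by
    intro t
    rw [Measure.restrict_restrict (measurableSet_le_time t)]
    refine (setIntegral_eq_of_subset_of_forall_sdiff_eq_zero (measurableSet_le_time t)
      inter_subset_left fun p hp => hzero p fun h => hp.2 ⟨hp.1, h⟩).symm
  constructor
  · intro h
    exact ⟨h.1, e1.1 h.2, fun t => by rw [h.3 t, e2]⟩
  · intro h
    exact ⟨h.1, e1.2 h.2, fun t => by rw [h.3 t, e2]⟩

/-- The counting measure of a finite set of points. -/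
def countPts {T : ℝ} (F : Finset (MarkTime T)) : Measure (MarkTime T) :=
  ∑ p ∈ F, Measure.dirac p

theorem countPts_apply {T : ℝ} (F : Finset (MarkTime T)) {A : Set (MarkTime T)}
    (hA : MeasurableSet A) : countPts F A = ∑ p ∈ F, A.indicator 1 p := by
  simp only [countPts, Measure.coe_finsetSum, Finset.sum_apply, Measure.dirac_apply' _ hA]

theorem integral_countPts {T : ℝ} (F : Finset (MarkTime T)) (f : MarkTime T → L2) :
    ∫ p, f p ∂(countPts F) = ∑ p ∈ F, f p := by
  rw [countPts, integral_finsetSum_measure]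
  · simp only [integral_dirac]
  · exact fun p _ => integrable_dirac (by simp)

theorem isPathFor_countPts_iff {T : ℝ} {d : ℕ} {lam : ℝ} {n : ℕ} {q₀ : L2}
    {F : Finset (MarkTime T)} {x : Cadlag T L2} :
    IsPathFor d lam n q₀ (countPts F) x ↔ (∀ t, x t ∈ states n) ∧
      x = stepPath F Prod.snd
        (fun p => (n : ℝ)⁻¹ • Gn d lam n (Function.leftLim x p.2) p.1) q₀ := by
  have hint : Integrable (fun p : MarkTime T => Gn d lam n (Function.leftLim x p.2) p.1)
      (countPts F) := by
    rw [countPts, integrable_finsetSum_measure]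
    exact fun p _ => integrable_dirac (by simp)
  have e : ∀ t : Icc (0 : ℝ) T, q₀ + (n : ℝ)⁻¹ • ∫ p in {p : MarkTime T | p.2 ≤ t},
      Gn d lam n (Function.leftLim x p.2) p.1 ∂(countPts F)
      = stepPath F Prod.snd
        (fun p => (n : ℝ)⁻¹ • Gn d lam n (Function.leftLim x p.2) p.1) q₀ t := by
    intro t
    rw [← integral_indicator (measurableSet_le_time t), integral_countPts, stepPath_apply,
      Finset.smul_sum]
    congr 1
    refine Finset.sum_congr rfl fun p _ => ?_
    by_cases h : p.2 ≤ t
    · rw [indicator_of_mem (show p ∈ {p : MarkTime T | p.2 ≤ t} from h), if_pos h]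
    · rw [indicator_of_notMem (show p ∉ {p : MarkTime T | p.2 ≤ t} from h), if_neg h, smul_zero]
  constructor
  · intro h
    exact ⟨h.1, Cadlag.ext' fun t => by rw [h.3 t, e]⟩
  · rintro ⟨h1, h2⟩
    exact ⟨h1, hint, fun t => by rw [e, ← h2]⟩

/-- Finitely many points with distinct positive times drive a path. -/
theorem exists_isPathFor_countPts {T : ℝ} {d : ℕ} {lam : ℝ} {n : ℕ} {q₀ : L2} (hlam : 0 < lam)
    (hn : d ≤ n) (hn0 : 0 < n) (hq : q₀ ∈ states n) (F : Finset (MarkTime T))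
    (hinj : InjOn Prod.snd (F : Set (MarkTime T))) (hpos : ∀ p ∈ F, 0 < (p.2 : ℝ)) :
    ∃ x, IsPathFor d lam n q₀ (countPts F) x := by
  classical
  -- The jumps `g p` are the unknowns, and the left limit at `p.2` is written out as the sum of the
  -- earlier jumps. The fixed point equation becomes an explicit recursion in time.
  suffices H : ∃ g : MarkTime T → L2,
      (∀ p ∈ F, g p = (n : ℝ)⁻¹ • Gn d lam n (q₀ + ∑ p' ∈ F, if p'.2 < p.2 then g p' else 0) p.1) ∧
      (∀ t, stepPath F Prod.snd g q₀ t ∈ states n) by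
    obtain ⟨g, hg, hmem⟩ := H
    refine ⟨stepPath F Prod.snd g q₀, isPathFor_countPts_iff.2 ⟨hmem, Cadlag.ext' fun t => ?_⟩⟩
    rw [stepPath_apply, stepPath_apply]
    congr 1
    refine Finset.sum_congr rfl fun p hp => ?_
    rw [leftLim_stepPath _ _ _ _ (hpos p hp), ← hg p hp]
  revert hinj hpos
  -- The point with the latest time is added last, so it does not affect the earlier jumps.
  refine Finset.induction_on_max_value (fun p : MarkTime T => p.2) F ?_ ?_
  · exact fun _ _ => ⟨fun _ => 0, by simp, fun t => by simpa [stepPath_apply] using hq⟩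
  · intro a F ha hmax ih hinj hpos
    obtain ⟨g, hg, hmem⟩ := ih (hinj.mono (by simp)) fun p hp => hpos p (Finset.mem_insert_of_mem hp)
    have hlt : ∀ p ∈ F, p.2 < a.2 := fun p hp => lt_of_le_of_ne (hmax p hp) fun h =>
      ha (hinj (by simp [hp]) (by simp) h ▸ hp)
    have hne : ∀ p ∈ F, p ≠ a := fun p hp h => ha (h ▸ hp)
    set v : L2 := q₀ + ∑ p ∈ F, g p with hv
    have hvmem : v ∈ states n := by
      have := hmem a.2
      rw [stepPath_apply] at this
      rwa [Finset.sum_congr rfl fun p hp => if_pos (hlt p hp).le] at this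
    let g' : MarkTime T → L2 := fun p => if p = a then (n : ℝ)⁻¹ • Gn d lam n v a.1 else g p
    have hg'a : g' a = (n : ℝ)⁻¹ • Gn d lam n v a.1 := if_pos rfl
    have hg'F : ∀ p ∈ F, g' p = g p := fun p hp => if_neg (hne p hp)
    refine ⟨g', ?_, fun t => ?_⟩
    · intro p hp
      rw [Finset.sum_insert ha]
      rcases Finset.mem_insert.1 hp with rfl | hpF
      · rw [if_neg (lt_irrefl _), zero_add, hg'a]
        congr 3
        rw [hv]
        congr 1
        exact Finset.sum_congr rfl fun p' hp' => by rw [if_pos (hlt p' hp'), hg'F p' hp']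
      · rw [if_neg (hlt p hpF).not_gt, zero_add, hg'F p hpF, hg p hpF,
          Finset.sum_congr rfl fun p' hp' => by rw [← hg'F p' hp']]
    · rw [stepPath_apply, Finset.sum_insert ha]
      have e : ∑ p ∈ F, (if p.2 ≤ t then g' p else 0) = ∑ p ∈ F, if p.2 ≤ t then g p else 0 :=
        Finset.sum_congr rfl fun p hp => by rw [hg'F p hp]
      rw [e]
      by_cases hat : a.2 ≤ t
      · rw [if_pos hat, hg'a, Finset.sum_congr rfl fun p hp => if_pos ((hlt p hp).le.trans hat),
          add_left_comm, add_comm]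
        exact add_jump_mem_states hlam hn hn0 hvmem a.1
      · rw [if_neg hat, zero_add]
        exact hmem t

/-! ### Dyadic blocks of time -/

/-- The `j`-th dyadic block of time. -/
def block {T : ℝ} (hT : 0 < T) (k j : ℕ) : Set (Icc (0 : ℝ) T) :=
  Ioc (grid hT k j) (grid hT k (j + 1))

theorem measurableSet_block {T : ℝ} (hT : 0 < T) (k j : ℕ) : MeasurableSet (block hT k j) :=
  measurableSet_Ioc

theorem mem_block_iff {T : ℝ} (hT : 0 < T) {k j : ℕ} (hj : j < 2 ^ k) (t : Icc (0 : ℝ) T) :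
    t ∈ block hT k j ↔ gridIndex T k t = j + 1 := by
  rw [block, mem_Ioc, ← gridIndex_le_iff hT hj, ← not_le, ← gridIndex_le_iff hT hj.le]
  omega

theorem grid_refine {T : ℝ} (hT : 0 < T) {k k' : ℕ} (h : k ≤ k') (j : ℕ) :
    grid hT k' (j * 2 ^ (k' - k)) = grid hT k j := by
  unfold grid
  congr 1
  obtain ⟨l, rfl⟩ := Nat.exists_eq_add_of_le h
  rw [Nat.add_sub_cancel_left, pow_add]
  push_cast
  field_simp

theorem tendsto_grid_gridIndex {T : ℝ} (hT : 0 < T) (t : Icc (0 : ℝ) T) :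
    Tendsto (fun k => grid hT k (gridIndex T k t)) atTop (𝓝[≥] t) := by
  refine tendsto_nhdsWithin_of_tendsto_nhds_of_eventually_within _ ?_
    (Eventually.of_forall fun k => le_grid_gridIndex hT k t)
  rw [tendsto_subtype_rng]
  have h2 : Tendsto (fun k : ℕ => (t : ℝ) + T / 2 ^ k) atTop (𝓝 t) := by
    simpa using (tendsto_div_two_pow T).const_add (t : ℝ)
  exact tendsto_of_tendsto_of_tendsto_of_le_of_le tendsto_const_nhds h2
    (fun k => le_grid_gridIndex hT k t) (fun k => (grid_gridIndex_lt hT k t).le)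

/-! ### Measures with a unique path -/

/-- The marks below `K` with times in a block. -/
def cell {T : ℝ} (hT : 0 < T) (K k j : ℕ) : Set (MarkTime T) :=
  below T K ∩ {p | p.2 ∈ block hT k j}

theorem measurableSet_cell {T : ℝ} (hT : 0 < T) (K k j : ℕ) : MeasurableSet (cell hT K k j) :=
  (measurableSet_below T K).inter (measurable_snd (measurableSet_block hT k j))

/-- Sufficient conditions, in terms of countably many values of the measure, for the existence of
a unique path: the measure counts points with distinct positive times, and infinitely many strips
are empty. -/
structure Good {T : ℝ} (hT : 0 < T) (lam : ℝ) (μ : Measure (MarkTime T)) : Prop where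
  zero : μ {p | (p.2 : ℝ) ≤ 0} = 0
  cells : ∀ K : ℕ, ∃ k : ℕ, ∀ j : ℕ, j < 2 ^ k →
    ∀ U ∈ insert univ (TopologicalSpace.countableBasis (MarkTime T)),
      μ (cell hT K k j ∩ U) = 0 ∨ μ (cell hT K k j ∩ U) = 1
  strips : ∀ m : ℕ, ∃ i : ℕ, m ≤ i ∧ μ (strip T lam i) = 0

theorem measurableSet_strip (T lam : ℝ) (i : ℕ) : MeasurableSet (strip T lam i) :=
  (measurable_subtype_coe.comp measurable_fst) measurableSet_Ico

theorem measurableSet_basis {T : ℝ} {U : Set (MarkTime T)}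
    (hU : U ∈ insert univ (TopologicalSpace.countableBasis (MarkTime T))) : MeasurableSet U := by
  rcases hU with rfl | hU
  · exact MeasurableSet.univ
  · exact (TopologicalSpace.isOpen_of_mem_countableBasis hU).measurableSet

/-- This is why `Good` is phrased through a countable basis: the event is obtained by countable
operations from evaluations at fixed sets. -/
theorem measurableSet_good {T : ℝ} (hT : 0 < T) (lam : ℝ) :
    MeasurableSet {μ : Measure (MarkTime T) | Good hT lam μ} := by
  have hm : ∀ (A : Set (MarkTime T)) (c : ℝ≥0∞), MeasurableSet A →
      MeasurableSet {μ : Measure (MarkTime T) | μ A = c} := fun A c hA =>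
    (Measure.measurable_coe hA) (measurableSet_singleton c)
  have e : {μ : Measure (MarkTime T) | Good hT lam μ}
      = {μ | μ {p | (p.2 : ℝ) ≤ 0} = 0} ∩ ((⋂ K : ℕ, ⋃ k : ℕ, ⋂ j : ℕ, ⋂ _ : j < 2 ^ k,
          ⋂ U ∈ insert univ (TopologicalSpace.countableBasis (MarkTime T)),
            ({μ | μ (cell hT K k j ∩ U) = 0} ∪ {μ | μ (cell hT K k j ∩ U) = 1})) ∩
        ⋂ m : ℕ, ⋃ i : ℕ, ⋃ _ : m ≤ i, {μ | μ (strip T lam i) = 0}) := by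
    ext μ
    simp only [mem_ofPred_eq, mem_inter_iff, mem_iInter, mem_iUnion, mem_union, exists_prop]
    exact ⟨fun h => ⟨h.1, h.2, h.3⟩, fun h => ⟨h.1, h.2.1, h.2.2⟩⟩
  rw [e]
  refine (hm _ _ ?_).inter (MeasurableSet.inter ?_ ?_)
  · exact measurableSet_le (measurable_subtype_coe.comp measurable_snd) measurable_const
  · refine MeasurableSet.iInter fun K => MeasurableSet.iUnion fun k => MeasurableSet.iInter fun j =>
      MeasurableSet.iInter fun _ => MeasurableSet.biInter
        ((TopologicalSpace.countable_countableBasis _).insert _) fun U hU => ?_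
    have := (measurableSet_cell hT K k j).inter (measurableSet_basis hU)
    exact (hm _ _ this).union (hm _ _ this)
  · exact MeasurableSet.iInter fun m => MeasurableSet.iUnion fun i => MeasurableSet.iUnion fun _ =>
      hm _ _ (measurableSet_strip T lam i)

/-- A probability measure that takes the values `0` and `1` on a countable basis is a Dirac
measure. -/
theorem exists_eq_dirac {S : Type*} [TopologicalSpace S] [SecondCountableTopology S] [T0Space S]
    [MeasurableSpace S] [OpensMeasurableSpace S] [Nonempty S] (ν : Measure S) (h1 : ν univ = 1)
    (hU : ∀ U ∈ TopologicalSpace.countableBasis S, ν U = 0 ∨ ν U = 1) :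
    ∃ p, ν = Measure.dirac p := by
  have : IsProbabilityMeasure ν := ⟨h1⟩
  have hsep : HasCountableSeparatingOn S (fun U => U ∈ TopologicalSpace.countableBasis S) univ := by
    refine ⟨⟨TopologicalSpace.countableBasis S, TopologicalSpace.countable_countableBasis S,
      fun U hU => hU, fun x _ y _ h => ?_⟩⟩
    exact ((TopologicalSpace.isBasis_countableBasis S).inseparable_iff.2 h).eq
  -- Every basic open set is null or conull and the basis separates points, so the identity map is
  -- almost everywhere constant.
  obtain ⟨p, hp⟩ := Filter.exists_eventuallyEq_const_of_forall_separating (l := ae ν)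
    (f := (id : S → S)) (fun U => U ∈ TopologicalSpace.countableBasis S) (fun U hUb => by
      have hm := (TopologicalSpace.isOpen_of_mem_countableBasis hUb).measurableSet
      rcases hU U hUb with h | h
      · exact Or.inr (measure_eq_zero_iff_ae_notMem.1 h)
      · exact Or.inl ((prob_compl_eq_zero_iff hm).2 h))
  refine ⟨p, ?_⟩
  calc ν = ν.map id := Measure.map_id.symm
    _ = ν.map fun _ => p := Measure.map_congr hp
    _ = Measure.dirac p := by rw [Measure.map_const, h1, one_smul]

theorem Good.exists_countPts_cell {T : ℝ} {hT : 0 < T} {μ : Measure (MarkTime T)} {K k j : ℕ}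
    (h : ∀ U ∈ insert univ (TopologicalSpace.countableBasis (MarkTime T)),
      μ (cell hT K k j ∩ U) = 0 ∨ μ (cell hT K k j ∩ U) = 1) :
    ∃ F : Finset (MarkTime T), μ.restrict (cell hT K k j) = countPts F ∧
      (∀ p ∈ F, ∀ p' ∈ F, p = p') ∧ ∀ p ∈ F, p ∈ cell hT K k j := by
  have hm := measurableSet_cell hT K k j
  rcases h univ (mem_insert _ _) with h0 | h1
  · rw [inter_univ] at h0
    exact ⟨∅, by rw [Measure.restrict_eq_zero.2 h0]; simp [countPts], by simp, by simp⟩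
  · rw [inter_univ] at h1
    have : Nonempty (Icc (0 : ℝ) T) := ⟨⟨0, le_rfl, hT.le⟩⟩
    obtain ⟨p, hp⟩ := exists_eq_dirac (μ.restrict (cell hT K k j))
      (by rw [Measure.restrict_apply_univ, h1]) (fun U hU => by
        rw [Measure.restrict_apply (measurableSet_basis (mem_insert_of_mem _ hU)), inter_comm]
        exact h U (mem_insert_of_mem _ hU))
    refine ⟨{p}, by rw [hp]; simp [countPts], by simp, ?_⟩
    simp only [Finset.mem_singleton, forall_eq]
    by_contra hpc
    have h2 : μ.restrict (cell hT K k j) (cell hT K k j) = 1 := by rw [Measure.restrict_apply_self, h1]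
    rw [hp, Measure.dirac_apply' _ hm, indicator_of_notMem hpc] at h2
    exact zero_ne_one h2

/-- Below every level, a good measure is the counting measure of finitely many points with distinct
positive times. -/
theorem Good.exists_countPts {T : ℝ} {hT : 0 < T} {lam : ℝ} {μ : Measure (MarkTime T)}
    (h : Good hT lam μ) (K : ℕ) : ∃ F : Finset (MarkTime T),
      μ.restrict (below T K) = countPts F ∧ InjOn Prod.snd (F : Set (MarkTime T)) ∧
      ∀ p ∈ F, 0 < (p.2 : ℝ) := by
  classical
  obtain ⟨k, hk⟩ := h.cells K
  have hex : ∀ j, ∃ F : Finset (MarkTime T), j < 2 ^ k → μ.restrict (cell hT K k j) = countPts F ∧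
      (∀ p ∈ F, ∀ p' ∈ F, p = p') ∧ ∀ p ∈ F, p ∈ cell hT K k j := by
    intro j
    by_cases hj : j < 2 ^ k
    · obtain ⟨F, hF⟩ := Good.exists_countPts_cell (hk j hj)
      exact ⟨F, fun _ => hF⟩
    · exact ⟨∅, fun h => absurd h hj⟩
  choose Fj hFj using hex
  have hidx : ∀ j < 2 ^ k, ∀ p ∈ Fj j, gridIndex T k p.2 = j + 1 := fun j hj p hp =>
    (mem_block_iff hT hj p.2).1 ((hFj j hj).2.2 p hp).2
  have hsame : ∀ i < 2 ^ k, ∀ j < 2 ^ k, ∀ p ∈ Fj i, ∀ p' ∈ Fj j, p.2 = p'.2 → p = p' := by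
    intro i hi j hj p hp p' hp' he
    have h1 := hidx i hi p hp
    have h2 := hidx j hj p' hp'
    rw [he, h2] at h1
    have : j = i := by omega
    subst this
    exact (hFj j hj).2.1 p hp p' hp'
  refine ⟨(Finset.range (2 ^ k)).biUnion Fj, ?_, ?_, ?_⟩
  · have hdisj : Set.PairwiseDisjoint (Finset.range (2 ^ k) : Set ℕ) Fj := by
      intro i hi j hj hij
      rw [Finset.coe_range, mem_Iio] at hi hj
      rw [Function.onFun, Finset.disjoint_left]
      intro p hp hp'
      have h1 := hidx i hi p hp
      have h2 := hidx j hj p hp'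
      omega
    rw [countPts, Finset.sum_biUnion hdisj]
    ext A hA
    rw [Measure.restrict_apply hA, Measure.coe_finsetSum, Finset.sum_apply]
    have e : ∀ j ∈ Finset.range (2 ^ k), (∑ p ∈ Fj j, Measure.dirac p : Measure (MarkTime T)) A
        = μ (A ∩ cell hT K k j) := by
      intro j hj
      have h1 := (hFj j (Finset.mem_range.1 hj)).1
      rw [countPts] at h1
      rw [← h1, Measure.restrict_apply hA]
    rw [Finset.sum_congr rfl e, ← measure_biUnion_finset]
    -- The blocks are open on the left and miss time `0`, so the decomposition holds only up to the
    -- null set of points at that time.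
    · refine measure_congr ?_
      have hz := measure_eq_zero_iff_ae_notMem.1 h.zero
      filter_upwards [hz] with p hp
      have hpos : 0 < (p.2 : ℝ) := not_le.1 hp
      refine propext ?_
      show p ∈ A ∩ below T K ↔ p ∈ ⋃ b ∈ Finset.range (2 ^ k), A ∩ cell hT K k b
      simp only [mem_iUnion, Finset.mem_range, exists_prop]
      constructor
      · rintro ⟨hpA, hpb⟩
        have h1 := gridIndex_pos hT k hpos
        have h2 := gridIndex_le hT k p.2
        have h3 : gridIndex T k p.2 - 1 < 2 ^ k := by omega
        exact ⟨gridIndex T k p.2 - 1, h3, hpA, hpb, (mem_block_iff hT h3 p.2).2 (by omega)⟩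
      · rintro ⟨j, -, hpA, hpc⟩
        exact ⟨hpA, hpc.1⟩
    · intro i hi j hj hij
      rw [Finset.coe_range, mem_Iio] at hi hj
      rw [Function.onFun, Set.disjoint_left]
      rintro p ⟨-, -, h1⟩ ⟨-, -, h2⟩
      have h1' := (mem_block_iff hT hi p.2).1 h1
      have h2' := (mem_block_iff hT hj p.2).1 h2
      omega
    · exact fun j _ => hA.inter (measurableSet_cell hT K k j)
  · intro p hp p' hp' he
    simp only [Finset.coe_biUnion, mem_iUnion, Finset.mem_coe, Finset.mem_range, exists_prop] at hp hp'
    obtain ⟨i, hi, hp⟩ := hp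
    obtain ⟨j, hj, hp'⟩ := hp'
    exact hsame i hi j hj p hp p' hp' he
  · intro p hp
    rw [Finset.mem_biUnion] at hp
    obtain ⟨j, hj, hp⟩ := hp
    have h1 := hidx j (Finset.mem_range.1 hj) p hp
    by_contra hle
    have : gridIndex T k p.2 = 0 := by
      refine Nat.ceil_eq_zero.2 ?_
      exact div_nonpos_of_nonpos_of_nonneg (not_lt.1 hle) (by positivity)
    omega

/-- Paths driven by a good measure are paths driven by finitely many points. -/
theorem Good.reduction {T : ℝ} {hT : 0 < T} {d : ℕ} {lam : ℝ} {n : ℕ} {q₀ : L2}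
    {μ : Measure (MarkTime T)} (h : Good hT lam μ) (hlam : 0 < lam) (hn : d ≤ n) (hn0 : 0 < n)
    (hq : q₀ ∈ states n) : ∃ (m K : ℕ) (F : Finset (MarkTime T)),
      (2 * m + 2) * max lam 1 ≤ (K : ℝ) ∧ μ.restrict (below T K) = countPts F ∧
      InjOn Prod.snd (F : Set (MarkTime T)) ∧ (∀ p ∈ F, 0 < (p.2 : ℝ)) ∧
      (∀ x, IsPathFor d lam n q₀ (countPts F) x ↔ IsPathFor d lam n q₀ μ x) ∧
      ∀ x, IsPathFor d lam n q₀ μ x → ∀ t, ∀ j, m ≤ j → x t j = 0 := by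
  obtain ⟨m₀, hm₀⟩ := states.exists_zero hn0 hq
  -- An empty strip past the support of `q₀` confines every solution to the first `i + 1`
  -- coordinates; `K` is then chosen above all windows of such states.
  obtain ⟨i, hi, hstrip⟩ := h.strips m₀
  obtain ⟨K, hK⟩ := exists_nat_ge ((2 * ((i + 1 : ℕ) : ℝ) + 2) * max lam 1)
  obtain ⟨F, hF, hinj, hpos⟩ := h.exists_countPts K
  have hz : q₀ (i + 1) = 0 := hm₀ _ (by omega)
  have h1 : ∀ x, IsPathFor d lam n q₀ μ x → ∀ t, ∀ j, i + 1 ≤ j → x t j = 0 :=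
    fun x hx t j hj => hx.eq_zero_of_strip hlam hn hn0 hz hstrip t hj
  have hstrip' : μ.restrict (below T K) (strip T lam i) = 0 :=
    le_antisymm ((Measure.restrict_le_self _).trans hstrip.le) zero_le
  have h2 : ∀ x, IsPathFor d lam n q₀ (μ.restrict (below T K)) x →
      ∀ t, ∀ j, i + 1 ≤ j → x t j = 0 :=
    fun x hx t j hj => hx.eq_zero_of_strip hlam hn hn0 hz hstrip' t hj
  refine ⟨i + 1, K, F, hK, hF, hinj, hpos, fun x => ?_, h1⟩
  rw [← hF]
  constructor
  · intro hx
    exact (isPathFor_restrict_iff hlam hn hn0 hK hx.mem_states (h2 x hx)).1 hx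
  · intro hx
    exact (isPathFor_restrict_iff hlam hn hn0 hK hx.mem_states (h1 x hx)).2 hx

theorem Good.exists_path {T : ℝ} {hT : 0 < T} {d : ℕ} {lam : ℝ} {n : ℕ} {q₀ : L2}
    {μ : Measure (MarkTime T)} (h : Good hT lam μ) (hlam : 0 < lam) (hn : d ≤ n) (hn0 : 0 < n)
    (hq : q₀ ∈ states n) : ∃ x, IsPathFor d lam n q₀ μ x := by
  obtain ⟨m, K, F, -, -, hinj, hpos, hiff, -⟩ := h.reduction hlam hn hn0 hq
  obtain ⟨x, hx⟩ := exists_isPathFor_countPts hlam hn hn0 hq F hinj hpos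
  exact ⟨x, (hiff x).1 hx⟩

theorem Good.isStepPath {T : ℝ} {hT : 0 < T} {d : ℕ} {lam : ℝ} {n : ℕ} {q₀ : L2}
    {μ : Measure (MarkTime T)} (h : Good hT lam μ) (hlam : 0 < lam) (hn : d ≤ n) (hn0 : 0 < n)
    (hq : q₀ ∈ states n) {x : Cadlag T L2} (hx : IsPathFor d lam n q₀ μ x) : IsStepPath x := by
  obtain ⟨m, K, F, -, -, hinj, hpos, hiff, -⟩ := h.reduction hlam hn hn0 hq
  exact ⟨F, _, q₀, hinj, hpos, (isPathFor_countPts_iff.1 ((hiff x).2 hx)).2⟩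

/-! ### The Euler scheme -/

/-- The increment over a block of time if the state were frozen at `q`. -/
def incr {T : ℝ} (d : ℕ) (lam : ℝ) (n : ℕ) (q : L2) (I : Set (Icc (0 : ℝ) T))
    (μ : Measure (MarkTime T)) : ℕ → ℝ
  | 0 => 0
  | i + 1 => (n : ℝ)⁻¹ *
    ((μ ((Subtype.val ⁻¹' arrWin lam (arrivalRate d n q) i) ×ˢ I)).toReal
      - (μ ((Subtype.val ⁻¹' depWin lam q i) ×ˢ I)).toReal)

theorem toReal_countPts_prod {T : ℝ} (F : Finset (MarkTime T)) {A : Set ℝ} {I : Set (Icc (0 : ℝ) T)}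
    [DecidablePred (· ∈ I)] (hA : MeasurableSet A) (hI : MeasurableSet I) :
    (countPts F ((Subtype.val ⁻¹' A) ×ˢ I)).toReal
      = ∑ p ∈ F, if p.2 ∈ I then A.indicator (1 : ℝ → ℝ) (p.1 : ℝ) else 0 := by
  rw [countPts_apply _ ((measurable_subtype_coe hA).prod hI), ENNReal.toReal_sum]
  · refine Finset.sum_congr rfl fun p _ => ?_
    by_cases h1 : (p.1 : ℝ) ∈ A
    · by_cases h2 : p.2 ∈ I
      · rw [indicator_of_mem (show p ∈ (Subtype.val ⁻¹' A) ×ˢ I from ⟨h1, h2⟩), if_pos h2,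
          indicator_of_mem h1]; rfl
      · rw [indicator_of_notMem (fun h : p ∈ (Subtype.val ⁻¹' A) ×ˢ I => h2 h.2), if_neg h2]; rfl
    · rw [indicator_of_notMem (fun h : p ∈ (Subtype.val ⁻¹' A) ×ˢ I => h1 h.1),
        indicator_of_notMem h1]
      simp
  · intro p _
    by_cases h : p ∈ (Subtype.val ⁻¹' A) ×ˢ I
    · rw [indicator_of_mem h]; exact ENNReal.one_ne_top
    · rw [indicator_of_notMem h]; exact ENNReal.zero_ne_top

/-- Once the mesh is smaller than the gaps between the relevant times, a block contains at most one
relevant point. The left limit there is the value at the left end of the block, so freezing the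
state over the block makes no error. -/
theorem Good.euler_identity {T : ℝ} {hT : 0 < T} {d : ℕ} {lam : ℝ} {n : ℕ} {q₀ : L2}
    {μ : Measure (MarkTime T)} (h : Good hT lam μ) (hlam : 0 < lam) (hn : d ≤ n) (hn0 : 0 < n)
    (hq : q₀ ∈ states n) {x : Cadlag T L2} (hx : IsPathFor d lam n q₀ μ x) :
    ∃ k₀, ∀ k, k₀ ≤ k → x (grid hT k 0) = q₀ ∧ ∀ j < 2 ^ k, ∀ i,
      x (grid hT k (j + 1)) i
        = x (grid hT k j) i + incr d lam n (x (grid hT k j)) (block hT k j) μ i := by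
  classical
  obtain ⟨m, K, F, hK, hF, hinj, hpos, hiff, hm⟩ := h.reduction hlam hn hn0 hq
  have hstep := (isPathFor_countPts_iff.1 ((hiff x).2 hx)).2
  set g : MarkTime T → L2 := fun p => (n : ℝ)⁻¹ • Gn d lam n (Function.leftLim x p.2) p.1 with hg
  have hxval : ∀ t, x t = q₀ + ∑ p ∈ F, if p.2 ≤ t then g p else 0 := fun t => by
    conv_lhs => rw [hstep]
    rfl
  have hxll : ∀ p ∈ F, Function.leftLim x p.2 = q₀ + ∑ p' ∈ F, if p'.2 < p.2 then g p' else 0 := by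
    intro p hp
    conv_lhs => rw [hstep]
    exact leftLim_stepPath _ _ _ _ (hpos p hp)
  obtain ⟨w, hw0, hw⟩ := exists_common_gap F Prod.snd hinj hpos
  obtain ⟨k₀, hk₀⟩ := eventually_atTop.1 ((tendsto_div_two_pow T).eventually (gt_mem_nhds hw0))
  refine ⟨k₀, fun k hk => ⟨?_, fun j hj i => ?_⟩⟩
  · rw [hxval, Finset.sum_eq_zero, add_zero]
    intro p hp
    rw [if_neg]
    rw [← Subtype.coe_le_coe, grid_zero]
    exact not_le.2 (hpos p hp)
  set a := grid hT k j with ha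
  set b := grid hT k (j + 1) with hb
  have hab : a ≤ b := grid_mono hT k (Nat.le_succ j)
  have hgap : (b : ℝ) - a < w := by rw [ha, hb, grid_succ_sub hT hj]; exact hk₀ k hk
  have hleft : ∀ p ∈ F, p.2 ∈ block hT k j → Function.leftLim x p.2 = x a := by
    intro p hp hpb
    rw [hxll p hp, hxval a]
    congr 1
    refine Finset.sum_congr rfl fun p' hp' => ?_
    have : p'.2 < p.2 ↔ p'.2 ≤ a := by
      constructor
      · intro hlt
        by_contra hna
        have h1 : (a : ℝ) < p'.2 := not_le.1 hna
        have h2 : (p.2 : ℝ) ≤ b := hpb.2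
        have h3 : (p'.2 : ℝ) < p.2 := hlt
        have h4 := (hw p hp).2.2 p' hp' (fun e => by rw [e] at hlt; exact lt_irrefl _ hlt)
        rw [abs_sub_comm, abs_of_pos (by linarith)] at h4
        linarith
      · exact fun hle => lt_of_le_of_lt hle hpb.1
    simp only [this]
  have hdiff : x b = x a + ∑ p ∈ F, if p.2 ∈ block hT k j
      then (n : ℝ)⁻¹ • Gn d lam n (x a) p.1 else 0 := by
    have e : ∀ p ∈ F, (if p.2 ∈ block hT k j then (n : ℝ)⁻¹ • Gn d lam n (x a) p.1 else 0)
        = if p.2 ∈ block hT k j then g p else 0 := by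
      intro p hp
      split_ifs with hmem
      · rw [hg, ← hleft p hp hmem]
      · rfl
    rw [Finset.sum_congr rfl e, hxval b, hxval a, add_assoc, ← Finset.sum_add_distrib]
    congr 1
    refine Finset.sum_congr rfl fun p hp => ?_
    by_cases h1 : p.2 ≤ a
    · rw [if_pos (h1.trans hab), if_pos h1, if_neg (fun h : p.2 ∈ block hT k j => absurd h.1 h1.not_gt),
        add_zero]
    · by_cases h2 : p.2 ≤ b
      · have hmem : p.2 ∈ block hT k j := ⟨not_le.1 h1, h2⟩
        rw [if_pos h2, if_neg h1, if_pos hmem, zero_add]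
      · rw [if_neg h2, if_neg h1, if_neg (fun h : p.2 ∈ block hT k j => h2 h.2), add_zero]
  rw [hdiff, lp.coeFn_add, Pi.add_apply]
  congr 1
  rw [← coordCLM_apply, map_sum]
  -- All windows of the states visited lie below `K`, where `μ` is the counting measure of `F`.
  have hμ : ∀ A : Set ℝ, MeasurableSet A → (∀ y ∈ A, y < K) →
      (μ ((Subtype.val ⁻¹' A) ×ˢ block hT k j)).toReal
        = ∑ p ∈ F, if p.2 ∈ block hT k j then A.indicator (1 : ℝ → ℝ) (p.1 : ℝ) else 0 := by
    intro A hA hAK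
    rw [← toReal_countPts_prod F hA (measurableSet_block hT k j), ← hF,
      Measure.restrict_apply ((measurable_subtype_coe hA).prod (measurableSet_block hT k j)),
      inter_eq_self_of_subset_left]
    exact fun p hp => hAK _ hp.1
  rcases i with _ | i
  · refine Finset.sum_eq_zero fun p _ => ?_
    rw [coordCLM_apply]
    split_ifs
    · rw [lp.coeFn_smul, Pi.smul_apply, Gn, jump_zero, smul_zero]
    · rfl
  · rw [incr, hμ _ (measurableSet_arrWin _ _ _), hμ _ (measurableSet_depWin _ _ _),
      ← Finset.sum_sub_distrib, Finset.mul_sum]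
    · refine Finset.sum_congr rfl fun p _ => ?_
      rw [coordCLM_apply]
      split_ifs
      · rw [lp.coeFn_smul, Pi.smul_apply, Gn, jump_succ, smul_eq_mul]
      · rw [sub_self, mul_zero]; rfl
    · exact fun y hy => lt_of_lt_of_le
        (lt_of_mem_window hlam hn hn0 (hx.mem_states a) (hm x hx a) (Or.inr hy)) hK
    · exact fun y hy => lt_of_lt_of_le
        (lt_of_mem_window hlam hn hn0 (hx.mem_states a) (hm x hx a) (Or.inl hy)) hK

instance (n : ℕ) : MeasurableSpace (states n) := ⊤

instance (n : ℕ) : DiscreteMeasurableSpace (states n) := ⟨fun _ => trivial⟩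

open Classical in
/-- The step of the Euler scheme, which stays put if it would leave the states. -/
def eulerStep {T : ℝ} (d : ℕ) (lam : ℝ) (n : ℕ) (I : Set (Icc (0 : ℝ) T))
    (μ : Measure (MarkTime T)) (q : states n) : states n :=
  if h : ∃ q' : states n, ∀ i, (q' : L2) i = (q : L2) i + incr d lam n q I μ i then h.choose else q

theorem eulerStep_eq {T : ℝ} {d : ℕ} {lam : ℝ} {n : ℕ} {I : Set (Icc (0 : ℝ) T)}
    {μ : Measure (MarkTime T)} {q q' : states n}
    (h : ∀ i, (q' : L2) i = (q : L2) i + incr d lam n q I μ i) : eulerStep d lam n I μ q = q' := by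
  have hex : ∃ q' : states n, ∀ i, (q' : L2) i = (q : L2) i + incr d lam n q I μ i := ⟨q', h⟩
  rw [eulerStep, dif_pos hex]
  refine Subtype.ext (lp.ext (funext fun i => ?_))
  rw [hex.choose_spec i, h i]

theorem measurable_incr {T : ℝ} (d : ℕ) (lam : ℝ) (n : ℕ) (q : L2) {I : Set (Icc (0 : ℝ) T)}
    (hI : MeasurableSet I) (i : ℕ) :
    Measurable fun μ : Measure (MarkTime T) => incr d lam n q I μ i := by
  rcases i with _ | i
  · exact measurable_const
  · have hA := (measurable_subtype_coe (p := (· ∈ Ici (0 : ℝ)))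
      (measurableSet_arrWin lam (arrivalRate d n q) i)).prod hI
    have hB := (measurable_subtype_coe (p := (· ∈ Ici (0 : ℝ)))
      (measurableSet_depWin lam q i)).prod hI
    exact (((Measure.measurable_coe hA).ennreal_toReal).sub
      ((Measure.measurable_coe hB).ennreal_toReal)).const_mul _

/-- By countability of the states it suffices to look at fibres. The fibre over `q'` consists of the
measures whose increment leads to `q'`, together with those leading to no state if `q' = q`. -/
theorem measurable_eulerStep {T : ℝ} (d : ℕ) (lam : ℝ) {n : ℕ} (hn0 : 0 < n)
    {I : Set (Icc (0 : ℝ) T)} (hI : MeasurableSet I) (q : states n) :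
    Measurable fun μ : Measure (MarkTime T) => eulerStep d lam n I μ q := by
  have : Countable (states n) := (countable_states hn0).to_subtype
  let E : states n → Set (Measure (MarkTime T)) := fun q' =>
    {μ | ∀ i, (q' : L2) i = (q : L2) i + incr d lam n q I μ i}
  have hE : ∀ q', MeasurableSet (E q') := by
    intro q'
    have : E q' = ⋂ i, {μ | (q' : L2) i = (q : L2) i + incr d lam n q I μ i} := by
      ext μ; simp [E]
    rw [this]
    exact MeasurableSet.iInter fun i => measurableSet_eq_fun measurable_const
      ((measurable_incr d lam n q hI i).const_add _)
  refine measurable_to_countable' fun q' => ?_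
  have e : (fun μ : Measure (MarkTime T) => eulerStep d lam n I μ q) ⁻¹' {q'}
      = E q' ∪ ((⋃ z, E z)ᶜ ∩ {_μ | q = q'}) := by
    ext μ
    simp only [mem_preimage, mem_singleton_iff, mem_union, mem_inter_iff, mem_compl_iff, mem_iUnion]
    by_cases hex : ∃ z, μ ∈ E z
    · obtain ⟨z, hz⟩ := hex
      rw [eulerStep_eq hz]
      constructor
      · rintro rfl; exact Or.inl hz
      · rintro (h | h)
        · rw [← eulerStep_eq hz, ← eulerStep_eq h]
        · exact absurd ⟨z, hz⟩ h.1
    · have : eulerStep d lam n I μ q = q := dif_neg hex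
      rw [this]
      constructor
      · intro h; exact Or.inr ⟨hex, h⟩
      · rintro (h | h)
        · exact absurd ⟨q', h⟩ hex
        · exact h.2
  rw [e]
  exact (hE q').union ((MeasurableSet.iUnion hE).compl.inter (MeasurableSet.const _))

/-- The Euler scheme on the dyadic grid. -/
def euler {T : ℝ} (hT : 0 < T) (d : ℕ) (lam : ℝ) (n : ℕ) (q₀ : states n) (k : ℕ) :
    ℕ → Measure (MarkTime T) → states n
  | 0, _ => q₀
  | j + 1, μ => eulerStep d lam n (block hT k j) μ (euler hT d lam n q₀ k j μ)

theorem measurable_euler {T : ℝ} (hT : 0 < T) (d : ℕ) (lam : ℝ) {n : ℕ} (hn0 : 0 < n)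
    (q₀ : states n) (k j : ℕ) : Measurable (euler hT d lam n q₀ k j) := by
  have : Countable (states n) := (countable_states hn0).to_subtype
  induction j with
  | zero => exact measurable_const
  | succ j ih =>
    have h : Measurable fun z : Measure (MarkTime T) × states n =>
        eulerStep d lam n (block hT k j) z.1 z.2 :=
      measurable_from_prod_countable_left fun q =>
        measurable_eulerStep d lam hn0 (measurableSet_block hT k j) q
    exact h.comp (measurable_id.prodMk ih)

theorem Good.eventually_euler {T : ℝ} {hT : 0 < T} {d : ℕ} {lam : ℝ} {n : ℕ} {q₀ : L2}
    {μ : Measure (MarkTime T)} (h : Good hT lam μ) (hlam : 0 < lam) (hn : d ≤ n) (hn0 : 0 < n)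
    (hq : q₀ ∈ states n) {x : Cadlag T L2} (hx : IsPathFor d lam n q₀ μ x) :
    ∃ k₀, ∀ k, k₀ ≤ k → (∀ j ≤ 2 ^ k, x (grid hT k j) = euler hT d lam n ⟨q₀, hq⟩ k j μ) ∧
      ∀ j < 2 ^ k, ∀ i, x (grid hT k (j + 1)) i
        = x (grid hT k j) i + incr d lam n (x (grid hT k j)) (block hT k j) μ i := by
  obtain ⟨k₀, hk₀⟩ := h.euler_identity hlam hn hn0 hq hx
  refine ⟨k₀, fun k hk => ⟨fun j hj => ?_, (hk₀ k hk).2⟩⟩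
  induction j with
  | zero => exact (hk₀ k hk).1
  | succ j ih =>
    have h1 := ih (by omega)
    have h2 : eulerStep d lam n (block hT k j) μ (euler hT d lam n ⟨q₀, hq⟩ k j μ)
        = ⟨x (grid hT k (j + 1)), hx.mem_states _⟩ := by
      refine eulerStep_eq fun i => ?_
      rw [← h1]
      exact (hk₀ k hk).2 j hj i
    rw [euler, h2]

/-- At the points of fine grids both paths equal the same Euler scheme. The first grid points after
`t` converge to `t` from the right, and right continuity concludes. -/
theorem Good.unique {T : ℝ} {hT : 0 < T} {d : ℕ} {lam : ℝ} {n : ℕ} {q₀ : L2}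
    {μ : Measure (MarkTime T)} (h : Good hT lam μ) (hlam : 0 < lam) (hn : d ≤ n) (hn0 : 0 < n)
    (hq : q₀ ∈ states n) {x x' : Cadlag T L2} (hx : IsPathFor d lam n q₀ μ x)
    (hx' : IsPathFor d lam n q₀ μ x') : x = x' := by
  obtain ⟨k₀, hk₀⟩ := h.eventually_euler hlam hn hn0 hq hx
  obtain ⟨k₁, hk₁⟩ := h.eventually_euler hlam hn hn0 hq hx'
  refine Cadlag.ext' fun t => ?_
  have h1 := (x.right_cont t).tendsto.comp (tendsto_grid_gridIndex hT t)
  have h2 := (x'.right_cont t).tendsto.comp (tendsto_grid_gridIndex hT t)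
  refine tendsto_nhds_unique (h1.congr' ?_) h2
  filter_upwards [eventually_ge_atTop k₀, eventually_ge_atTop k₁] with k hk hk'
  simp only [Function.comp_apply]
  rw [(hk₀ k hk).1 _ (gridIndex_le hT k t), (hk₁ k hk').1 _ (gridIndex_le hT k t)]

/-! ### The solution map -/

open Classical in
/-- The path driven by a good measure, and a constant path otherwise. -/
def solMap {T : ℝ} (hT : 0 < T) (d : ℕ) (lam : ℝ) (n : ℕ) (q₀ : L2) (μ : Measure (MarkTime T)) :
    Cadlag T L2 :=
  if h : Good hT lam μ ∧ ∃ x, IsPathFor d lam n q₀ μ x then h.2.choose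
  else stepPath (∅ : Finset (MarkTime T)) Prod.snd 0 q₀

theorem Good.solMap {T : ℝ} {hT : 0 < T} {d : ℕ} {lam : ℝ} {n : ℕ} {q₀ : L2}
    {μ : Measure (MarkTime T)} (h : Good hT lam μ) (hlam : 0 < lam) (hn : d ≤ n) (hn0 : 0 < n)
    (hq : q₀ ∈ states n) : IsPathFor d lam n q₀ μ (solMap hT d lam n q₀ μ) := by
  have hex := h.exists_path hlam hn hn0 hq
  rw [JSQ.solMap, dif_pos ⟨h, hex⟩]
  exact hex.choose_spec

theorem solMap_of_not_good {T : ℝ} {hT : 0 < T} {d : ℕ} {lam : ℝ} {n : ℕ} {q₀ : L2}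
    {μ : Measure (MarkTime T)} (h : ¬ Good hT lam μ) :
    solMap hT d lam n q₀ μ = stepPath (∅ : Finset (MarkTime T)) Prod.snd 0 q₀ :=
  dif_neg fun h' => h h'.1

/-- On good measures the value at a grid point is the eventual value, along finer and finer grids,
of the Euler scheme at the same time. Its fibres are therefore countable unions of countable
intersections of measurable sets. -/
theorem measurable_solMap {T : ℝ} (hT : 0 < T) {d : ℕ} {lam : ℝ} {n : ℕ} {q₀ : L2}
    (hlam : 0 < lam) (hn : d ≤ n) (hn0 : 0 < n) (hq : q₀ ∈ states n) :
    Measurable (solMap hT d lam n q₀) := by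
  have : Countable (states n) := (countable_states hn0).to_subtype
  have hmem : ∀ μ t, solMap hT d lam n q₀ μ t ∈ states n := by
    intro μ t
    by_cases h : Good hT lam μ
    · exact (h.solMap hlam hn hn0 hq).mem_states t
    · rw [solMap_of_not_good h, stepPath_apply]
      simpa using hq
  -- The truncation `min j (2 ^ k)` keeps the refined index `min j (2 ^ k) * 2 ^ (k' - k)` in the
  -- range `≤ 2 ^ k'` in which the Euler scheme is known to follow the path.
  let X : ℕ → ℕ → Measure (MarkTime T) → states n := fun k j μ =>
    ⟨solMap hT d lam n q₀ μ (grid hT k (min j (2 ^ k))), hmem μ _⟩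
  refine measurable_of_grid hT (S := states n) (fun μ => ?_) Subtype.val X (fun k j => ?_)
    (fun k j hj μ => ?_)
  · by_cases h : Good hT lam μ
    · exact h.isStepPath hlam hn hn0 hq (h.solMap hlam hn hn0 hq)
    · exact ⟨∅, 0, q₀, by simp, by simp, solMap_of_not_good h⟩
  · refine measurable_to_countable' fun y => ?_
    have e : X k j ⁻¹' {y} = ({μ | Good hT lam μ} ∩ ⋃ k₀ : ℕ, ⋂ k' : ℕ, ⋂ _ : k₀ ≤ k',
          euler hT d lam n ⟨q₀, hq⟩ k' (min j (2 ^ k) * 2 ^ (k' - k)) ⁻¹' {y})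
        ∪ ({μ | Good hT lam μ}ᶜ ∩ {_μ | q₀ = y}) := by
      ext μ
      simp only [mem_preimage, mem_singleton_iff, mem_union, mem_inter_iff, mem_ofPred_eq,
        mem_iUnion, mem_iInter, mem_compl_iff]
      by_cases h : Good hT lam μ
      · obtain ⟨k₀, hk₀⟩ := h.eventually_euler hlam hn hn0 hq (h.solMap hlam hn hn0 hq)
        have hval : ∀ k', k₀ ≤ k' → k ≤ k' →
            euler hT d lam n ⟨q₀, hq⟩ k' (min j (2 ^ k) * 2 ^ (k' - k)) μ = X k j μ := by
          intro k' h1 h2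
          have hle : min j (2 ^ k) * 2 ^ (k' - k) ≤ 2 ^ k' := by
            calc min j (2 ^ k) * 2 ^ (k' - k) ≤ 2 ^ k * 2 ^ (k' - k) :=
                  Nat.mul_le_mul_right _ (min_le_right _ _)
              _ = 2 ^ k' := by rw [← pow_add, Nat.add_sub_cancel' h2]
          refine Subtype.ext ?_
          rw [← (hk₀ k' h1).1 _ hle, grid_refine hT h2]
        constructor
        · intro hy
          refine Or.inl ⟨h, max k₀ k, fun k' hk' => ?_⟩
          rw [hval k' ((le_max_left _ _).trans hk') ((le_max_right _ _).trans hk'), hy]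
        · rintro (⟨-, k₁, hk₁⟩ | ⟨h', -⟩)
          · rw [← hval (max k₁ (max k₀ k)) ((le_max_left _ _).trans (le_max_right _ _))
              ((le_max_right _ _).trans (le_max_right _ _))]
            exact hk₁ _ (le_max_left _ _)
          · exact absurd h h'
      · have hX : (X k j μ : L2) = q₀ := by
          show solMap hT d lam n q₀ μ _ = q₀
          rw [solMap_of_not_good h, stepPath_apply]
          simp
        constructor
        · rintro rfl; exact Or.inr ⟨h, hX.symm⟩
        · rintro (⟨h', -⟩ | ⟨-, hy⟩)
          · exact absurd h' h
          · exact Subtype.ext (hX.trans hy)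
    rw [e]
    refine ((measurableSet_good hT lam).inter (MeasurableSet.iUnion fun k₀ => MeasurableSet.iInter
      fun k' => MeasurableSet.iInter fun _ => ?_)).union
      ((measurableSet_good hT lam).compl.inter (MeasurableSet.const _))
    exact measurable_euler hT d lam hn0 _ _ _ (measurableSet_singleton y)
  · show _ = solMap hT d lam n q₀ μ (grid hT k (min j (2 ^ k)))
    rw [min_eq_left hj]

/-! ### Poisson random measures: moments, independence, thinning, and almost sure goodness. -/

/-! ### Moments of the Poisson distribution -/

theorem hasSum_poisson_mean (r : ℝ≥0) :
    HasSum (fun k : ℕ => Real.exp (-r) * r ^ k / (k.factorial : ℝ) * k) r := by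
  rw [← hasSum_nat_add_iff' 1]
  simp only [Finset.range_one, Finset.sum_singleton, CharP.cast_eq_zero, mul_zero, sub_zero]
  have h := (hasSum_one_poissonMeasure r).mul_left (r : ℝ)
  rw [mul_one] at h
  refine h.congr_fun ?_
  intro k
  have hk : ((k + 1 : ℕ) : ℝ) ≠ 0 := by positivity
  rw [Nat.factorial_succ, Nat.cast_mul, pow_succ]
  field_simp

theorem hasSum_poisson_sq (r : ℝ≥0) :
    HasSum (fun k : ℕ => Real.exp (-r) * r ^ k / (k.factorial : ℝ) * (k : ℝ) ^ 2)
      (r * (r + 1)) := by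
  rw [← hasSum_nat_add_iff' 1]
  simp only [Finset.range_one, Finset.sum_singleton, CharP.cast_eq_zero, ne_eq, OfNat.ofNat_ne_zero,
    not_false_eq_true, zero_pow, mul_zero, sub_zero]
  have h := ((hasSum_poisson_mean r).add (hasSum_one_poissonMeasure r)).mul_left (r : ℝ)
  refine h.congr_fun ?_
  intro k
  have hk : ((k + 1 : ℕ) : ℝ) ≠ 0 := by positivity
  rw [Nat.factorial_succ, Nat.cast_mul, pow_succ]
  field_simp
  push_cast
  ring

theorem integrable_poisson_id (r : ℝ≥0) : Integrable (fun k : ℕ => (k : ℝ)) (poissonMeasure r) := by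
  rw [integrable_poissonMeasure_iff]
  simpa using (hasSum_poisson_mean r).summable

theorem integrable_poisson_sq (r : ℝ≥0) :
    Integrable (fun k : ℕ => (k : ℝ) ^ 2) (poissonMeasure r) := by
  rw [integrable_poissonMeasure_iff]
  simpa using (hasSum_poisson_sq r).summable

theorem integral_poisson_id (r : ℝ≥0) : ∫ k : ℕ, (k : ℝ) ∂poissonMeasure r = r := by
  rw [integral_poissonMeasure]
  simpa using (hasSum_poisson_mean r).tsum_eq

theorem integral_poisson_sq (r : ℝ≥0) : ∫ k : ℕ, (k : ℝ) ^ 2 ∂poissonMeasure r = r * (r + 1) := by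
  rw [integral_poissonMeasure]
  simpa using (hasSum_poisson_sq r).tsum_eq

theorem integral_poisson_centered_sq (r : ℝ≥0) :
    ∫ k : ℕ, ((k : ℝ) - r) ^ 2 ∂poissonMeasure r = r := by
  have e : (fun k : ℕ => ((k : ℝ) - r) ^ 2)
      = fun k : ℕ => ((k : ℝ) ^ 2 - 2 * r * k) + (r : ℝ) ^ 2 := by
    ext k; ring
  have h1 := (integrable_poisson_id r).const_mul (2 * (r : ℝ))
  have h2 : Integrable (fun k : ℕ => (k : ℝ) ^ 2 - 2 * r * k) (poissonMeasure r) :=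
    (integrable_poisson_sq r).sub h1
  rw [e, integral_add h2 (integrable_const _), integral_sub (integrable_poisson_sq r) h1,
    integral_const_mul, integral_poisson_id, integral_poisson_sq, integral_const]
  simp
  ring

/-- The probability is `1 - exp (-r) (1 + r)`, and `exp (-r) ≥ 1 - r` leaves at most `1 - (1 - r) (1
+ r) = r ^ 2`. -/
theorem poissonMeasure_ge_two_le (r : ℝ≥0) :
    poissonMeasure r {k | ¬ (k = 0 ∨ k = 1)} ≤ ENNReal.ofReal ((r : ℝ) ^ 2) := by
  have e : {k : ℕ | ¬ (k = 0 ∨ k = 1)} = ({0} ∪ {1})ᶜ := by ext; simp [and_comm]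
  rw [e, prob_compl_eq_one_sub MeasurableSet.of_discrete, measure_union (by simp)
    MeasurableSet.of_discrete, poissonMeasure_singleton, poissonMeasure_singleton,
    ← ENNReal.ofReal_add (by positivity) (by positivity), ← ENNReal.ofReal_one,
    ← ENNReal.ofReal_sub _ (by positivity)]
  refine ENNReal.ofReal_le_ofReal ?_
  have h := Real.add_one_le_exp (-(r : ℝ))
  have hr := r.2
  simp only [pow_zero, Nat.factorial_zero, Nat.cast_one, mul_one, div_one, pow_one,
    Nat.factorial_one]
  have h2 : (1 - (r : ℝ)) * (1 + r) ≤ Real.exp (-r) * (1 + r) := by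
    refine mul_le_mul_of_nonneg_right (by linarith) ?_
    have : (0 : ℝ) ≤ r := hr
    linarith
  nlinarith

/-! ### Poisson random measures -/

/-- A Poisson random measure on a measurable space, without reference to a topology. -/
structure IsPoissonField {Ω S : Type*} [MeasurableSpace Ω] [MeasurableSpace S] (ν : Measure S)
    (M : Ω → Measure S) (P : Measure Ω) : Prop where
  measurable : Measurable M
  law : ∀ H, MeasurableSet H → ν H < ∞ →
    P.map (fun ω => M ω H) = (poissonMeasure (ν H).toNNReal).map (Nat.cast : ℕ → ℝ≥0∞)
  indep : ∀ (k : ℕ) (H : Fin k → Set S), (∀ i, MeasurableSet (H i)) →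
    Pairwise (fun i j => Disjoint (H i) (H j)) → iIndepFun (fun i ω => M ω (H i)) P

/-- The σ-algebra on measures is generated by evaluations, so independence of restricted random
measures reduces to that of the families of masses `M ω (A ∩ H)`. -/
theorem comap_restrict_le {Ω S : Type*} [MeasurableSpace S] (M : Ω → Measure S) (H : Set S) :
    MeasurableSpace.comap (fun ω => (M ω).restrict H) inferInstance
      ≤ MeasurableSpace.comap (fun ω (A : {A : Set S // MeasurableSet A}) => M ω (A.1 ∩ H))
        inferInstance := by
  rw [MeasurableSpace.comap_le_iff_le_map]
  refine iSup₂_le fun A hA => ?_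
  rw [MeasurableSpace.comap_le_iff_le_map]
  intro B hB
  refine ⟨(fun v => v ⟨A, hA⟩) ⁻¹' B, measurable_pi_apply _ hB, ?_⟩
  ext ω
  simp [Measure.restrict_apply hA]

namespace IsPoissonField

variable {Ω S : Type*} [MeasurableSpace Ω] [MeasurableSpace S] {ν : Measure S}
  {M : Ω → Measure S} {P : Measure Ω}

theorem measurable_apply (h : IsPoissonField ν M P) {A : Set S} (hA : MeasurableSet A) :
    Measurable fun ω => M ω A :=
  (Measure.measurable_coe hA).comp h.measurable

theorem measure_mem (h : IsPoissonField ν M P) {A : Set S} (hA : MeasurableSet A) (hν : ν A < ∞)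
    {B : Set ℝ≥0∞} (hB : MeasurableSet B) :
    P {ω | M ω A ∈ B} = poissonMeasure (ν A).toNNReal {k : ℕ | (k : ℝ≥0∞) ∈ B} := by
  have h1 := congrArg (fun m => m B) (h.law A hA hν)
  rw [Measure.map_apply (h.measurable_apply hA) hB, Measure.map_apply .of_discrete hB] at h1
  exact h1

theorem ae_nat (h : IsPoissonField ν M P) {A : Set S} (hA : MeasurableSet A) (hν : ν A < ∞) :
    ∀ᵐ ω ∂P, ∃ k : ℕ, M ω A = k := by
  have hB : MeasurableSet (range (Nat.cast : ℕ → ℝ≥0∞))ᶜ := (countable_range _).measurableSet.compl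
  have h1 := h.measure_mem hA hν hB
  have e : {k : ℕ | (k : ℝ≥0∞) ∈ (range (Nat.cast : ℕ → ℝ≥0∞))ᶜ} = ∅ := by
    ext k; simp
  rw [e, measure_empty] at h1
  rw [ae_iff]
  convert h1 using 2
  ext ω
  simp [eq_comm]

theorem measure_ge_two_le (h : IsPoissonField ν M P) {A : Set S} (hA : MeasurableSet A)
    (hν : ν A < ∞) :
    P {ω | ¬ (M ω A = 0 ∨ M ω A = 1)} ≤ ENNReal.ofReal ((ν A).toReal ^ 2) := by
  have h1 := h.measure_mem hA hν (B := ({0} ∪ {1})ᶜ)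
    ((measurableSet_singleton _).union (measurableSet_singleton _)).compl
  have e : {k : ℕ | (k : ℝ≥0∞) ∈ (({0} ∪ {1} : Set ℝ≥0∞))ᶜ} = {k | ¬ (k = 0 ∨ k = 1)} := by
    ext k; simp [and_comm]
  rw [e] at h1
  exact h1.le.trans (poissonMeasure_ge_two_le _)

theorem measure_eq_zero (h : IsPoissonField ν M P) {A : Set S} (hA : MeasurableSet A)
    (hν : ν A < ∞) : P {ω | M ω A = 0} = ENNReal.ofReal (Real.exp (-(ν A).toReal)) := by
  have h1 := h.measure_mem hA hν (B := {0}) (measurableSet_singleton _)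
  have e : {k : ℕ | (k : ℝ≥0∞) ∈ ({0} : Set ℝ≥0∞)} = {0} := by ext k; simp
  rw [e, poissonMeasure_singleton] at h1
  simpa [ENNReal.coe_toNNReal_eq_toReal] using h1

theorem ae_eq_zero [IsProbabilityMeasure P] (h : IsPoissonField ν M P) {A : Set S}
    (hA : MeasurableSet A) (hν : ν A = 0) : ∀ᵐ ω ∂P, M ω A = 0 := by
  have h1 := h.measure_eq_zero hA (by rw [hν]; exact ENNReal.zero_lt_top)
  rw [hν] at h1
  simp only [ENNReal.toReal_zero, neg_zero, Real.exp_zero, ENNReal.ofReal_one] at h1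
  have hm : MeasurableSet {ω | M ω A = 0} := h.measurable_apply hA (measurableSet_singleton 0)
  exact (prob_compl_eq_zero_iff hm).2 h1

theorem integral_comp (h : IsPoissonField ν M P) {A : Set S} (hA : MeasurableSet A)
    (hν : ν A < ∞) {f : ℝ → ℝ} (hf : Measurable f) :
    ∫ ω, f (M ω A).toReal ∂P = ∫ k : ℕ, f k ∂poissonMeasure (ν A).toNNReal := by
  have hg : Measurable fun a : ℝ≥0∞ => f a.toReal := hf.comp ENNReal.measurable_toReal
  rw [← integral_map (φ := fun ω => M ω A) (f := fun a : ℝ≥0∞ => f a.toReal)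
    (h.measurable_apply hA).aemeasurable hg.aestronglyMeasurable, h.law A hA hν,
    integral_map Measurable.of_discrete.aemeasurable hg.aestronglyMeasurable]
  simp

theorem integrable_comp (h : IsPoissonField ν M P) {A : Set S} (hA : MeasurableSet A)
    (hν : ν A < ∞) {f : ℝ → ℝ} (hf : Measurable f)
    (hi : Integrable (fun k : ℕ => f k) (poissonMeasure (ν A).toNNReal)) :
    Integrable (fun ω => f (M ω A).toReal) P := by
  have hg : Measurable fun a : ℝ≥0∞ => f a.toReal := hf.comp ENNReal.measurable_toReal
  have h1 : Integrable (fun a : ℝ≥0∞ => f a.toReal) (P.map fun ω => M ω A) := by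
    rw [h.law A hA hν, integrable_map_measure hg.aestronglyMeasurable
      Measurable.of_discrete.aemeasurable]
    simpa [Function.comp_def] using hi
  exact (integrable_map_measure hg.aestronglyMeasurable (h.measurable_apply hA).aemeasurable).1 h1

theorem integrable_centered (h : IsPoissonField ν M P) {A : Set S} (hA : MeasurableSet A)
    (hν : ν A < ∞) : Integrable (fun ω => (M ω A).toReal - (ν A).toReal) P :=
  h.integrable_comp hA hν (f := fun a => a - (ν A).toReal) (by fun_prop)
    ((integrable_poisson_id _).sub (integrable_const _))

theorem integral_centered (h : IsPoissonField ν M P) {A : Set S} (hA : MeasurableSet A)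
    (hν : ν A < ∞) : ∫ ω, ((M ω A).toReal - (ν A).toReal) ∂P = 0 := by
  rw [h.integral_comp hA hν (f := fun a => a - (ν A).toReal) (by fun_prop),
    integral_sub (integrable_poisson_id _) (integrable_const _), integral_poisson_id]
  simp [ENNReal.toReal]

theorem integrable_centered_sq (h : IsPoissonField ν M P) {A : Set S} (hA : MeasurableSet A)
    (hν : ν A < ∞) : Integrable (fun ω => ((M ω A).toReal - (ν A).toReal) ^ 2) P := by
  refine h.integrable_comp hA hν (f := fun a => (a - (ν A).toReal) ^ 2) (by fun_prop) ?_
  have e : (fun k : ℕ => ((k : ℝ) - (ν A).toReal) ^ 2)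
      = fun k : ℕ => ((k : ℝ) ^ 2 - 2 * (ν A).toReal * k) + (ν A).toReal ^ 2 := by
    ext k; ring
  rw [e]
  exact ((integrable_poisson_sq _).sub ((integrable_poisson_id _).const_mul _)).add
    (integrable_const _)

theorem integral_centered_sq (h : IsPoissonField ν M P) {A : Set S} (hA : MeasurableSet A)
    (hν : ν A < ∞) : ∫ ω, ((M ω A).toReal - (ν A).toReal) ^ 2 ∂P = (ν A).toReal := by
  rw [h.integral_comp hA hν (f := fun a => (a - (ν A).toReal) ^ 2) (by fun_prop)]
  exact integral_poisson_centered_sq _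

/-! ### Independence over disjoint sets -/

theorem iIndepFun_of_disjoint (h : IsPoissonField ν M P) {κ : Type*} [Finite κ] (H : κ → Set S)
    (hm : ∀ i, MeasurableSet (H i)) (hd : Pairwise fun i j => Disjoint (H i) (H j)) :
    iIndepFun (fun i ω => M ω (H i)) P := by
  obtain ⟨k, ⟨e⟩⟩ := Finite.exists_equiv_fin κ
  have h1 := (h.indep k (fun i => H (e.symm i)) (fun i => hm _)
    (fun i j hij => hd (e.symm.injective.ne hij))).precomp e.injective
  simpa [Function.comp_def] using h1

/-- The part of `H` on which exactly the sets in `s` occur. -/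
def atomIn {ι : Type*} (H : Set S) (A : ι → Set S) (s : Set ι) : Set S :=
  {p | p ∈ H ∧ {i | p ∈ A i} = s}

theorem measurableSet_atomIn {ι : Type*} [Finite ι] {H : Set S} (hH : MeasurableSet H)
    {A : ι → Set S} (hA : ∀ i, MeasurableSet (A i)) (s : Set ι) :
    MeasurableSet (atomIn H A s) := by
  have e : atomIn H A s = H ∩ ⋂ i, {p | p ∈ A i ↔ i ∈ s} := by
    ext p
    simp [atomIn, Set.ext_iff]
  rw [e]
  refine hH.inter (MeasurableSet.iInter fun i => ?_)
  by_cases hi : i ∈ s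
  · simpa [hi] using hA i
  · simp only [hi, iff_false]
    exact (hA i).compl

open Classical in
theorem measure_inter_eq_sum_atomIn {ι : Type*} [Finite ι] [Fintype (Set ι)] {H : Set S}
    (hH : MeasurableSet H) {A : ι → Set S} (hA : ∀ i, MeasurableSet (A i)) (μ : Measure S) (i : ι) :
    μ (A i ∩ H) = ∑ s : Set ι, if i ∈ s then μ (atomIn H A s) else 0 := by
  have e : A i ∩ H = ⋃ s ∈ (Finset.univ.filter fun s : Set ι => i ∈ s), atomIn H A s := by
    ext p
    simp only [mem_inter_iff, mem_iUnion, Finset.mem_filter, Finset.mem_univ, true_and,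
      exists_prop, atomIn, mem_ofPred_eq]
    constructor
    · rintro ⟨h1, h2⟩
      exact ⟨{i | p ∈ A i}, h1, h2, rfl⟩
    · rintro ⟨s, h1, h2, rfl⟩
      exact ⟨h1, h2⟩
  rw [e, measure_biUnion_finset _ fun s _ => measurableSet_atomIn hH hA s, Finset.sum_filter]
  intro s _ t _ hst
  rw [Function.onFun, Set.disjoint_left]
  rintro p ⟨-, h1⟩ ⟨-, h2⟩
  exact hst (h1.symm.trans h2)

/-- The given sets may overlap, while the definition only speaks of disjoint ones. The atoms
generated by the `A i` in `H` and by the `B j` in `H'` form one disjoint family, and the masses in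
question are sums over the two groups of atoms. -/
theorem indepFun_finite (h : IsPoissonField ν M P) [IsProbabilityMeasure P] {H H' : Set S}
    (hH : MeasurableSet H) (hH' : MeasurableSet H') (hd : Disjoint H H') {ι κ : Type*} [Finite ι]
    [Finite κ] {A : ι → Set S} {B : κ → Set S} (hA : ∀ i, MeasurableSet (A i))
    (hB : ∀ i, MeasurableSet (B i)) :
    IndepFun (fun ω i => M ω (A i ∩ H)) (fun ω j => M ω (B j ∩ H')) P := by
  classical
  have := Fintype.ofFinite (Set ι)
  have := Fintype.ofFinite (Set κ)
  let E : Set ι ⊕ Set κ → Set S := Sum.elim (atomIn H A) (atomIn H' B)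
  have hE : ∀ z, MeasurableSet (E z) := by
    rintro (s | s)
    · exact measurableSet_atomIn hH hA s
    · exact measurableSet_atomIn hH' hB s
  have hEd : Pairwise fun i j => Disjoint (E i) (E j) := by
    rintro (s | s) (t | t) hst
    · rw [Set.disjoint_left]
      rintro p ⟨-, h1⟩ ⟨-, h2⟩
      exact hst (by rw [← h1, ← h2])
    · exact hd.mono (fun p hp => hp.1) (fun p hp => hp.1)
    · exact hd.symm.mono (fun p hp => hp.1) (fun p hp => hp.1)
    · rw [Set.disjoint_left]
      rintro p ⟨-, h1⟩ ⟨-, h2⟩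
      exact hst (by rw [← h1, ← h2])
  have h1 := (h.iIndepFun_of_disjoint E hE hEd).indepFun_finset
    (Finset.univ.image Sum.inl) (Finset.univ.image Sum.inr)
    (by
      rw [Finset.disjoint_left]
      intro z hz hz'
      simp only [Finset.mem_image, Finset.mem_univ, true_and] at hz hz'
      obtain ⟨s, rfl⟩ := hz
      obtain ⟨t, ht⟩ := hz'
      cases ht)
    (fun z => h.measurable_apply (hE z))
  have hl : ∀ s : Set ι, (Sum.inl s : Set ι ⊕ Set κ) ∈ Finset.univ.image Sum.inl := fun s => by simp
  have hr : ∀ s : Set κ, (Sum.inr s : Set ι ⊕ Set κ) ∈ Finset.univ.image Sum.inr := fun s => by simp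
  have h2 := h1.comp
    (φ := fun v i => ∑ s : Set ι, if i ∈ s then v ⟨Sum.inl s, hl s⟩ else 0)
    (ψ := fun v i => ∑ s : Set κ, if i ∈ s then v ⟨Sum.inr s, hr s⟩ else 0)
    (by
      refine measurable_pi_lambda _ fun i => Finset.measurable_sum _ fun s _ => ?_
      split_ifs
      · exact measurable_pi_apply _
      · exact measurable_const)
    (by
      refine measurable_pi_lambda _ fun i => Finset.measurable_sum _ fun s _ => ?_
      split_ifs
      · exact measurable_pi_apply _
      · exact measurable_const)
  convert h2 using 1
  · ext ω i
    exact measure_inter_eq_sum_atomIn hH hA _ i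
  · ext ω i
    exact measure_inter_eq_sum_atomIn hH' hB _ i

/-- The restrictions of a Poisson random measure to disjoint sets are independent. -/
theorem indepFun_restrict (h : IsPoissonField ν M P) [IsProbabilityMeasure P] {H H' : Set S}
    (hH : MeasurableSet H) (hH' : MeasurableSet H') (hd : Disjoint H H') :
    IndepFun (fun ω => (M ω).restrict H) (fun ω => (M ω).restrict H') P := by
  have h1 : IndepFun (fun ω (A : {A : Set S // MeasurableSet A}) => M ω (A.1 ∩ H))
      (fun ω (A : {A : Set S // MeasurableSet A}) => M ω (A.1 ∩ H')) P := by
    refine IndepFun.process_indepFun_process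
      (X := fun (A : {A : Set S // MeasurableSet A}) ω => M ω (A.1 ∩ H))
      (Y := fun (A : {A : Set S // MeasurableSet A}) ω => M ω (A.1 ∩ H'))
      (fun A => h.measurable_apply (A.2.inter hH)) (fun A => h.measurable_apply (A.2.inter hH'))
      fun I J => ?_
    exact h.indepFun_finite hH hH' hd (fun i : I => i.1.2) (fun j : J => j.1.2)
  rw [IndepFun_iff_Indep] at h1 ⊢
  exact indep_of_indep_of_le_left (indep_of_indep_of_le_right h1 (comap_restrict_le M H'))
    (comap_restrict_le M H)

end IsPoissonField

/-! ### Thinned Poisson random measures -/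

theorem lebHalf_le_natCast (n : ℕ) : lebHalf {r : Half | (r : ℝ) ≤ n} = n := by
  have h : lebHalf (Subtype.val ⁻¹' Iic (n : ℝ)) = ENNReal.ofReal n := by
    rw [← Measure.map_apply measurable_subtype_coe measurableSet_Iic, map_lebHalf,
      Measure.restrict_apply measurableSet_Iic]
    have : Iic (n : ℝ) ∩ Ici 0 = Icc 0 (n : ℝ) := by ext; simp [and_comm]
    rw [this, Real.volume_Icc, sub_zero]
  rw [ENNReal.ofReal_natCast] at h
  exact h

theorem measurableSet_radius_le {T : ℝ} (n : ℕ) :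
    MeasurableSet {p : Half × MarkTime T | (p.1 : ℝ) ≤ n} :=
  measurableSet_le (by fun_prop) measurable_const

theorem thin_apply {T : ℝ} (n : ℕ) (μ : RadonMeasure (Half × MarkTime T)) {A : Set (MarkTime T)}
    (hA : MeasurableSet A) :
    (thin n μ).1 A = μ.1 (Prod.snd ⁻¹' A ∩ {p : Half × MarkTime T | (p.1 : ℝ) ≤ n}) := by
  rw [thin, Measure.map_apply measurable_snd hA, Measure.restrict_apply (measurable_snd hA)]

instance (T : ℝ) : SigmaFinite (lebMarkTime T) :=
  inferInstanceAs (SigmaFinite (lebHalf.prod (lebTime T)))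

theorem intensity_thin {T : ℝ} (n : ℕ) (A : Set (MarkTime T)) :
    intensity T (Prod.snd ⁻¹' A ∩ {p : Half × MarkTime T | (p.1 : ℝ) ≤ n})
      = n * lebMarkTime T A := by
  have e : Prod.snd ⁻¹' A ∩ {p : Half × MarkTime T | (p.1 : ℝ) ≤ n}
      = {r : Half | (r : ℝ) ≤ n} ×ˢ A := by
    ext p; simp [and_comm]
  rw [e, intensity, Measure.prod_prod, lebHalf_le_natCast]

/-- The mass of `A` under the thinned measure is the mass of `[0, n] × A` under the original one,
which multiplies the intensity by `n` and preserves disjointness. -/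
theorem isPoissonField_thin {Ω : Type*} [MeasurableSpace Ω] {P : Measure Ω} {T : ℝ}
    {N : Ω → RadonMeasure (Half × MarkTime T)} (hN : IsPoissonRandomMeasure (intensity T) N P)
    (n : ℕ) : IsPoissonField ((n : ℝ≥0∞) • lebMarkTime T) (fun ω => (thin n (N ω)).1) P := by
  have hB : ∀ {A : Set (MarkTime T)}, MeasurableSet A →
      MeasurableSet (Prod.snd ⁻¹' A ∩ {p : Half × MarkTime T | (p.1 : ℝ) ≤ n}) := fun hA =>
    (measurable_snd hA).inter (measurableSet_radius_le n)
  refine ⟨?_, fun A hA hν => ?_, fun k H hm hd => ?_⟩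
  · refine Measure.measurable_of_measurable_coe _ fun A hA => ?_
    simp only [thin_apply n _ hA]
    exact (Measure.measurable_coe (hB hA)).comp (measurable_subtype_coe.comp hN.measurable)
  · simp only [thin_apply n _ hA]
    rw [Measure.smul_apply, smul_eq_mul] at hν ⊢
    rw [hN.law _ (hB hA) (by rwa [intensity_thin]), intensity_thin]
  · simp only [thin_apply n _ (hm _)]
    exact hN.indep k _ (fun i => hB (hm i)) fun i j hij =>
      ((hd hij).preimage Prod.snd).mono inter_subset_left inter_subset_left

/-! ### Poisson random measures are good -/

theorem lebTime_block {T : ℝ} (hT : 0 < T) {k j : ℕ} (hj : j < 2 ^ k) :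
    lebTime T (block hT k j) = ENNReal.ofReal (T / 2 ^ k) := by
  have e : block hT k j = Subtype.val ⁻¹' Ioc (grid hT k j : ℝ) (grid hT k (j + 1)) := rfl
  rw [e, ← Measure.map_apply measurable_subtype_coe measurableSet_Ioc, map_lebTime,
    Measure.restrict_apply measurableSet_Ioc, inter_eq_self_of_subset_left, Real.volume_Ioc,
    grid_succ_sub hT hj]
  exact fun x hx => ⟨(grid hT k j).2.1.trans hx.1.le, hx.2.trans (grid hT k (j + 1)).2.2⟩

theorem lebMarkTime_cell {T : ℝ} (hT : 0 < T) (K : ℕ) {k j : ℕ} (hj : j < 2 ^ k) :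
    lebMarkTime T (cell hT K k j) = ENNReal.ofReal (K * (T / 2 ^ k)) := by
  have e : cell hT K k j = (Subtype.val ⁻¹' Ico (0 : ℝ) K) ×ˢ block hT k j := by
    ext p
    have : (0 : ℝ) ≤ p.1 := p.1.2
    simp [cell, below, this]
  rw [e, lebMarkTime, Measure.prod_prod, lebHalf_preimage_Ico le_rfl, lebTime_block hT hj, sub_zero,
    ← ENNReal.ofReal_mul (Nat.cast_nonneg K)]

theorem lebTime_univ (T : ℝ) : lebTime T univ = ENNReal.ofReal T := by
  rw [← preimage_univ (f := ((↑) : Icc (0 : ℝ) T → ℝ)),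
    ← Measure.map_apply measurable_subtype_coe MeasurableSet.univ, map_lebTime,
    Measure.restrict_apply_univ, Real.volume_Icc, sub_zero]

theorem lebMarkTime_strip (T : ℝ) {lam : ℝ} (hlam : 0 < lam) (i : ℕ) :
    lebMarkTime T (strip T lam i) = ENNReal.ofReal (lam * T) := by
  have hm : (0 : ℝ) < max lam 1 := lt_of_lt_of_le one_pos (le_max_right _ _)
  have e : strip T lam i
      = (Subtype.val ⁻¹' Ico (2 * i * max lam 1) (2 * i * max lam 1 + lam)) ×ˢ univ := by
    ext p; simp [strip]
  rw [e, lebMarkTime, Measure.prod_prod, lebHalf_preimage_Ico (by positivity), lebTime_univ T,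
    add_sub_cancel_left, ← ENNReal.ofReal_mul hlam.le]

theorem lebMarkTime_zero {T : ℝ} : lebMarkTime T {p | (p.2 : ℝ) ≤ 0} = 0 := by
  have e : {p : MarkTime T | (p.2 : ℝ) ≤ 0} = univ ×ˢ (Subtype.val ⁻¹' Iic (0 : ℝ)) := by
    ext p; simp
  have h : lebTime T (Subtype.val ⁻¹' Iic (0 : ℝ)) = 0 := by
    rw [← Measure.map_apply measurable_subtype_coe measurableSet_Iic, map_lebTime,
      Measure.restrict_apply measurableSet_Iic]
    refine measure_mono_null (t := {0}) ?_ Real.volume_singleton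
    rintro x ⟨h1, h2⟩
    exact le_antisymm h1 h2.1
  rw [e, lebMarkTime, Measure.prod_prod, h, mul_zero]

theorem pairwise_disjoint_strip {T lam : ℝ} {i j : ℕ} (hij : i ≠ j) :
    Disjoint (strip T lam i) (strip T lam j) := by
  have key : ∀ i j : ℕ, i < j → Disjoint (strip T lam i) (strip T lam j) := by
    intro i j hij
    rw [Set.disjoint_left]
    rintro p ⟨-, h1⟩ ⟨h2, -⟩
    have h3 : (i : ℝ) + 1 ≤ j := by exact_mod_cast hij
    have h4 : lam ≤ max lam 1 := le_max_left _ _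
    have h5 : (1 : ℝ) ≤ max lam 1 := le_max_right _ _
    nlinarith
  rcases lt_or_gt_of_ne hij with h | h
  · exact key i j h
  · exact (key j i h).symm

section Field

variable {Ω : Type*} [MeasurableSpace Ω] {P : Measure Ω} {T : ℝ}
  {n : ℕ} {M : Ω → Measure (MarkTime T)}

/-- There are `2 ^ k` cells, each with more than one point with probability at most `(n K T / 2 ^ k)
^ 2`. The probability that some cell is bad is at most `(n K T) ^ 2 / 2 ^ k`, so almost surely some
`k` has no bad cell. The masses of subsets are integers, hence `0` or `1` as well. -/
theorem IsPoissonField.ae_cells (hM : IsPoissonField ((n : ℝ≥0∞) • lebMarkTime T) M P)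
    (hT : 0 < T) (K : ℕ) : ∀ᵐ ω ∂P, ∃ k : ℕ, ∀ j : ℕ, j < 2 ^ k →
      ∀ U ∈ insert univ (TopologicalSpace.countableBasis (MarkTime T)),
        M ω (cell hT K k j ∩ U) = 0 ∨ M ω (cell hT K k j ∩ U) = 1 := by
  have hval : ∀ {k j : ℕ}, j < 2 ^ k → ((n : ℝ≥0∞) • lebMarkTime T) (cell hT K k j)
      = ENNReal.ofReal (n * (K * (T / 2 ^ k))) := by
    intro k j hj
    rw [Measure.smul_apply, smul_eq_mul, lebMarkTime_cell hT K hj,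
      ENNReal.ofReal_mul (Nat.cast_nonneg n), ENNReal.ofReal_natCast]
  have hfin : ∀ {k j : ℕ}, j < 2 ^ k → ((n : ℝ≥0∞) • lebMarkTime T) (cell hT K k j) < ∞ := by
    intro k j hj
    rw [hval hj]
    exact ENNReal.ofReal_lt_top
  have hnat : ∀ᵐ ω ∂P, ∀ k j : ℕ, j < 2 ^ k →
      ∀ U ∈ insert univ (TopologicalSpace.countableBasis (MarkTime T)),
        ∃ l : ℕ, M ω (cell hT K k j ∩ U) = l := by
    refine ae_all_iff.2 fun k => ae_all_iff.2 fun j => ?_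
    by_cases hj : j < 2 ^ k
    · have h2 := (ae_ball_iff ((TopologicalSpace.countable_countableBasis (MarkTime T)).insert univ)
        (p := fun ω U _ => ∃ l : ℕ, M ω (cell hT K k j ∩ U) = l) (μ := P)).2 fun U hU =>
          hM.ae_nat ((measurableSet_cell hT K k j).inter (measurableSet_basis hU))
            ((measure_mono inter_subset_left).trans_lt (hfin hj))
      filter_upwards [h2] with ω hω _ using hω
    · exact Eventually.of_forall fun ω h => absurd h hj
  have hbad : P {ω | ∀ k : ℕ, ∃ j, j < 2 ^ k ∧
      ¬ (M ω (cell hT K k j) = 0 ∨ M ω (cell hT K k j) = 1)} = 0 := by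
    have hk : ∀ k : ℕ, P {ω | ∀ k : ℕ, ∃ j, j < 2 ^ k ∧
        ¬ (M ω (cell hT K k j) = 0 ∨ M ω (cell hT K k j) = 1)}
          ≤ ENNReal.ofReal ((n * K * T) ^ 2 / 2 ^ k) := by
      intro k
      calc _ ≤ P (⋃ j ∈ Finset.range (2 ^ k),
              {ω | ¬ (M ω (cell hT K k j) = 0 ∨ M ω (cell hT K k j) = 1)}) := by
            refine measure_mono fun ω hω => ?_
            obtain ⟨j, hj, h⟩ := hω k
            simp only [mem_iUnion, Finset.mem_range, exists_prop]
            exact ⟨j, hj, h⟩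
        _ ≤ ∑ j ∈ Finset.range (2 ^ k),
              P {ω | ¬ (M ω (cell hT K k j) = 0 ∨ M ω (cell hT K k j) = 1)} :=
            measure_biUnion_finset_le _ _
        _ ≤ ∑ _j ∈ Finset.range (2 ^ k), ENNReal.ofReal ((n * (K * (T / 2 ^ k))) ^ 2) := by
            refine Finset.sum_le_sum fun j hj => ?_
            have hj' := Finset.mem_range.1 hj
            have h := hM.measure_ge_two_le (measurableSet_cell hT K k j) (hfin hj')
            rwa [hval hj', ENNReal.toReal_ofReal (by positivity)] at h
        _ = ENNReal.ofReal ((n * K * T) ^ 2 / 2 ^ k) := by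
            rw [Finset.sum_const, Finset.card_range, nsmul_eq_mul, ← ENNReal.ofReal_natCast,
              ← ENNReal.ofReal_mul (Nat.cast_nonneg _)]
            congr 1
            push_cast
            field_simp
    have hlim : Tendsto (fun k : ℕ => ENNReal.ofReal ((n * K * T) ^ 2 / 2 ^ k)) atTop (𝓝 0) := by
      have := ENNReal.tendsto_ofReal (tendsto_div_two_pow ((n * K * T) ^ 2))
      rwa [ENNReal.ofReal_zero] at this
    exact le_antisymm (ge_of_tendsto' hlim hk) zero_le
  have hgood : ∀ᵐ ω ∂P, ¬ ∀ k : ℕ, ∃ j, j < 2 ^ k ∧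
      ¬ (M ω (cell hT K k j) = 0 ∨ M ω (cell hT K k j) = 1) :=
    measure_eq_zero_iff_ae_notMem.1 hbad
  filter_upwards [hnat, hgood] with ω h1 h2
  push Not at h2
  obtain ⟨k, hk⟩ := h2
  refine ⟨k, fun j hj U hU => ?_⟩
  obtain ⟨l, hl⟩ := h1 k j hj U hU
  have hle : M ω (cell hT K k j ∩ U) ≤ 1 := by
    refine (measure_mono inter_subset_left).trans ?_
    rcases hk j hj with h0 | h1
    · rw [h0]; exact zero_le
    · exact h1.le
  rw [hl] at hle ⊢
  have hl1 : l ≤ 1 := by exact_mod_cast hle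
  rcases Nat.le_one_iff_eq_zero_or_eq_one.1 hl1 with rfl | rfl
  · exact Or.inl Nat.cast_zero
  · exact Or.inr Nat.cast_one

/-- The strips are disjoint and of equal intensity, so they are independently empty with one and the
same positive probability. The chance that `L` of them are all nonempty is `c ^ L` with `c < 1`. -/
theorem IsPoissonField.ae_strips [IsProbabilityMeasure P]
    (hM : IsPoissonField ((n : ℝ≥0∞) • lebMarkTime T) M P)
    (hT : 0 < T) {lam : ℝ} (hlam : 0 < lam) (m : ℕ) :
    ∀ᵐ ω ∂P, ∃ i : ℕ, m ≤ i ∧ M ω (strip T lam i) = 0 := by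
  have hval : ∀ i, ((n : ℝ≥0∞) • lebMarkTime T) (strip T lam i)
      = ENNReal.ofReal (n * (lam * T)) := by
    intro i
    rw [Measure.smul_apply, smul_eq_mul, lebMarkTime_strip T hlam,
      ENNReal.ofReal_mul (Nat.cast_nonneg n), ENNReal.ofReal_natCast]
  set c : ℝ≥0∞ := 1 - ENNReal.ofReal (Real.exp (-(n * (lam * T)))) with hc
  have hc1 : c < 1 := by
    refine ENNReal.sub_lt_self ENNReal.one_ne_top one_ne_zero ?_
    exact (ENNReal.ofReal_pos.2 (Real.exp_pos _)).ne'
  have hone : ∀ i, P ((fun ω => M ω (strip T lam i)) ⁻¹' {0}ᶜ) = c := by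
    intro i
    have hm := hM.measurable_apply (measurableSet_strip T lam i)
    rw [preimage_compl, prob_compl_eq_one_sub (hm (measurableSet_singleton 0))]
    have h := hM.measure_eq_zero (measurableSet_strip T lam i)
      (by rw [hval]; exact ENNReal.ofReal_lt_top)
    rw [hval, ENNReal.toReal_ofReal (by positivity)] at h
    rw [hc, ← h]
    rfl
  have hL : ∀ L : ℕ, P {ω | ¬ ∃ i : ℕ, m ≤ i ∧ M ω (strip T lam i) = 0} ≤ c ^ L := by
    intro L
    have hind := hM.indep L (fun l => strip T lam (m + l)) (fun l => measurableSet_strip T lam _)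
      (fun i j hij => pairwise_disjoint_strip (fun h => hij (Fin.ext (by omega))))
    have h := hind.measure_inter_preimage_eq_mul Finset.univ (sets := fun _ => {0}ᶜ)
      (fun _ _ => (measurableSet_singleton 0).compl)
    simp only [hone, Finset.prod_const, Finset.card_univ, Fintype.card_fin] at h
    rw [← h]
    refine measure_mono fun ω hω => ?_
    simp only [mem_iInter]
    exact fun l _ h0 => hω ⟨m + l, Nat.le_add_right _ _, h0⟩
  have hlim : Tendsto (fun L : ℕ => c ^ L) atTop (𝓝 0) :=
    ENNReal.tendsto_pow_atTop_nhds_zero_of_lt_one hc1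
  rw [ae_iff]
  exact le_antisymm (ge_of_tendsto' hlim hL) zero_le

theorem IsPoissonField.ae_good [IsProbabilityMeasure P]
    (hM : IsPoissonField ((n : ℝ≥0∞) • lebMarkTime T) M P)
    (hT : 0 < T) {lam : ℝ} (hlam : 0 < lam) : ∀ᵐ ω ∂P, Good hT lam (M ω) := by
  have h0 : ∀ᵐ ω ∂P, M ω {p | (p.2 : ℝ) ≤ 0} = 0 :=
    hM.ae_eq_zero (measurableSet_le (measurable_subtype_coe.comp measurable_snd) measurable_const)
      (by rw [Measure.smul_apply, lebMarkTime_zero, smul_zero])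
  filter_upwards [h0, ae_all_iff.2 (hM.ae_cells hT), ae_all_iff.2 (hM.ae_strips hT hlam)]
    with ω h1 h2 h3 using ⟨h1, h2, h3⟩

end Field

/-! ### The occupancy process as a functional of the random measure -/

theorem exists_solution_map {T : ℝ} (hT : 0 < T) {d n : ℕ} {lam : ℝ} (hlam : 0 < lam) (hn : d ≤ n)
    (hn0 : 0 < n) {q₀ : L2} (hq : q₀ ∈ states n) :
    ∃ 𝒢 : RadonMeasure (MarkTime T) → Cadlag T L2, Measurable 𝒢 ∧
      ∀ (Ω : Type*) [MeasurableSpace Ω] (P : Measure Ω) [IsProbabilityMeasure P]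
        (N : Ω → RadonMeasure (Half × MarkTime T)),
        IsPoissonRandomMeasure (intensity T) N P →
          IsOccupancyProcess d lam n q₀ N P (fun ω => 𝒢 (scaledThin n (N ω))) ∧
          ∀ Qn : Ω → Cadlag T L2, IsOccupancyProcess d lam n q₀ N P Qn →
            ∀ᵐ ω ∂P, Qn ω = 𝒢 (scaledThin n (N ω)) := by
  have hscale : ∀ μ : RadonMeasure (Half × MarkTime T),
      (n : ℝ≥0) • (scaledThin n μ).1 = (thin n μ).1 := by
    intro μ
    have : (n : ℝ≥0) ≠ 0 := by exact_mod_cast hn0.ne'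
    rw [scaledThin, smul_smul, mul_inv_cancel₀ this, one_smul]
  -- The map receives the measure divided by `n`, and multiplication by `n` recovers the counting
  -- measure.
  refine ⟨fun μ => solMap hT d lam n q₀ ((n : ℝ≥0) • μ.1), ?_, ?_⟩
  · refine (measurable_solMap hT hlam hn hn0 hq).comp ?_
    refine Measure.measurable_of_measurable_coe _ fun A hA => ?_
    have : Measurable fun μ : RadonMeasure (MarkTime T) => μ.1 A :=
      (Measure.measurable_coe hA).comp measurable_subtype_coe
    simp only [Measure.smul_apply]
    exact this.const_smul _
  · intro Ω _ P _ N hN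
    have hgood := (isPoissonField_thin hN n).ae_good hT hlam
    refine ⟨?_, fun Qn hQn => ?_⟩
    · filter_upwards [hgood] with ω hω
      rw [hscale, isOccupancyPath_iff]
      exact hω.solMap hlam hn hn0 hq
    · filter_upwards [hgood, hQn] with ω hω hx
      rw [hscale]
      exact hω.unique hlam hn hn0 hq (isOccupancyPath_iff.1 hx) (hω.solMap hlam hn hn0 hq)

/-! ### The law of large numbers: compensated noise, stability of the scheme, convergence. -/

/-! ### The noise of the Euler scheme -/

/-- The increment over a block, minus its mean. -/
def noise {T : ℝ} (hT : 0 < T) (d : ℕ) (lam : ℝ) (n k j : ℕ) (q : L2) (μ : Measure (MarkTime T))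
    (i : ℕ) : ℝ :=
  incr d lam n q (block hT k j) μ i - T / 2 ^ k * nDriftCoord d lam n q i

/-- The sum of the squares of a sequence, possibly infinite. -/
def sumSq (m : ℕ → ℝ) : ℝ≥0∞ := ∑' i, ENNReal.ofReal (m i ^ 2)

theorem measurable_sumSq : Measurable sumSq :=
  Measurable.tsum fun i => ((measurable_pi_apply i).pow_const 2).ennreal_ofReal

/-- The cross term has mean zero, and `(X - Y) ^ 2 ≤ 2 (X ^ 2 + Y ^ 2)` dispenses with the
covariance of `X` and `Y`. Here `m` stands for the noise accumulated so far, and `X`, `Y` for the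
centred arrival and departure counts of a block. -/
theorem lintegral_add_centered_sq_le {Ω : Type*} [MeasurableSpace Ω] {P : Measure Ω}
    [IsProbabilityMeasure P] {X Y : Ω → ℝ} {a b : ℝ} (hX : Integrable X P) (hY : Integrable Y P)
    (hX0 : ∫ ω, X ω ∂P = 0) (hY0 : ∫ ω, Y ω ∂P = 0) (hX2 : Integrable (fun ω => X ω ^ 2) P)
    (hY2 : Integrable (fun ω => Y ω ^ 2) P) (ha : ∫ ω, X ω ^ 2 ∂P = a) (hb : ∫ ω, Y ω ^ 2 ∂P = b)
    (m e : ℝ) :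
    ∫⁻ ω, ENNReal.ofReal ((m + e * (X ω - Y ω)) ^ 2) ∂P
      ≤ ENNReal.ofReal (m ^ 2) + ENNReal.ofReal (2 * e ^ 2 * (a + b)) := by
  have ha0 : 0 ≤ a := ha ▸ integral_nonneg fun ω => sq_nonneg _
  have hb0 : 0 ≤ b := hb ▸ integral_nonneg fun ω => sq_nonneg _
  have hle : ∀ ω, (m + e * (X ω - Y ω)) ^ 2
      ≤ m ^ 2 + (2 * m * e * (X ω - Y ω) + 2 * e ^ 2 * (X ω ^ 2 + Y ω ^ 2)) := by
    intro ω
    nlinarith [sq_nonneg (e * (X ω + Y ω))]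
  have i1 : Integrable (fun ω => 2 * m * e * (X ω - Y ω)) P := (hX.sub hY).const_mul _
  have i2 : Integrable (fun ω => 2 * e ^ 2 * (X ω ^ 2 + Y ω ^ 2)) P := (hX2.add hY2).const_mul _
  have i3 : Integrable (fun ω => 2 * m * e * (X ω - Y ω) + 2 * e ^ 2 * (X ω ^ 2 + Y ω ^ 2)) P :=
    i1.add i2
  have hint : ∫ ω, (m ^ 2 + (2 * m * e * (X ω - Y ω) + 2 * e ^ 2 * (X ω ^ 2 + Y ω ^ 2))) ∂P
      = m ^ 2 + 2 * e ^ 2 * (a + b) := by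
    rw [integral_add (integrable_const _) i3, integral_add i1 i2, integral_const_mul,
      integral_const_mul, integral_sub hX hY, integral_add hX2 hY2, hX0, hY0, ha, hb,
      integral_const]
    simp
  calc _ ≤ ∫⁻ ω, ENNReal.ofReal
        (m ^ 2 + (2 * m * e * (X ω - Y ω) + 2 * e ^ 2 * (X ω ^ 2 + Y ω ^ 2))) ∂P :=
      lintegral_mono fun ω => ENNReal.ofReal_le_ofReal (hle ω)
    _ = ENNReal.ofReal (m ^ 2 + 2 * e ^ 2 * (a + b)) := by
      rw [← hint]
      exact (ofReal_integral_eq_lintegral_ofReal ((integrable_const (m ^ 2)).add i3)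
        (Eventually.of_forall fun ω => (sq_nonneg _).trans (hle ω))).symm
    _ = _ := ENNReal.ofReal_add (sq_nonneg _) (by positivity)

/-- Conditioning on `Z` in the form of Fubini: the law of the pair is a product, so a bound for each
frozen value `z` can be integrated. -/
theorem lintegral_comp_le_of_indepFun {Ω α β : Type*} [MeasurableSpace Ω] [MeasurableSpace α]
    [MeasurableSpace β] {P : Measure Ω} [IsProbabilityMeasure P] {Z : Ω → α} {Y : Ω → β}
    (hind : IndepFun Z Y P) (hZ : Measurable Z) (hY : Measurable Y) {Ψ : α × β → ℝ≥0∞}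
    (hΨ : Measurable Ψ) {φ : α → ℝ≥0∞} (hφ : Measurable φ)
    (h : ∀ z, ∫⁻ ω, Ψ (z, Y ω) ∂P ≤ φ z) :
    ∫⁻ ω, Ψ (Z ω, Y ω) ∂P ≤ ∫⁻ ω, φ (Z ω) ∂P := by
  have : IsProbabilityMeasure (P.map Z) := Measure.isProbabilityMeasure_map hZ.aemeasurable
  have : IsProbabilityMeasure (P.map Y) := Measure.isProbabilityMeasure_map hY.aemeasurable
  calc ∫⁻ ω, Ψ (Z ω, Y ω) ∂P = ∫⁻ p, Ψ p ∂(P.map Z).prod (P.map Y) := by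
        rw [← hind.map_prod_eq_prod_map_map hZ.aemeasurable hY.aemeasurable,
          lintegral_map hΨ (hZ.prodMk hY)]
    _ = ∫⁻ z, ∫⁻ y, Ψ (z, y) ∂P.map Y ∂P.map Z := lintegral_prod _ hΨ.aemeasurable
    _ ≤ ∫⁻ z, φ z ∂P.map Z := by
        refine lintegral_mono fun z => ?_
        exact (lintegral_map (hΨ.comp measurable_prodMk_left) hY).trans_le (h z)
    _ = ∫⁻ ω, φ (Z ω) ∂P := lintegral_map hφ hZ

section Field

variable {Ω : Type*} [MeasurableSpace Ω] {P : Measure Ω} [IsProbabilityMeasure P] {T : ℝ}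
  {n : ℕ} {M : Ω → Measure (MarkTime T)}

theorem intensity_window (hT : 0 < T) {k j : ℕ} (hj : j < 2 ^ k) {A : Set ℝ} {a : ℝ} (ha : 0 ≤ a)
    (hA : lebHalf (Subtype.val ⁻¹' A) = ENNReal.ofReal a) :
    ((n : ℝ≥0∞) • lebMarkTime T) ((Subtype.val ⁻¹' A) ×ˢ block hT k j)
      = ENNReal.ofReal (n * (a * (T / 2 ^ k))) := by
  rw [Measure.smul_apply, smul_eq_mul, lebMarkTime, Measure.prod_prod, hA, lebTime_block hT hj,
    ← ENNReal.ofReal_mul ha, ENNReal.ofReal_mul (Nat.cast_nonneg n), ENNReal.ofReal_natCast]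

/-- In each coordinate the variance of a count is its mean, `n` times rate times mesh, and jumps
carry the factor `1 / n`. Summed over coordinates only the total rate, at most `lam + 1`, appears,
so the bound depends neither on the dimension nor on the state. -/
theorem IsPoissonField.lintegral_noise_le
    (hM : IsPoissonField ((n : ℝ≥0∞) • lebMarkTime T) M P) (hT : 0 < T) {d : ℕ} {lam : ℝ}
    (hlam : 0 < lam) (hn : d ≤ n) (hn0 : 0 < n) {q : L2} (hq : q ∈ states n) {k j : ℕ}
    (hj : j < 2 ^ k) (m : ℕ → ℝ) :
    ∫⁻ ω, sumSq (fun i => m i + noise hT d lam n k j q (M ω) i) ∂P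
      ≤ sumSq m + ENNReal.ofReal (2 * (lam + 1) / n * (T / 2 ^ k)) := by
  have hnR : (0 : ℝ) < n := by exact_mod_cast hn0
  have hh : 0 < T / 2 ^ k := by positivity
  have hql := states_subset_limitStates hn0 hq
  let v : ℕ → ℝ := fun i => Nat.casesOn i 0 fun i =>
    lam * arrivalRate d n q i + (q (i + 1) - q (i + 2))
  have hmeas : ∀ i, Measurable fun ω => ENNReal.ofReal ((m i + noise hT d lam n k j q (M ω) i) ^ 2) :=
    fun i => (((((measurable_incr d lam n q (measurableSet_block hT k j) i).comp
      hM.measurable).sub_const _).const_add _).pow_const 2).ennreal_ofReal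
  have hcoord : ∀ i, ∫⁻ ω, ENNReal.ofReal ((m i + noise hT d lam n k j q (M ω) i) ^ 2) ∂P
      ≤ ENNReal.ofReal (m i ^ 2) + ENNReal.ofReal (2 / n * (T / 2 ^ k)) * ENNReal.ofReal (v i) := by
    rintro (_ | i)
    · simp [noise, incr, nDriftCoord, v]
    · have hr := arrivalRate_nonneg hn hq i
      have ha : 0 ≤ lam * arrivalRate d n q i := mul_nonneg hlam.le hr
      have hb : 0 ≤ q (i + 1) - q (i + 2) := sub_nonneg.2 (hq.2 (i + 1)).1
      set A : Set (MarkTime T) :=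
        (Subtype.val ⁻¹' arrWin lam (arrivalRate d n q) i) ×ˢ block hT k j with hAdef
      set B : Set (MarkTime T) := (Subtype.val ⁻¹' depWin lam q i) ×ˢ block hT k j with hBdef
      have hA : MeasurableSet A := (measurable_subtype_coe (p := (· ∈ Ici (0 : ℝ)))
        (measurableSet_arrWin lam (arrivalRate d n q) i)).prod (measurableSet_block hT k j)
      have hB : MeasurableSet B := (measurable_subtype_coe (p := (· ∈ Ici (0 : ℝ)))
        (measurableSet_depWin lam q i)).prod (measurableSet_block hT k j)
      have hνA := intensity_window (n := n) hT hj ha (lebHalf_arrWin (arrivalRate d n q) i)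
      have hνB := intensity_window (n := n) hT hj hb (lebHalf_depWin (lam := lam) q i)
      rw [← hAdef] at hνA
      rw [← hBdef] at hνB
      have hfA : ((n : ℝ≥0∞) • lebMarkTime T) A < ∞ := by rw [hνA]; exact ENNReal.ofReal_lt_top
      have hfB : ((n : ℝ≥0∞) • lebMarkTime T) B < ∞ := by rw [hνB]; exact ENNReal.ofReal_lt_top
      have h := lintegral_add_centered_sq_le (hM.integrable_centered hA hfA)
        (hM.integrable_centered hB hfB) (hM.integral_centered hA hfA) (hM.integral_centered hB hfB)
        (hM.integrable_centered_sq hA hfA) (hM.integrable_centered_sq hB hfB)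
        (hM.integral_centered_sq hA hfA) (hM.integral_centered_sq hB hfB) (m (i + 1)) (n : ℝ)⁻¹
      rw [hνA, hνB, ENNReal.toReal_ofReal (by positivity), ENNReal.toReal_ofReal (by positivity)] at h
      refine (le_of_eq (lintegral_congr fun ω => ?_)).trans (h.trans (le_of_eq ?_))
      · congr 3
        simp only [noise, incr, nDriftCoord]
        rw [← hAdef, ← hBdef]
        field_simp
        ring
      · rw [← ENNReal.ofReal_mul (by positivity)]
        congr 2
        simp only [v]
        field_simp
  have hv : ∑' i, ENNReal.ofReal (v i) ≤ ENNReal.ofReal (lam + 1) := by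
    rw [tsum_eq_zero_add' ENNReal.summable]
    have e0 : ENNReal.ofReal (v 0) = 0 := by simp [v]
    have e : ∀ i, ENNReal.ofReal (v (i + 1)) = ENNReal.ofReal (lam * arrivalRate d n q i)
        + ENNReal.ofReal (q (i + 1) - q (i + 2)) := fun i =>
      ENNReal.ofReal_add (mul_nonneg hlam.le (arrivalRate_nonneg hn hq i))
        (sub_nonneg.2 (hq.2 (i + 1)).1)
    rw [e0, zero_add, tsum_congr e, ENNReal.tsum_add, ENNReal.ofReal_add hlam.le zero_le_one,
      ENNReal.ofReal_one]
    exact add_le_add (tsum_ofReal_arr_le hlam (arrivalRate_nonneg hn hq)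
      (sum_arrivalRate_le_one hn hq)) (tsum_ofReal_dep_le hql)
  calc ∫⁻ ω, sumSq (fun i => m i + noise hT d lam n k j q (M ω) i) ∂P
      = ∑' i, ∫⁻ ω, ENNReal.ofReal ((m i + noise hT d lam n k j q (M ω) i) ^ 2) ∂P :=
        lintegral_tsum fun i => (hmeas i).aemeasurable
    _ ≤ ∑' i, (ENNReal.ofReal (m i ^ 2)
          + ENNReal.ofReal (2 / n * (T / 2 ^ k)) * ENNReal.ofReal (v i)) :=
        ENNReal.tsum_le_tsum hcoord
    _ = sumSq m + ENNReal.ofReal (2 / n * (T / 2 ^ k)) * ∑' i, ENNReal.ofReal (v i) := by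
        rw [ENNReal.tsum_add, ENNReal.tsum_mul_left, sumSq]
    _ ≤ sumSq m + ENNReal.ofReal (2 / n * (T / 2 ^ k)) * ENNReal.ofReal (lam + 1) := by gcongr
    _ = _ := by
        rw [← ENNReal.ofReal_mul (by positivity)]
        congr 2
        field_simp

/-! ### The stopped martingale -/

open Classical in
/-- A step of the Euler scheme with its accumulated noise, which is frozen once its size
exceeds `c`. -/
def chainStep (hT : 0 < T) (d : ℕ) (lam : ℝ) (c : ℝ≥0∞) (k j : ℕ) (μ : Measure (MarkTime T))
    (z : states n × (ℕ → ℝ)) : states n × (ℕ → ℝ) :=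
  (eulerStep d lam n (block hT k j) μ z.1,
    if c < sumSq z.2 then z.2 else fun i => z.2 i + noise hT d lam n k j z.1 μ i)

/-- The Euler scheme with its accumulated noise, which is frozen once its size exceeds `c`. -/
def chain (hT : 0 < T) (d : ℕ) (lam : ℝ) (c : ℝ≥0∞) (q₀ : states n) (k : ℕ) :
    ℕ → Measure (MarkTime T) → states n × (ℕ → ℝ)
  | 0, _ => (q₀, 0)
  | j + 1, μ => chainStep hT d lam c k j μ (chain hT d lam c q₀ k j μ)

theorem measurable_chainStep (hT : 0 < T) (d : ℕ) (lam : ℝ) (c : ℝ≥0∞) (hn0 : 0 < n) (k j : ℕ) :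
    Measurable fun p : (states n × (ℕ → ℝ)) × Measure (MarkTime T) =>
      chainStep hT d lam c k j p.2 p.1 := by
  have : Countable (states n) := (countable_states hn0).to_subtype
  have hqμ : Measurable fun p : (states n × (ℕ → ℝ)) × Measure (MarkTime T) => (p.2, p.1.1) :=
    measurable_snd.prodMk (measurable_fst.comp measurable_fst)
  have h1 : Measurable fun z : Measure (MarkTime T) × states n =>
      eulerStep d lam n (block hT k j) z.1 z.2 :=
    measurable_from_prod_countable_left fun q =>
      measurable_eulerStep d lam hn0 (measurableSet_block hT k j) q
  have h2 : ∀ i, Measurable fun z : Measure (MarkTime T) × states n =>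
      noise hT d lam n k j z.2 z.1 i := fun i =>
    measurable_from_prod_countable_left fun q =>
      (measurable_incr d lam n q (measurableSet_block hT k j) i).sub_const
        (T / 2 ^ k * nDriftCoord d lam n q i)
  have hm : Measurable fun p : (states n × (ℕ → ℝ)) × Measure (MarkTime T) => p.1.2 :=
    measurable_snd.comp measurable_fst
  refine (h1.comp hqμ).prodMk (Measurable.ite ?_ hm ?_)
  · exact measurableSet_lt measurable_const (measurable_sumSq.comp hm)
  · refine measurable_pi_lambda _ fun i => ?_
    have h3 := (measurable_pi_apply i).comp hm
    have h4 := (h2 i).comp hqμ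
    exact Measurable.add h3 h4

theorem measurable_chain (hT : 0 < T) (d : ℕ) (lam : ℝ) (c : ℝ≥0∞) (hn0 : 0 < n) (q₀ : states n)
    (k j : ℕ) : Measurable (chain hT d lam c q₀ k j) := by
  induction j with
  | zero => exact measurable_const
  | succ j ih => exact (measurable_chainStep hT d lam c hn0 k j).comp (ih.prodMk measurable_id)

theorem incr_restrict (d : ℕ) (lam : ℝ) (q : L2) {I : Set (Icc (0 : ℝ) T)} (hI : MeasurableSet I)
    {H : Set (MarkTime T)} (hH : ∀ p : MarkTime T, p.2 ∈ I → p ∈ H) (μ : Measure (MarkTime T)) :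
    incr d lam n q I (μ.restrict H) = incr d lam n q I μ := by
  have h : ∀ A : Set ℝ, MeasurableSet A →
      μ.restrict H ((Subtype.val ⁻¹' A) ×ˢ I) = μ ((Subtype.val ⁻¹' A) ×ˢ I) := by
    intro A hA
    rw [Measure.restrict_apply ((measurable_subtype_coe (p := (· ∈ Ici (0 : ℝ))) hA).prod hI),
      inter_eq_self_of_subset_left]
    exact fun p hp => hH p hp.2
  funext i
  rcases i with _ | i
  · rfl
  · rw [incr, incr, h _ (measurableSet_arrWin _ _ _), h _ (measurableSet_depWin _ _ _)]

theorem chainStep_restrict (hT : 0 < T) (d : ℕ) (lam : ℝ) (c : ℝ≥0∞) (k j : ℕ)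
    {H : Set (MarkTime T)} (hH : ∀ p : MarkTime T, p.2 ∈ block hT k j → p ∈ H)
    (μ : Measure (MarkTime T)) (z : states n × (ℕ → ℝ)) :
    chainStep hT d lam c k j (μ.restrict H) z = chainStep hT d lam c k j μ z := by
  have h := incr_restrict (n := n) d lam z.1 (measurableSet_block hT k j) hH μ
  have h2 : eulerStep d lam n (block hT k j) (μ.restrict H) z.1
      = eulerStep d lam n (block hT k j) μ z.1 := by
    unfold eulerStep
    rw [h]
  simp only [chainStep, h2, noise, h]

theorem chain_restrict (hT : 0 < T) (d : ℕ) (lam : ℝ) (c : ℝ≥0∞) (q₀ : states n) (k j : ℕ)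
    {H : Set (MarkTime T)} (hH : ∀ p : MarkTime T, p.2 ≤ grid hT k j → p ∈ H)
    (μ : Measure (MarkTime T)) :
    chain hT d lam c q₀ k j (μ.restrict H) = chain hT d lam c q₀ k j μ := by
  induction j with
  | zero => rfl
  | succ j ih =>
    rw [chain, chain, ih fun p hp => hH p (hp.trans (grid_mono hT k (Nat.le_succ j))),
      chainStep_restrict hT d lam c k j fun p hp => hH p hp.2]

theorem IsPoissonField.lintegral_chainStep_le
    (hM : IsPoissonField ((n : ℝ≥0∞) • lebMarkTime T) M P) (hT : 0 < T) {d : ℕ} {lam : ℝ}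
    (hlam : 0 < lam) (hn : d ≤ n) (hn0 : 0 < n) (c : ℝ≥0∞) {k j : ℕ} (hj : j < 2 ^ k)
    (z : states n × (ℕ → ℝ)) :
    ∫⁻ ω, sumSq (chainStep hT d lam c k j (M ω) z).2 ∂P
      ≤ sumSq z.2 + ENNReal.ofReal (2 * (lam + 1) / n * (T / 2 ^ k)) := by
  by_cases h : c < sumSq z.2
  · simp only [chainStep, if_pos h, lintegral_const, measure_univ, mul_one]
    exact le_self_add
  · simp only [chainStep, if_neg h]
    exact hM.lintegral_noise_le hT hlam hn hn0 z.1.2 hj z.2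

/-- The Markov property: the chain up to step `j` only uses points up to the `j`-th grid time, the
next step only those of the following block. The two restrictions are independent. -/
theorem IsPoissonField.lintegral_chain_succ_le
    (hM : IsPoissonField ((n : ℝ≥0∞) • lebMarkTime T) M P) (hT : 0 < T) {d : ℕ} {lam : ℝ}
    (hlam : 0 < lam) (hn : d ≤ n) (hn0 : 0 < n) (c : ℝ≥0∞) (q₀ : states n) {k j : ℕ}
    (hj : j < 2 ^ k) :
    ∫⁻ ω, sumSq (chain hT d lam c q₀ k (j + 1) (M ω)).2 ∂P
      ≤ ∫⁻ ω, sumSq (chain hT d lam c q₀ k j (M ω)).2 ∂P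
        + ENNReal.ofReal (2 * (lam + 1) / n * (T / 2 ^ k)) := by
  set H : Set (MarkTime T) := {p | p.2 ≤ grid hT k j} with hH
  set H' : Set (MarkTime T) := {p | p.2 ∈ block hT k j} with hH'
  have hmH : MeasurableSet H := measurableSet_le_time _
  have hmH' : MeasurableSet H' := measurable_snd (measurableSet_block hT k j)
  have hd : Disjoint H H' := Set.disjoint_left.2 fun p hp hp' => absurd hp'.1 (not_lt.2 hp)
  have hind := hM.indepFun_restrict hmH hmH' hd
  have hmr : ∀ {A : Set (MarkTime T)}, MeasurableSet A → Measurable fun ω => (M ω).restrict A :=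
    fun hA => Measure.measurable_of_measurable_coe _ fun B hB => by
      simpa only [Measure.restrict_apply hB] using hM.measurable_apply (hB.inter hA)
  have hmc := measurable_chain hT d lam c hn0 q₀ k j
  have hΨ : Measurable fun p : (states n × (ℕ → ℝ)) × Measure (MarkTime T) =>
      sumSq (chainStep hT d lam c k j p.2 p.1).2 :=
    measurable_sumSq.comp (measurable_snd.comp (measurable_chainStep hT d lam c hn0 k j))
  have hφ : Measurable fun z : states n × (ℕ → ℝ) =>
      sumSq z.2 + ENNReal.ofReal (2 * (lam + 1) / n * (T / 2 ^ k)) :=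
    (measurable_sumSq.comp measurable_snd).add_const _
  have h := lintegral_comp_le_of_indepFun (hind.comp hmc measurable_id) (hmc.comp (hmr hmH))
    (measurable_id.comp (hmr hmH')) hΨ hφ fun z => by
      simp only [Function.comp_apply, id_eq, chainStep_restrict hT d lam c k j (H := H')
        fun p hp => hp]
      exact hM.lintegral_chainStep_le hT hlam hn hn0 c hj z
  simp only [Function.comp_apply, id_eq, chainStep_restrict hT d lam c k j (H := H')
    fun p hp => hp, chain_restrict hT d lam c q₀ k j (H := H) fun p hp => hp] at h
  rw [lintegral_add_right _ measurable_const, lintegral_const, measure_univ, mul_one] at h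
  exact h

theorem IsPoissonField.lintegral_chain_le
    (hM : IsPoissonField ((n : ℝ≥0∞) • lebMarkTime T) M P) (hT : 0 < T) {d : ℕ} {lam : ℝ}
    (hlam : 0 < lam) (hn : d ≤ n) (hn0 : 0 < n) (c : ℝ≥0∞) (q₀ : states n) {k j : ℕ}
    (hj : j ≤ 2 ^ k) :
    ∫⁻ ω, sumSq (chain hT d lam c q₀ k j (M ω)).2 ∂P
      ≤ j * ENNReal.ofReal (2 * (lam + 1) / n * (T / 2 ^ k)) := by
  induction j with
  | zero => simp [chain, sumSq]
  | succ j ih =>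
    refine (hM.lintegral_chain_succ_le hT hlam hn hn0 c q₀ hj).trans ?_
    rw [Nat.cast_succ, add_mul, one_mul]
    gcongr
    exact ih (Nat.le_of_succ_le hj)

/-- The accumulated noise is small with high probability, uniformly in the mesh. -/
theorem IsPoissonField.measure_chain_le
    (hM : IsPoissonField ((n : ℝ≥0∞) • lebMarkTime T) M P) (hT : 0 < T) {d : ℕ} {lam : ℝ}
    (hlam : 0 < lam) (hn : d ≤ n) (hn0 : 0 < n) {c : ℝ} (hc : 0 < c) (q₀ : states n) (k : ℕ) :
    P {ω | ENNReal.ofReal c < sumSq (chain hT d lam (ENNReal.ofReal c) q₀ k (2 ^ k) (M ω)).2}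
      ≤ ENNReal.ofReal (2 * (lam + 1) * T / c / n) := by
  have hnR : (0 : ℝ) < n := by exact_mod_cast hn0
  have hmeas : Measurable fun ω => sumSq (chain hT d lam (ENNReal.ofReal c) q₀ k (2 ^ k) (M ω)).2 :=
    measurable_sumSq.comp (measurable_snd.comp
      ((measurable_chain hT d lam _ hn0 q₀ k _).comp hM.measurable))
  calc P {ω | ENNReal.ofReal c < sumSq (chain hT d lam (ENNReal.ofReal c) q₀ k (2 ^ k) (M ω)).2}
      ≤ P {ω | ENNReal.ofReal c
          ≤ sumSq (chain hT d lam (ENNReal.ofReal c) q₀ k (2 ^ k) (M ω)).2} :=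
        measure_mono fun ω hω => by
          rw [mem_ofPred_eq] at hω ⊢
          exact hω.le
    -- Markov's inequality at the final time suffices, in place of a maximal inequality, because a
    -- chain that has exceeded the level is frozen above it. The `2 ^ k` steps of length `T / 2 ^ k`
    -- make the bound independent of `k`.
    _ ≤ (∫⁻ ω, sumSq (chain hT d lam (ENNReal.ofReal c) q₀ k (2 ^ k) (M ω)).2 ∂P)
          / ENNReal.ofReal c :=
        meas_ge_le_lintegral_div hmeas.aemeasurable (ENNReal.ofReal_pos.2 hc).ne'
          ENNReal.ofReal_ne_top
    _ ≤ (((2 ^ k : ℕ) : ℝ≥0∞) * ENNReal.ofReal (2 * (lam + 1) / n * (T / 2 ^ k)))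
          / ENNReal.ofReal c := by
        gcongr
        exact hM.lintegral_chain_le hT hlam hn hn0 _ q₀ le_rfl
    _ = ENNReal.ofReal (2 * (lam + 1) * T / c / n) := by
        rw [← ENNReal.ofReal_natCast, ← ENNReal.ofReal_mul (by positivity),
          ← ENNReal.ofReal_div_of_pos hc]
        congr 1
        push_cast
        field_simp

end Field

/-! ### The unstopped martingale -/

theorem chain_fst {T : ℝ} {n : ℕ} (hT : 0 < T) (d : ℕ) (lam : ℝ) (c : ℝ≥0∞) (q₀ : states n)
    (k j : ℕ) (μ : Measure (MarkTime T)) :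
    (chain hT d lam c q₀ k j μ).1 = euler hT d lam n q₀ k j μ := by
  induction j with
  | zero => rfl
  | succ j ih => rw [chain, chainStep, euler, ih]

/-- Freezing is permanent, so a small final value means that the level was never exceeded and the
chain is the unmodified accumulated noise. -/
theorem sumSq_chain_le_of_succ {T : ℝ} {n : ℕ} {hT : 0 < T} {d : ℕ} {lam : ℝ} {c : ℝ≥0∞}
    {q₀ : states n} {k j : ℕ} {μ : Measure (MarkTime T)}
    (h : sumSq (chain hT d lam c q₀ k (j + 1) μ).2 ≤ c) :
    sumSq (chain hT d lam c q₀ k j μ).2 ≤ c := by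
  by_contra hlt
  rw [chain, chainStep, if_pos (not_le.1 hlt)] at h
  exact hlt h

theorem chain_snd_of_le {T : ℝ} {n : ℕ} {hT : 0 < T} {d : ℕ} {lam : ℝ} {c : ℝ≥0∞}
    {q₀ : states n} {k : ℕ} {μ : Measure (MarkTime T)} {j : ℕ}
    (h : sumSq (chain hT d lam c q₀ k j μ).2 ≤ c) (i : ℕ) :
    (chain hT d lam c q₀ k j μ).2 i
      = ∑ l ∈ Finset.range j, noise hT d lam n k l (euler hT d lam n q₀ k l μ) μ i := by
  induction j with
  | zero => simp [chain]
  | succ j ih =>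
    have h' := sumSq_chain_le_of_succ h
    rw [Finset.sum_range_succ, ← ih h', chain, chainStep, if_neg (not_lt.2 h'), chain_fst]

/-! ### Stability of the Euler scheme -/

theorem discrete_gronwall {a : ℕ → ℝ} {α β : ℝ} (hβ : 0 ≤ β) {J : ℕ}
    (h : ∀ j ≤ J, a j ≤ α + β * ∑ l ∈ Finset.range j, a l) {j : ℕ} (hj : j ≤ J) :
    a j ≤ α * (1 + β) ^ j := by
  have key : ∀ j ≤ J, α + β * ∑ l ∈ Finset.range j, a l ≤ α * (1 + β) ^ j := by
    intro j hj
    induction j with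
    | zero => simp
    | succ j ih =>
      have h1 := ih (by omega)
      have h2 := mul_le_mul_of_nonneg_left (h j (by omega)) hβ
      have h3 := mul_le_mul_of_nonneg_left h1 hβ
      rw [Finset.sum_range_succ, pow_succ]
      nlinarith
  exact (h j hj).trans (key j hj)

/-- The error of `v` is controlled only after summation, as for a martingale, and that of `u` step
by step, as for the discretised limit. The summed equations are subtracted and the discrete Grönwall
inequality applied. -/
theorem euler_stability {E : Type*} [NormedAddCommGroup E] [NormedSpace ℝ E] {v u f g : ℕ → E}
    {J : ℕ} {h c δ η β : ℝ} (hh : 0 ≤ h) (hδ : 0 ≤ δ) (hη : 0 ≤ η) (hβ : 0 ≤ β) (hc : 0 ≤ c)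
    (hv : ∀ j ≤ J, ‖v j - v 0 - ∑ l ∈ Finset.range j, h • f l‖ ≤ c)
    (hu : ∀ j < J, ‖u (j + 1) - u j - h • g j‖ ≤ δ * h)
    (hfg : ∀ j < J, ‖f j - g j‖ ≤ η + β * ‖v j - u j‖) {j : ℕ} (hj : j ≤ J) :
    ‖v j - u j‖ ≤ (‖v 0 - u 0‖ + c + J * h * (δ + η)) * Real.exp (β * (J * h)) := by
  have hu' : ∀ j ≤ J, ‖u j - u 0 - ∑ l ∈ Finset.range j, h • g l‖ ≤ J * h * δ := by
    intro j hj
    rw [← Finset.sum_range_sub u j, ← Finset.sum_sub_distrib]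
    refine (norm_sum_le _ _).trans ?_
    refine (Finset.sum_le_sum fun l hl => hu l ((Finset.mem_range.1 hl).trans_le hj)).trans ?_
    rw [Finset.sum_const, Finset.card_range, nsmul_eq_mul]
    have : (j : ℝ) ≤ J := by exact_mod_cast hj
    nlinarith [mul_nonneg hδ hh]
  have hmain : ∀ j ≤ J, ‖v j - u j‖ ≤ (‖v 0 - u 0‖ + c + J * h * (δ + η))
      + β * h * ∑ l ∈ Finset.range j, ‖v l - u l‖ := by
    intro j hj
    have e : v j - u j = (v j - v 0 - ∑ l ∈ Finset.range j, h • f l)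
        - (u j - u 0 - ∑ l ∈ Finset.range j, h • g l) + (v 0 - u 0)
        + ∑ l ∈ Finset.range j, h • (f l - g l) := by
      simp only [smul_sub, Finset.sum_sub_distrib]
      abel
    have h1 : ‖∑ l ∈ Finset.range j, h • (f l - g l)‖
        ≤ J * h * η + β * h * ∑ l ∈ Finset.range j, ‖v l - u l‖ := by
      refine (norm_sum_le _ _).trans ?_
      calc ∑ l ∈ Finset.range j, ‖h • (f l - g l)‖
          ≤ ∑ l ∈ Finset.range j, (h * η + β * h * ‖v l - u l‖) := by
            refine Finset.sum_le_sum fun l hl => ?_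
            rw [norm_smul, Real.norm_of_nonneg hh]
            have := mul_le_mul_of_nonneg_left
              (hfg l ((Finset.mem_range.1 hl).trans_le hj)) hh
            linarith
        _ ≤ _ := by
            rw [Finset.sum_add_distrib, Finset.sum_const, Finset.card_range, nsmul_eq_mul,
              ← Finset.mul_sum]
            have : (j : ℝ) ≤ J := by exact_mod_cast hj
            nlinarith [mul_nonneg hh hη]
    rw [e]
    have h2 := norm_add_le ((v j - v 0 - ∑ l ∈ Finset.range j, h • f l)
        - (u j - u 0 - ∑ l ∈ Finset.range j, h • g l) + (v 0 - u 0))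
        (∑ l ∈ Finset.range j, h • (f l - g l))
    have h3 := norm_add_le ((v j - v 0 - ∑ l ∈ Finset.range j, h • f l)
        - (u j - u 0 - ∑ l ∈ Finset.range j, h • g l)) (v 0 - u 0)
    have h4 := norm_sub_le (v j - v 0 - ∑ l ∈ Finset.range j, h • f l)
        (u j - u 0 - ∑ l ∈ Finset.range j, h • g l)
    linarith [hv j hj, hu' j hj]
  have hβh : 0 ≤ β * h := mul_nonneg hβ hh
  refine (discrete_gronwall hβh hmain hj).trans (mul_le_mul_of_nonneg_left ?_ (by positivity))
  have hjJ : (j : ℝ) ≤ J := by exact_mod_cast hj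
  calc (1 + β * h) ^ j ≤ Real.exp (β * h) ^ j :=
        pow_le_pow_left₀ (by linarith) (by linarith [Real.add_one_le_exp (β * h)]) _
    _ = Real.exp (j * (β * h)) := (Real.exp_nat_mul _ _).symm
    _ ≤ _ := Real.exp_le_exp.2 (by nlinarith)

/-- Along the solution the drift is uniformly continuous in time, so on a short block it is within
`δ` of its value at the left end; the mean value inequality does the rest. -/
theorem SolvesDriftEquation.eventually_step {T : ℝ} (hT : 0 < T) {d : ℕ} {lam : ℝ}
    (hlam : 0 < lam) {q₀ : L2} {x : C(Icc (0 : ℝ) T, L2)} (hx : SolvesDriftEquation d lam q₀ x)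
    {δ : ℝ} (hδ : 0 < δ) : ∀ᶠ k in atTop, ∀ j < 2 ^ k,
      ‖x (grid hT k (j + 1)) - x (grid hT k j) - (T / 2 ^ k) • drift d lam (x (grid hT k j))‖
        ≤ δ * (T / 2 ^ k) := by
  obtain ⟨X, -, hX, hXd⟩ := hx.exists_extension hT.le hlam
  have huc : UniformContinuous fun t => drift d lam (x t) :=
    CompactSpace.uniformContinuous_of_continuous ((continuous_drift d hlam).comp x.continuous)
  obtain ⟨w, hw0, hw⟩ := Metric.uniformContinuous_iff.1 huc δ hδ
  filter_upwards [(tendsto_div_two_pow T).eventually (gt_mem_nhds hw0)] with k hk j hj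
  set a := grid hT k j with ha
  set b := grid hT k (j + 1) with hb
  have hab : (a : ℝ) ≤ b := grid_mono hT k (Nat.le_succ j)
  have hsub : (b : ℝ) - a = T / 2 ^ k := grid_succ_sub hT hj
  set D := drift d lam (x a) with hD
  have hmem : ∀ s ∈ Icc (a : ℝ) b, s ∈ Icc 0 T := fun s hs =>
    ⟨a.2.1.trans hs.1, hs.2.trans b.2.2⟩
  have h := (convex_Icc (a : ℝ) b).norm_image_sub_le_of_norm_hasDerivWithin_le
    (f := fun s => X s - s • D) (f' := fun s => drift d lam (X s) - D) (C := δ)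
    (fun s hs => by
      have h2 := (hXd s (hmem s hs)).sub ((hasDerivAt_id s).smul_const D)
      rw [one_smul] at h2
      exact h2.hasDerivWithinAt)
    (fun s hs => by
      have h1 := hX ⟨s, hmem s hs⟩
      simp only at h1
      rw [h1, hD, ← dist_eq_norm]
      refine (hw ?_).le
      rw [Subtype.dist_eq, Real.dist_eq, abs_of_nonneg (by linarith [hs.1])]
      simp only
      linarith [hs.2])
    (left_mem_Icc.2 hab) (right_mem_Icc.2 hab)
  rw [Real.norm_of_nonneg (sub_nonneg.2 hab), hsub] at h
  refine le_of_eq_of_le ?_ h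
  rw [hX, hX, ← hsub, sub_smul]
  congr 1
  abel

theorem sumSq_coe (f : L2) : sumSq f = ENNReal.ofReal (‖f‖ ^ 2) := by
  rw [norm_sq_eq_tsum, ENNReal.ofReal_tsum_of_nonneg (fun i => sq_nonneg _) (summable_sq f), sumSq]

/-! ### Convergence -/

/-- On the grid, a path with small accumulated noise is close to the limit. -/
theorem Good.norm_sub_le {T : ℝ} {hT : 0 < T} {d : ℕ} {lam : ℝ} {n : ℕ} {q q₀ : L2}
    (hlam : 0 < lam) (hn0 : 0 < n) (hq : q ∈ states n)
    {μ : Measure (MarkTime T)} {x : Cadlag T L2} (hx : ∀ t, x t ∈ states n)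
    {Q : C(Icc (0 : ℝ) T, L2)} (hQ : ∀ t, Q t ∈ limitStates) (hQ0 : Q (grid hT 0 0) = q₀)
    {k : ℕ} {c ε δ : ℝ} (hc : 0 ≤ c) (hε : 0 ≤ ε) (hδ : 0 ≤ δ)
    (he : ∀ j ≤ 2 ^ k, x (grid hT k j) = euler hT d lam n ⟨q, hq⟩ k j μ)
    (hi : ∀ j < 2 ^ k, ∀ i, x (grid hT k (j + 1)) i
        = x (grid hT k j) i + incr d lam n (x (grid hT k j)) (block hT k j) μ i)
    (hm : sumSq (chain hT d lam (ENNReal.ofReal (c ^ 2)) ⟨q, hq⟩ k (2 ^ k) μ).2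
      ≤ ENNReal.ofReal (c ^ 2))
    (hε' : ∀ z ∈ states n, ‖nDrift d lam n z - drift d lam z‖ ≤ ε * ‖z‖)
    (hstep : ∀ j < 2 ^ k,
      ‖Q (grid hT k (j + 1)) - Q (grid hT k j) - (T / 2 ^ k) • drift d lam (Q (grid hT k j))‖
        ≤ δ * (T / 2 ^ k)) {j : ℕ} (hj : j ≤ 2 ^ k) :
    ‖x (grid hT k j) - Q (grid hT k j)‖
      ≤ (‖q - q₀‖ + c + T * (δ + ε * ‖Q‖)) * Real.exp ((ε + 3 * (lam * d + 1)) * T) := by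
  have hh : 0 ≤ T / 2 ^ k := by positivity
  have hJh : (2 ^ k : ℕ) * (T / 2 ^ k) = T := by
    push_cast
    field_simp
  have hm' : ∀ j ≤ 2 ^ k, sumSq (chain hT d lam (ENNReal.ofReal (c ^ 2)) ⟨q, hq⟩ k j μ).2
      ≤ ENNReal.ofReal (c ^ 2) := by
    intro j hj
    induction hj using Nat.decreasingInduction with
    | self => exact hm
    | of_succ j _ ih => exact sumSq_chain_le_of_succ ih
  have hx0 : x (grid hT k 0) = q := he 0 (Nat.zero_le _)
  have hQ0' : Q (grid hT k 0) = q₀ := by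
    rw [← hQ0]
    congr 1
    exact Subtype.ext (by rw [grid_zero, grid_zero])
  have hsum : ∀ j ≤ 2 ^ k, ∀ i, x (grid hT k j) i = q i
      + ∑ l ∈ Finset.range j, incr d lam n (x (grid hT k l)) (block hT k l) μ i := by
    intro j hj i
    induction j with
    | zero => rw [hx0]; simp
    | succ j ih => rw [hi j hj i, ih (by omega), Finset.sum_range_succ, add_assoc]
  have hv : ∀ j ≤ 2 ^ k, ‖x (grid hT k j) - x (grid hT k 0)
      - ∑ l ∈ Finset.range j, (T / 2 ^ k) • nDrift d lam n (x (grid hT k l))‖ ≤ c := by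
    intro j hj
    have h1 := hm' j hj
    -- The unfrozen chain is the path minus its starting point and minus its summed mean jumps, so
    -- its sum of squares is a squared `ℓ²` norm.
    have e : (chain hT d lam (ENNReal.ofReal (c ^ 2)) ⟨q, hq⟩ k j μ).2
        = ((x (grid hT k j) - x (grid hT k 0)
          - ∑ l ∈ Finset.range j, (T / 2 ^ k) • nDrift d lam n (x (grid hT k l)) : L2) : ℕ → ℝ) := by
      funext i
      rw [chain_snd_of_le h1, ← coordCLM_apply, map_sub, map_sub, map_sum, coordCLM_apply,
        coordCLM_apply, hsum j hj i, hx0, add_sub_cancel_left, ← Finset.sum_sub_distrib]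
      refine Finset.sum_congr rfl fun l hl => ?_
      have hl' : l ≤ 2 ^ k := (Finset.mem_range.1 hl).le.trans hj
      rw [← he l hl', coordCLM_apply, lp.coeFn_smul, Pi.smul_apply, nDrift_apply lam hn0 (hx _),
        smul_eq_mul, noise]
    rw [e, sumSq_coe, ENNReal.ofReal_le_ofReal_iff (sq_nonneg c)] at h1
    exact le_of_sq_le_sq h1 hc
  have h := euler_stability (v := fun j => x (grid hT k j)) (u := fun j => Q (grid hT k j))
    (f := fun j => nDrift d lam n (x (grid hT k j))) (g := fun j => drift d lam (Q (grid hT k j)))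
    (J := 2 ^ k) (h := T / 2 ^ k) (η := ε * ‖Q‖) (β := ε + 3 * (lam * d + 1)) hh hδ (by positivity)
    (by positivity) hc hv hstep (fun j _ => ?_) hj
  · simp only [hx0, hQ0', hJh] at h
    exact h
  · have h1 := norm_sub_le_norm_sub_add_norm_sub (nDrift d lam n (x (grid hT k j)))
      (drift d lam (x (grid hT k j))) (drift d lam (Q (grid hT k j)))
    have h2 := hε' _ (hx (grid hT k j))
    have h3 := norm_drift_sub_le_of_mem d hlam (states_subset_limitStates hn0 (hx (grid hT k j)))
      (hQ (grid hT k j))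
    -- The error `ε ‖x‖` is split into `ε ‖Q‖`, which is fixed, and `ε ‖x - Q‖`, which goes into the
    -- Grönwall rate. No a priori bound on `‖x‖` is needed.
    have h4 : ‖x (grid hT k j)‖ ≤ ‖Q‖ + ‖x (grid hT k j) - Q (grid hT k j)‖ := by
      have h5 := norm_add_le (Q (grid hT k j)) (x (grid hT k j) - Q (grid hT k j))
      rw [add_sub_cancel] at h5
      linarith [Q.norm_coe_le_norm (grid hT k j)]
    have h6 := mul_le_mul_of_nonneg_left h4 hε
    linarith

theorem edist_ofContinuous_le {T : ℝ} {x : Cadlag T L2} {Q : C(Icc (0 : ℝ) T, L2)} {η : ℝ}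
    (h : ∀ t, ‖x t - Q t‖ ≤ η) : edist x (Cadlag.ofContinuous Q) ≤ ENNReal.ofReal η := by
  refine (iInf_le _ (OrderIso.refl _)).trans (max_le (iSup_le fun t => ?_) (iSup_le fun t => ?_))
  · simp
  · rw [edist_dist, dist_eq_norm]
    exact ENNReal.ofReal_le_ofReal (h t)

/-- Fatou's lemma for events. The bad event depends on the mesh, and this bounds the event that all
sufficiently fine meshes are bad. -/
theorem measure_iUnion_iInter_le {Ω : Type*} [MeasurableSpace Ω] {P : Measure Ω} {A : ℕ → Set Ω} {b : ℝ≥0∞} (h : ∀ k, P (A k) ≤ b) :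
    P (⋃ k₀, ⋂ k, ⋂ _ : k₀ ≤ k, A k) ≤ b := by
  have hmono : Monotone fun k₀ => ⋂ k, ⋂ _ : k₀ ≤ k, A k := fun a b hab =>
    iInter_mono fun k => iInter_mono' fun hb => ⟨hab.trans hb, subset_rfl⟩
  rw [hmono.measure_iUnion]
  exact iSup_le fun k₀ => (measure_mono (iInter₂_subset k₀ le_rfl)).trans (h k₀)

variable {Ω : Type*} [MeasurableSpace Ω] {P : Measure Ω} [IsProbabilityMeasure P]

/-- Outside an event of small probability, infinitely many meshes have small noise. Along those the
grid estimate holds with the same constant, and letting the grid points decrease to `t` gives it at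
every `t`. -/
theorem measure_edist_ge_le {T : ℝ} (hT : 0 < T) {d : ℕ} {lam : ℝ} (hlam : 0 < lam) {n : ℕ}
    (hn : d ≤ n) (hn0 : 0 < n) {q q₀ : L2} (hq : q ∈ states n)
    {N : Ω → RadonMeasure (Half × MarkTime T)}
    (hN : IsPoissonRandomMeasure (intensity T) N P) {Qn : Ω → Cadlag T L2}
    (hQn : IsOccupancyProcess d lam n q N P Qn) {Q : C(Icc (0 : ℝ) T, L2)}
    (hQ : ∀ t, Q t ∈ limitStates) (hQd : SolvesDriftEquation d lam q₀ Q) {c ε δ : ℝ} (hc : 0 < c)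
    (hε : 0 ≤ ε) (hδ : 0 < δ)
    (hε' : ∀ z ∈ states n, ‖nDrift d lam n z - drift d lam z‖ ≤ ε * ‖z‖) {r : ℝ≥0∞}
    (hr : ENNReal.ofReal ((‖q - q₀‖ + c + T * (δ + ε * ‖Q‖))
      * Real.exp ((ε + 3 * (lam * d + 1)) * T)) < r) :
    P {ω | r ≤ edist (Qn ω) (Cadlag.ofContinuous Q)}
      ≤ ENNReal.ofReal (2 * (lam + 1) * T / c ^ 2 / n) := by
  have hM := isPoissonField_thin hN n
  have hQ0 : Q (grid hT 0 0) = q₀ := by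
    have h := (solvesDriftEquation_iff hT.le).1 hQd (grid hT 0 0)
    rw [grid_zero, intervalIntegral.integral_same, add_zero] at h
    exact h
  refine le_trans (measure_mono_ae ?_) (measure_iUnion_iInter_le fun k =>
    hM.measure_chain_le hT hlam hn hn0 (pow_pos hc 2) ⟨q, hq⟩ k)
  filter_upwards [hM.ae_good hT hlam, hQn] with ω hω hx hge
  rw [isOccupancyPath_iff] at hx
  by_contra hnot
  refine absurd hge (not_le.2 (lt_of_le_of_lt (edist_ofContinuous_le fun t => ?_) hr))
  obtain ⟨k₀, hk₀⟩ := hω.eventually_euler hlam hn hn0 hq hx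
  have hfreq : ∃ᶠ k in atTop,
      sumSq (chain hT d lam (ENNReal.ofReal (c ^ 2)) ⟨q, hq⟩ k (2 ^ k) (thin n (N ω)).1).2
        ≤ ENNReal.ofReal (c ^ 2) := by
    rw [Filter.frequently_atTop]
    intro a
    by_contra hall
    refine hnot (mem_iUnion.2 ⟨a, mem_iInter₂.2 fun k hk => ?_⟩)
    by_contra hle
    exact hall ⟨k, hk, not_lt.1 hle⟩
  have hlim : Tendsto (fun k => ‖Qn ω (grid hT k (gridIndex T k t)) - Q (grid hT k (gridIndex T k t))‖)
      atTop (𝓝 ‖Qn ω t - Q t‖) := by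
    have h1 := ((Qn ω).right_cont t).tendsto.comp (tendsto_grid_gridIndex hT t)
    have h2 := (Q.continuous.continuousWithinAt (s := Ici t)).tendsto.comp
      (tendsto_grid_gridIndex hT t)
    exact (h1.sub h2).norm
  refine le_of_tendsto_of_frequently hlim ?_
  refine (hfreq.and_eventually
    ((eventually_ge_atTop k₀).and (hQd.eventually_step hT hlam hδ))).mono ?_
  rintro k ⟨h1, h2, h3⟩
  exact Good.norm_sub_le hlam hn0 hq hx.mem_states hQ hQ0 hc.le hε hδ.le (hk₀ k h2).1 (hk₀ k h2).2
    h1 hε' h3 (gridIndex_le hT k t)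

theorem tendstoInMeasure_of_isOccupancyProcess {T : ℝ} (hT : 0 < T) {d : ℕ} {lam : ℝ}
    (hlam : 0 < lam) {q₀ : L2} {N : Ω → RadonMeasure (Half × MarkTime T)} {qn : ℕ → L2}
    {Qn : ℕ → Ω → Cadlag T L2} (hN : IsPoissonRandomMeasure (intensity T) N P)
    (hqn : ∀ n, d ≤ n → qn n ∈ states n) (hlim : Tendsto (fun n => ‖qn n - q₀‖) atTop (𝓝 0))
    (hQn : ∀ n, d ≤ n → IsOccupancyProcess d lam n (qn n) N P (Qn n)) {Q : C(Icc (0 : ℝ) T, L2)}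
    (hQ : ∀ t, Q t ∈ limitStates) (hQd : SolvesDriftEquation d lam q₀ Q) :
    TendstoInMeasure P Qn atTop (fun _ => Cadlag.ofContinuous Q) := by
  intro r hr
  obtain ⟨η, hη0, hηr⟩ : ∃ η : ℝ, 0 < η ∧ ENNReal.ofReal η < r := by
    obtain ⟨s, hs0, hsr⟩ := ENNReal.lt_iff_exists_nnreal_btwn.1 hr
    exact ⟨s, by exact_mod_cast hs0, by rwa [ENNReal.ofReal_coe_nnreal]⟩
  set K := 3 * (lam * d + 1) with hK
  -- Four errors (initial state, noise, discretisation, drift) are each made at most `ρ`, and `ε ≤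
  -- 1` bounds the Grönwall exponent by `(1 + K) T`; the product is `η`.
  set ρ := η / (4 * Real.exp ((1 + K) * T)) with hρ
  have hρ0 : 0 < ρ := by positivity
  set ε := min 1 (ρ / (T * (‖Q‖ + 1))) with hε
  have hQn0 : 0 ≤ ‖Q‖ := norm_nonneg Q
  have hε0 : 0 < ε := lt_min one_pos (by positivity)
  have hεQ : T * (ε * ‖Q‖) ≤ ρ := by
    have h1 : ε * (T * (‖Q‖ + 1)) ≤ ρ := (le_div_iff₀ (by positivity)).1 (min_le_right _ _)
    nlinarith [mul_pos hε0 hT]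
  have hbound : Tendsto (fun n : ℕ => ENNReal.ofReal (2 * (lam + 1) * T / ρ ^ 2 / n)) atTop
      (𝓝 0) := by
    have := ENNReal.tendsto_ofReal
      (tendsto_const_div_atTop_nhds_zero_nat (2 * (lam + 1) * T / ρ ^ 2))
    rwa [ENNReal.ofReal_zero] at this
  refine tendsto_of_tendsto_of_tendsto_of_le_of_le' tendsto_const_nhds hbound
    (Eventually.of_forall fun _ => zero_le) ?_
  filter_upwards [eventually_ge_atTop d, eventually_gt_atTop 0,
    hlim.eventually (ge_mem_nhds hρ0), eventually_norm_nDrift_sub_drift_le d hlam hε0]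
    with n hn hn0 hnρ hnε
  refine measure_edist_ge_le hT hlam hn hn0 (hqn n hn) hN (hQn n hn) hQ hQd hρ0 hε0.le
    (div_pos hρ0 hT) hnε (lt_of_le_of_lt (ENNReal.ofReal_le_ofReal ?_) hηr)
  have h1 : Real.exp ((ε + K) * T) ≤ Real.exp ((1 + K) * T) :=
    Real.exp_le_exp.2 (mul_le_mul_of_nonneg_right (by linarith [min_le_left 1 (ρ / (T * (‖Q‖ + 1)))])
      hT.le)
  have h2 : T * (ρ / T + ε * ‖Q‖) ≤ 2 * ρ := by
    rw [mul_add, mul_div_cancel₀ _ hT.ne']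
    linarith
  calc (‖qn n - q₀‖ + ρ + T * (ρ / T + ε * ‖Q‖)) * Real.exp ((ε + K) * T)
      ≤ (4 * ρ) * Real.exp ((1 + K) * T) := by
        refine mul_le_mul (by linarith) h1 (Real.exp_pos _).le (by positivity)
    _ = η := by
        rw [hρ]
        field_simp

end

end JSQ

theorem proposition2p2 (d : ℕ) (hd : 1 ≤ d) (lam : ℝ) (hlam : 0 < lam) (T : ℝ) (hT : 0 < T) :
    -- (a) the occupancy process is a measurable functional of the scaled random measure
    (∀ n : ℕ, d ≤ n → ∀ q₀ ∈ JSQ.states n,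
      ∃ 𝒢 : JSQ.RadonMeasure (JSQ.MarkTime T) → JSQ.Cadlag T JSQ.L2, Measurable 𝒢 ∧
        ∀ (Ω : Type*) [MeasurableSpace Ω] (P : Measure Ω) [IsProbabilityMeasure P]
          (N : Ω → JSQ.RadonMeasure (JSQ.Half × JSQ.MarkTime T)),
          JSQ.IsPoissonRandomMeasure (JSQ.intensity T) N P →
            JSQ.IsOccupancyProcess d lam n q₀ N P (fun ω => 𝒢 (JSQ.scaledThin n (N ω))) ∧
            ∀ Qn : Ω → JSQ.Cadlag T JSQ.L2, JSQ.IsOccupancyProcess d lam n q₀ N P Qn →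
              ∀ᵐ ω ∂P, Qn ω = 𝒢 (JSQ.scaledThin n (N ω))) ∧
    -- (b) the limit equation, the bound on its solution, and convergence in probability
    (∀ q₀ ∈ JSQ.limitStates, ∃ Q : C(Icc (0 : ℝ) T, JSQ.L2),
      JSQ.SolvesJumpEquation d lam q₀ Q ∧
      JSQ.SolvesDriftEquation d lam q₀ Q ∧
      (∀ x : C(Icc (0 : ℝ) T, JSQ.L2),
        JSQ.SolvesJumpEquation d lam q₀ x ∨ JSQ.SolvesDriftEquation d lam q₀ x → x = Q) ∧
      (∀ t : Icc (0 : ℝ) T,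
        ‖Q t‖ ^ 2 ≤ 2 * ‖q₀‖ ^ 2 * Real.exp (8 * (lam * d + 1) ^ 2 * (t : ℝ))) ∧
      ∀ (Ω : Type*) [MeasurableSpace Ω] (P : Measure Ω) [IsProbabilityMeasure P]
        (N : Ω → JSQ.RadonMeasure (JSQ.Half × JSQ.MarkTime T))
        (qn : ℕ → JSQ.L2) (Qn : ℕ → Ω → JSQ.Cadlag T JSQ.L2),
        JSQ.IsPoissonRandomMeasure (JSQ.intensity T) N P →
        (∀ n, d ≤ n → qn n ∈ JSQ.states n) →
        Tendsto (fun n => ‖qn n - q₀‖) atTop (𝓝 0) →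
        (∀ n, d ≤ n → JSQ.IsOccupancyProcess d lam n (qn n) N P (Qn n)) →
        TendstoInMeasure P Qn atTop (fun _ => JSQ.Cadlag.ofContinuous Q)) := by
  -- The assumption `1 ≤ d` serves to exclude `n = 0`; in the limit theorem large `n` are positive
  -- anyway.
  refine ⟨fun n hn q₀ hq => JSQ.exists_solution_map hT hlam hn (hd.trans hn) hq,
    fun q₀ hq => ?_⟩
  obtain ⟨Q, hQj, hQd, hQu, hQb⟩ := JSQ.exists_limit hT.le d hlam hq
  exact ⟨Q, hQj, hQd, hQu, hQb, fun Ω _ P _ N qn Qn hN hqn hlim hQn =>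
    JSQ.tendstoInMeasure_of_isOccupancyProcess hT hlam hN hqn hlim hQn hQj.mem_states hQd⟩
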